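/- **Setting.** Let $K$ be an algebraically closed field of characteristic $0$, $C=\{F=0\}\subset\mathbb P^2_K$ a smooth plane curve given by a form $F(X_0,X_1,X_2)$ of degree $d\ge 2$, $\Theta$ a nondegenerate quadratic form in two variables over $K$ with bilinear form $B$, $B(u,u)=\Theta(u)$, and $D=\{[Q_0:Q_1:Q_2] : \Theta(Q_0,Q_1)=Q_2^2\}$. For a rational correspondence $f: X\vdash Y$ of surfaces with graph $\Gamma_f\subset X\times Y$ let $\operatorname{Ind} f$ be the set of $x\in X$ for which $\{y:(x,y)\in\Gamma_f\}$ has positive dimension. The graph of the composite $g\circ f$ is (as a set) the Zariski closure of the set of all $(x,z)$ such that, for some $y$, $(x,y)\in\Gamma_f$, $(y,z)\in\Gamma_g$, $x\notin\operatorname{Ind} f$, $y\notin\operatorname{Ind} g$. Iterates $f^n$ are formed with this composition. The *secant correspondence* $s$ on $C\times D$ has as graph the Zariski closure of the set of pairs $((x,v),(x',v))$ with $x\ne x'$ in $C$ and $v=[Q_0:Q_1:Q_2]\in D$ such that $x$, $x'$, $[Q_0:Q_1:0]$ are collinear. The *reflection* $r$ on $C\times D$ is the rational map $(x,v)\mapsto(x,r_{t(x)}v)$,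 where, for $x$ and $v$ not at infinity and non-isotropic tangent vector $t(x)=\left(-\frac{\partial F}{\partial X_1}(x),\frac{\partial F}{\partial X_0}(x)\right)$, $r_\tau$ is the map of $D$ induced by the linear reflection $q\mapsto \frac{2B(\tau,q)}{\Theta(\tau)}\tau-q$ on $(Q_0,Q_1)$ (with $Q_2$ fixed). The *billiards correspondence* is $b_{C,D}=r\circ s$. For $n\ge 1$, it is *$n$-reflective* if $(x,v)\in b_{C,D}^n(x,v)$ for every $(x,v)\in C\times D$, i.e. if the graph of $b_{C,D}^n$ contains the diagonal. **Theorem.** Let $d\ge 2$. 1. Let $K=\mathbb C$, $C: (X_0-iX_1)^d+(X_0+iX_1)^d=X_2^d$ (the Fermat hyperbola) and $\Theta=q_0^2+q_1^2$. For every integer $n\ge 1$, the billiard $b_{C,D}$ is not $n$-reflective. 2. Let $C_{\mathrm{gen}}$ be the generic plane curve of degree $d$ over $\mathbb C$, that is, the curve $\sum_{|m|=d}a_mX^m=0$ with independent indeterminates $a_m$, over $K=\overline{\mathbb C(a_m : |m|=d)}$, and let $D$ be the space of unit directions of any nondegenerate quadratic form $\Theta$ with coefficients in $\mathbb C$. For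 every integer $n\ge 1$, the billiard $b_{\mathrm{gen}}: C_{\mathrm{gen}}\times D\vdash C_{\mathrm{gen}}\times D$ is not $n$-reflective. 3. Let $F\in\mathbb R[x,y]$ have degree $d$, and suppose that its $\binom{d+2}{2}$ coefficients (of all monomials of degree $\le d$) are algebraically independent over $\mathbb Q$. Let $T=\{F=0\}\subset\mathbb R^2$ and let $\Omega$ be a bounded connected component of $\mathbb R^2\setminus T$. Let $W$ be the set of inward-facing unit vectors based on $\partial\Omega$, i.e. of pairs $(x,v)$ with $x\in\partial\Omega$, $|v|=1$ and $x+sv\in\Omega$ for all small $s>0$. The classical billiard map (partially defined on $W$) sends $(x,v)$ to $(x',v')$, where $x'$ is the first point of $\partial\Omega$ on the ray $x+sv$, $s>0$, and $v'$ is the reflection of $v$ across the tangent line to $T$ at $x'$, provided that $(x',v')\in W$. Then the set of points of $W$ that are periodic under this map (of any period $n\ge 1$) has measure zero for surface area on $\partial\Omega\times S^1$, equivalently two-dimensional Hausdorff measure zero. -/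

import Mathlib

open MvPolynomial MeasureTheory

noncomputable section

/-! ## Algebraic billiards

Throughout, `K` is the (algebraically closed) base field.  A plane curve is given by a form `F` of
degree `d` in the homogeneous coordinates `X₀, X₁, X₂`, and a quadratic form `Θ` in two variables
by its symmetric Gram matrix. -/

namespace AlgBilliard

section Algebraic

variable {K : Type*} [Field K]

/-- The projective plane over `K`. -/
abbrev Plane (K : Type*) [Field K] : Type _ := Projectivization K (Fin 3 → K)

/-- Pairs `(x, v)`: a position `x = [X₀ : X₁ : X₂]` and a direction `v = [Q₀ : Q₁ : Q₂]`. -/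
abbrev Phase (K : Type*) [Field K] : Type _ := Plane K × Plane K

/-- The polynomial `f`, in one triple of variables for each factor of the product `ι → ℙ²`,
vanishes at all homogeneous coordinates of the point `p`. -/
def VanishesAt {ι : Type*} (f : MvPolynomial (ι × Fin 3) K) (p : ι → Plane K) : Prop :=
  ∀ c : ι → Kˣ, eval (fun ij => (c ij.1 : K) * (p ij.1).rep ij.2) f = 0

/-- The Zariski closure of a set of points in a product of projective planes. -/
def zariskiClosure {ι : Type*} (S : Set (ι → Plane K)) : Set (ι → Plane K) :=
  {p | ∀ f : MvPolynomial (ι × Fin 3) K, (∀ q ∈ S, VanishesAt f q) → VanishesAt f p}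

/-- A point of `(ℙ² × ℙ²) × (ℙ² × ℙ²)` as a family of four points of the plane. -/
def quadruple (z : Phase K × Phase K) : Fin 4 → Plane K :=
  ![z.1.1, z.1.2, z.2.1, z.2.2]

/-- The Zariski closure in `(ℙ² × ℙ²) × (ℙ² × ℙ²)`. -/
def graphClosure (Γ : Set (Phase K × Phase K)) : Set (Phase K × Phase K) :=
  {z | quadruple z ∈ zariskiClosure (quadruple '' Γ)}

/-- The indeterminacy locus of the correspondence with graph `Γ`: the points over which the fibre
of the first projection has positive dimension.  A fibre is a closed algebraic set, so over an
algebraically closed field it has positive dimension if and only if it is infinite. -/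
def indeterminacy (Γ : Set (Phase K × Phase K)) : Set (Phase K) :=
  {p | {q | (p, q) ∈ Γ}.Infinite}

/-- The (support of the) graph of the composite `g ∘ f` of two rational correspondences: compose
away from the indeterminacy loci of `f` and `g` and take the Zariski closure. -/
def compose (Γg Γf : Set (Phase K × Phase K)) : Set (Phase K × Phase K) :=
  graphClosure {z | ∃ y : Phase K, z.1 ∉ indeterminacy Γf ∧ y ∉ indeterminacy Γg ∧
    (z.1, y) ∈ Γf ∧ (y, z.2) ∈ Γg}

/-- The graph of the `n`-th iterate of a correspondence with graph `Γ` on the surface `S`. -/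
def iterate (S : Set (Phase K)) (Γ : Set (Phase K × Phase K)) : ℕ → Set (Phase K × Phase K)
  | 0 => {z | z.1 ∈ S ∧ z.2 = z.1}
  | n + 1 => compose Γ (iterate S Γ n)

/-- The projective plane curve `F = 0`, for a form `F`. -/
def curve (F : MvPolynomial (Fin 3) K) : Set (Plane K) :=
  {x | eval x.rep F = 0}

/-- The bilinear form `B` with `B(u, u) = Θ(u)`. -/
def bilin (Θ : Matrix (Fin 2) (Fin 2) K) (u w : Fin 2 → K) : K := u ⬝ᵥ (Θ.mulVec w)

/-- The vector part `(Q₀, Q₁)` of a triple of homogeneous coordinates. -/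
def vec (Q : Fin 3 → K) : Fin 2 → K := ![Q 0, Q 1]

/-- The compactified space of unit directions of `Θ`: the conic `Θ(Q₀, Q₁) = Q₂²`. -/
def directions (Θ : Matrix (Fin 2) (Fin 2) K) : Set (Plane K) :=
  {v | bilin Θ (vec v.rep) (vec v.rep) = v.rep 2 ^ 2}

/-- The domain `C × D` of the billiard. -/
def table (F : MvPolynomial (Fin 3) K) (Θ : Matrix (Fin 2) (Fin 2) K) : Set (Phase K) :=
  curve F ×ˢ directions Θ

/-- The relation on `C × D`: same direction `v = v'`, and `x`, `x'` and the point at infinity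
`[Q₀ : Q₁ : 0]` of slope `v` are collinear.  It contains the diagonal. -/
def secantPlus (F : MvPolynomial (Fin 3) K) (Θ : Matrix (Fin 2) (Fin 2) K) :
    Set (Phase K × Phase K) :=
  {z | z.1 ∈ table F Θ ∧ z.2 ∈ table F Θ ∧ z.1.2 = z.2.2 ∧
    Matrix.det ![z.1.1.rep, z.2.1.rep, ![z.1.2.rep 0, z.1.2.rep 1, 0]] = 0}

/-- The graph of the secant correspondence: the components of the above relation other than the
diagonal (in which the diagonal has multiplicity one). -/
def secant (F : MvPolynomial (Fin 3) K) (Θ : Matrix (Fin 2) (Fin 2) K) :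
    Set (Phase K × Phase K) :=
  graphClosure {z | z ∈ secantPlus F Θ ∧ z.1 ≠ z.2}

/-- The tangent vector `(-∂F/∂X₁, ∂F/∂X₀)` of the curve `F = 0`. -/
def tangent (F : MvPolynomial (Fin 3) K) (X : Fin 3 → K) : Fin 2 → K :=
  ![-eval X (pderiv 1 F), eval X (pderiv 0 F)]

/-- The reflection with axis the line spanned by the non-isotropic vector `τ`, orthogonal with
respect to `Θ`, that is `q ↦ 2 B(τ, q) / Θ(τ) τ - q`, in homogeneous coordinates on the space of
directions (and multiplied by `Θ(τ)`). -/
def reflectVec (Θ : Matrix (Fin 2) (Fin 2) K) (τ : Fin 2 → K) (Q : Fin 3 → K) : Fin 3 → K :=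
  let w := (2 * bilin Θ τ (vec Q)) • τ - bilin Θ τ τ • vec Q
  ![w 0, w 1, bilin Θ τ τ * Q 2]

/-- The reflection fixes the two directions whose slope is that of `τ`. -/
theorem reflectVec_self (Θ : Matrix (Fin 2) (Fin 2) K) (τ : Fin 2 → K) (a : K) :
    reflectVec Θ τ ![τ 0, τ 1, a] = bilin Θ τ τ • ![τ 0, τ 1, a] := by
  ext i
  fin_cases i <;>
    simp [reflectVec, bilin, vec, dotProduct, Matrix.mulVec, Fin.sum_univ_two] <;> ring

/-- The reflection preserves `Θ`, up to the factor coming from the homogeneous coordinates. -/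
theorem bilin_reflectVec (Θ : Matrix (Fin 2) (Fin 2) K) (hΘ : Θ.IsSymm) (τ : Fin 2 → K)
    (Q : Fin 3 → K) :
    bilin Θ (vec (reflectVec Θ τ Q)) (vec (reflectVec Θ τ Q)) =
      bilin Θ τ τ ^ 2 * bilin Θ (vec Q) (vec Q) := by
  have h : Θ 1 0 = Θ 0 1 := hΘ.apply 0 1
  simp [reflectVec, bilin, vec, dotProduct, Matrix.mulVec, Fin.sum_univ_two, h]
  ring

/-- The graph of the reflection map `(x, v) ↦ (x, r_{t(x)}(v))`: the Zariski closure of its graph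
over the pairs `(x, v)`, with `x` and `v` not at infinity, such that the tangent slope `t(x)` is not
isotropic. -/
def reflection (F : MvPolynomial (Fin 3) K) (Θ : Matrix (Fin 2) (Fin 2) K) :
    Set (Phase K × Phase K) :=
  graphClosure {z | z.1 ∈ table F Θ ∧ z.1.1.rep 2 ≠ 0 ∧ z.1.2.rep 2 ≠ 0 ∧
    bilin Θ (tangent F z.1.1.rep) (tangent F z.1.1.rep) ≠ 0 ∧
    z.2.1 = z.1.1 ∧
    ∃ h : reflectVec Θ (tangent F z.1.1.rep) z.1.2.rep ≠ 0,
      z.2.2 = Projectivization.mk K _ h}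

/-- The graph of the billiards correspondence: reflection after secant. -/
def billiard (F : MvPolynomial (Fin 3) K) (Θ : Matrix (Fin 2) (Fin 2) K) :
    Set (Phase K × Phase K) :=
  compose (reflection F Θ) (secant F Θ)

/-- The billiard `b` of the curve `F = 0` with respect to `Θ` is `n`-reflective: every point `p` of
`C × D` satisfies `p ∈ bⁿ(p)`. -/
def IsReflective (F : MvPolynomial (Fin 3) K) (Θ : Matrix (Fin 2) (Fin 2) K) (n : ℕ) : Prop :=
  ∀ p ∈ table F Θ, (p, p) ∈ iterate (table F Θ) (billiard F Θ) n

end Algebraic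

/-- The Fermat hyperbola `(X₀ - i X₁)ᵈ + (X₀ + i X₁)ᵈ = X₂ᵈ`. -/
def fermatHyperbola (d : ℕ) : MvPolynomial (Fin 3) ℂ :=
  (X 0 - C Complex.I * X 1) ^ d + (X 0 + C Complex.I * X 1) ^ d - X 2 ^ d

/-- The exponents of the monomials of degree `d` in three variables. -/
abbrev Exponents (d : ℕ) : Type :=
  {m : Fin 3 →₀ ℕ // m ∈ (Finset.univ : Finset (Fin 3)).finsuppAntidiag d}

/-- An algebraic closure of the field of rational functions, over `ℂ`, in indeterminate
coefficients of a ternary form of degree `d`. -/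
abbrev GenericField (d : ℕ) : Type :=
  AlgebraicClosure (FractionRing (MvPolynomial (Exponents d) ℂ))

/-- The generic plane curve of degree `d`: all its coefficients are distinct indeterminates. -/
def genericCurve (d : ℕ) : MvPolynomial (Fin 3) (GenericField d) :=
  ∑ m : Exponents d,
    monomial m.1 (algebraMap (MvPolynomial (Exponents d) ℂ) (GenericField d) (X m))

/-! ## The classical billiard -/

/-- The Euclidean plane. -/
abbrev E2 : Type := EuclideanSpace ℝ (Fin 2)

/-- The real plane curve `F(x, y) = 0`. -/
def realCurve (F : MvPolynomial (Fin 2) ℝ) : Set E2 :=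
  {x | eval (fun i => x i) F = 0}

/-- The gradient of `F`, normal to the curve `F = 0`. -/
def grad (F : MvPolynomial (Fin 2) ℝ) (x : E2) : E2 :=
  !₂[eval (fun i => x i) (pderiv 0 F), eval (fun i => x i) (pderiv 1 F)]

/-- The inward-facing unit vectors based on the boundary of `Ω`. -/
def inward (Ω : Set E2) : Set (E2 × E2) :=
  {w | w.1 ∈ frontier Ω ∧ ‖w.2‖ = 1 ∧
    ∃ ε > (0 : ℝ), ∀ s ∈ Set.Ioo (0 : ℝ) ε, w.1 + s • w.2 ∈ Ω}

/-- The graph of the classical billiard map of a domain `Ω` whose boundary lies on the smooth curve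
`F = 0`: from `w = (x, v)` the ball moves through `Ω` along the ray of direction `v` until its first
collision with the boundary, at `x'`, where `v` is reflected across the tangent line.
A ball that only grazes the boundary and stays in `Ω` goes on in the same direction; the map is not
defined if the reflected vector does not point into `Ω`. -/
def BilliardMap (F : MvPolynomial (Fin 2) ℝ) (Ω : Set E2) (w w' : E2 × E2) : Prop :=
  w ∈ inward Ω ∧ w' ∈ inward Ω ∧
    ∃ t > (0 : ℝ), (∀ s ∈ Set.Ioo (0 : ℝ) t, w.1 + s • w.2 ∈ Ω) ∧
      w'.1 = w.1 + t • w.2 ∧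
      w'.2 = (Submodule.span ℝ {grad F w'.1})ᗮ.reflection w.2

/-- The periodic points of the classical billiard map: the points that return to themselves after
`n ≥ 1` iterations, for some `n`.  They form a subset of the surface `inward Ω ⊂ ∂Ω × S¹`, whose
null sets for surface area are the null sets of the two-dimensional Hausdorff measure (which do not
depend on the choice among the usual bi-Lipschitz equivalent metrics of `ℝ² × ℝ²`). -/
def periodicPoints (F : MvPolynomial (Fin 2) ℝ) (Ω : Set E2) : Set (E2 × E2) :=
  {w | Relation.TransGen (BilliardMap F Ω) w w}

end AlgBilliard

end

open MvPolynomial MeasureTheory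

noncomputable section

/-! In coordinates whose axes are the isotropic directions, Θ is the product of the two coordinates
and a direction satisfies Q₀Q₁ = Q₂². A point where the curve has contact of order d with an
isotropic line is modelled by w = -uᵈ/d. On this model the billiard is repelled from the origin. Put
m = Q₂/Q₀, so that m² is the slope of the direction, and call a state escaping if |u|^(d-1) < |m|²,
that is, if the direction is steeper than the tangent. A chord from u to u' has m² = -(1/d) ∑ u'^i
u^(d-1-i), hence |u'| > |u|, and then |m|² < |u'|^(d-1). Reflection gives m m' = -u'^(d-1), so |m'|²
> |u'|^(d-1), and the new state is again escaping (`Escaping.step`). This holds for every branch of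
the correspondence, so no chain starting at u = 0, m = 1 returns to its position.

The other curves are degenerated to the model. A step satisfies polynomial equations, `NullStep`, in
which a divided difference has removed the diagonal from the secant relation. They define a closed
relation containing the billiard (`billiard_subset`). Composites of closed relations are closed,
because projections of projective varieties are closed, so a point of the graph of the n-th iterate
is the pair of ends of an actual chain (`iterate_subset_chain`). A place of the base field, with
suitable rescaling, specializes all states of a chain at once (`exists_place`), and a closed chain
from a lift of the initial state would become an impossible chain on the model (`not_closed_chain`).

For the Fermat hyperbola the degeneration is a rescaling at an isotropic tangent. For the generic
curve the constant coefficient is exchanged for a coordinate of a point of the curve; the remaining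
coefficients and that coordinate are independent and can be specialized at will. In the classical
case the same exchange applies to almost every (x, v): over the coefficients of F, x₀ and 2 cos θ
are independent off a Lebesgue null set of parameters, and this null set is carried to the phase
surface by covering the curve with countably many Lipschitz pieces. -/

namespace AlgBilliard

/-! ### Places: extending homomorphisms to algebraically closed fields. -/

/-- A nontrivial finitely generated `k`-algebra has a point in every algebraically closed extension
of `k`. -/
theorem nonempty_algHom_of_finiteType {k R Ω : Type*} [Field k] [CommRing R] [Nontrivial R]
    [Field Ω] [IsAlgClosed Ω] [Algebra k R] [Algebra k Ω] [Algebra.FiniteType k R] :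
    Nonempty (R →ₐ[k] Ω) := by
  obtain ⟨m, hm⟩ := Ideal.exists_maximal R
  let _ := Ideal.Quotient.field m
  -- Zariski's lemma: the residue field is finite over `k`, hence embeds in `Ω`.
  have : Module.Finite k (R ⧸ m) := finite_of_finite_type_of_isJacobsonRing _ _
  have : Algebra.IsAlgebraic k (R ⧸ m) := Algebra.IsAlgebraic.of_finite _ _
  exact ⟨(IsAlgClosed.lift (R := k) (M := Ω) (S := R ⧸ m)).comp (Ideal.Quotient.mkₐ k m)⟩

/-- Two homomorphisms with the same kernel to fields: the second extends, along the first, to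
finitely generated subalgebras. -/
theorem exists_extend_of_ker_eq {B κ Ω : Type*} [CommRing B] [Field κ] [Field Ω] [IsAlgClosed Ω]
    (g : B →+* κ) (φ : B →+* Ω) (h : ∀ b, g b = 0 ↔ φ b = 0) (s : Set κ) (hs : s.Finite) :
    ∃ (E : Subring κ) (ψ : E →+* Ω), s ⊆ E ∧ ∀ b, ∃ hb : g b ∈ E, ψ ⟨g b, hb⟩ = φ b := by
  set P := RingHom.ker φ
  have hP : P.IsPrime := RingHom.ker_isPrime φ
  have hgP : RingHom.ker g = P := by ext b; simp [P, h]
  let g' : B ⧸ P →+* κ := Ideal.Quotient.lift P g (fun b hb => (h b).2 hb)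
  let φ' : B ⧸ P →+* Ω := Ideal.Quotient.lift P φ (fun b hb => hb)
  have hg' : Function.Injective g' := RingHom.lift_injective_of_ker_le_ideal _ _ hgP.le
  have hφ' : Function.Injective φ' := RingHom.lift_injective_of_ker_le_ideal _ _ le_rfl
  -- Equality of the kernels embeds this one field in both `κ` and `Ω`.
  let k := FractionRing (B ⧸ P)
  let _ : Algebra k κ := (IsFractionRing.lift (K := k) hg').toAlgebra
  let _ : Algebra k Ω := (IsFractionRing.lift (K := k) hφ').toAlgebra
  have : Algebra.FiniteType k (Algebra.adjoin k s) :=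
    (Subalgebra.fg_iff_finiteType _).1 ⟨hs.toFinset, by simp⟩
  obtain ⟨χ⟩ := nonempty_algHom_of_finiteType (k := k) (Ω := Ω) (R := Algebra.adjoin k s)
  refine ⟨(Algebra.adjoin k s).toSubring, χ.toRingHom, Algebra.subset_adjoin, fun b => ?_⟩
  have e : g b = algebraMap k κ (algebraMap (B ⧸ P) k (Ideal.Quotient.mk P b)) :=
    (IsFractionRing.lift_algebraMap (K := k) hg' (Ideal.Quotient.mk P b)).symm
  refine ⟨by rw [e]; exact Subalgebra.algebraMap_mem _ _, ?_⟩
  have e2 : (⟨g b, by rw [e]; exact Subalgebra.algebraMap_mem _ _⟩ : Algebra.adjoin k s) =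
      algebraMap k _ (algebraMap (B ⧸ P) k (Ideal.Quotient.mk P b)) := Subtype.ext e
  refine (congrArg χ e2).trans ?_
  rw [AlgHom.commutes]
  exact IsFractionRing.lift_algebraMap (K := k) hφ' (Ideal.Quotient.mk P b)

/-- A homomorphism from `B` to an algebraically closed field extends to a place of `K`; a nonzero
vector can be rescaled so as to have a nonzero image, finitely many at a time. -/
theorem exists_place {B K Ω : Type*} [CommRing B] [Field K] [Field Ω] [IsAlgClosed Ω]
    (f : B →+* K) (φ : B →+* Ω) (h : ∀ b, f b = 0 → φ b = 0) {ι : Type*} [Finite ι]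
    (v : ι → Fin 3 → K) (hv : ∀ i, v i ≠ 0) :
    ∃ (E : Subring K) (ψ : E →+* Ω) (g : B →+* E) (w : ι → Fin 3 → E) (c : ι → Kˣ),
      (∀ b, (g b : K) = f b) ∧ (∀ b, ψ (g b) = φ b) ∧
      (∀ i j, (w i j : K) = c i * v i j) ∧ ∀ i, (fun j => ψ (w i j)) ≠ 0 := by
  obtain ⟨φS, hφS⟩ : ∃ φS : f.range →+* Ω, ∀ b, φS (f.rangeRestrict b) = φ b := by
    refine ⟨f.rangeRestrict.liftOfSurjective f.rangeRestrict_surjective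
      ⟨φ, fun b hb => h b ?_⟩, fun b => ?_⟩
    · simpa [RingHom.mem_ker, Subtype.ext_iff] using hb
    · exact RingHom.liftOfRightInverse_comp_apply _ _ _ _ b
  let S := f.range
  set P := RingHom.ker φS
  have hP : P.IsPrime := RingHom.ker_isPrime φS
  let R := Localization.AtPrime P
  have hunit : ∀ y : P.primeCompl, IsUnit (S.subtype y) := fun y => by
    refine IsUnit.mk0 _ fun h0 => y.2 ?_
    have : (y : S) = 0 := Subtype.ext h0
    rw [this]; exact P.zero_mem
  let F : R →+* K := IsLocalization.lift hunit
  -- A valuation ring dominating the local ring of `S` at the kernel of `φS`. Domination makes the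
  -- residue of `s` vanish exactly when `φS s` does, the equality of kernels needed to extend `φS`
  -- to residues.
  obtain ⟨A, hA, hloc⟩ := IsLocalRing.exists_factor_valuationRing F
  let q : S →+* A := (F.codRestrict A.toSubring hA).comp (algebraMap S R)
  have hq : ∀ s : S, ((q s : A) : K) = s := fun s => IsLocalization.lift_eq hunit s
  let res : A →+* IsLocalRing.ResidueField A := IsLocalRing.residue A
  have hres : ∀ s : S, res (q s) = 0 ↔ φS s = 0 := fun s => by
    rw [IsLocalRing.residue_eq_zero_iff, IsLocalRing.mem_maximalIdeal, mem_nonunits_iff]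
    have h1 : IsUnit (q s) ↔ IsUnit (algebraMap S R s) :=
      ⟨fun hu => hloc.map_nonunit _ hu, fun hu => hu.map (F.codRestrict A.toSubring hA)⟩
    rw [h1, IsLocalization.AtPrime.isUnit_to_map_iff R P s]
    simp [P, Ideal.primeCompl, RingHom.mem_ker]
  -- Division by an entry of largest valuation makes all entries integral and one of them equal to
  -- 1.
  have hscale : ∀ i, ∃ (c : Kˣ) (w : Fin 3 → A), (∀ j, (w j : K) = c * v i j) ∧ ∃ j, w j = 1 := by
    intro i
    obtain ⟨j, -, hj⟩ := Finset.exists_max_image Finset.univ (fun j => A.valuation (v i j))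
      ⟨0, Finset.mem_univ _⟩
    have hj0 : v i j ≠ 0 := fun h0 => hv i (funext fun l => by
      have := hj l (Finset.mem_univ _)
      simpa [h0] using this)
    refine ⟨(Units.mk0 _ hj0)⁻¹, fun l => ⟨(v i j)⁻¹ * v i l, ?_⟩, fun l => by simp, j, ?_⟩
    · rw [← A.valuation_le_one_iff, map_mul, map_inv₀]
      have h0 : A.valuation (v i j) ≠ 0 := by simpa using hj0
      calc _ ≤ (A.valuation (v i j))⁻¹ * A.valuation (v i j) :=
            mul_le_mul_right (hj l (Finset.mem_univ _)) _
        _ = 1 := inv_mul_cancel₀ h0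
    · exact Subtype.ext (inv_mul_cancel₀ hj0)
  choose c w hw hw1 using hscale
  -- The whole residue field need not embed in `Ω`; a finitely generated part containing the
  -- residues of the rescaled vectors suffices. Its preimage in `A` is the required ring.
  obtain ⟨E, ψ, hsE, hE⟩ := exists_extend_of_ker_eq (res.comp q) φS hres
    (Set.range fun ij : ι × Fin 3 => res (w ij.1 ij.2)) (Set.finite_range _)
  let E' : Subring A := E.comap res
  let E'' : Subring K := E'.map A.subtype
  have hmem : ∀ x : K, x ∈ E'' ↔ ∃ a : A, res a ∈ E ∧ (a : K) = x := fun x => by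
    simp [E'', E', Subring.mem_map]
  let e : E' ≃+* E'' := E'.equivMapOfInjective A.subtype Subtype.coe_injective
  let resE : E' →+* E := (res.comp E'.subtype).codRestrict E fun x => x.2
  have hqE : ∀ b, q (f.rangeRestrict b) ∈ E' := fun b => (hE _).1
  have hwE : ∀ i j, w i j ∈ E' := fun i j => hsE ⟨(i, j), rfl⟩
  let g : B →+* E' := (q.comp f.rangeRestrict).codRestrict E' hqE
  refine ⟨E'', (ψ.comp resE).comp e.symm.toRingHom, e.toRingHom.comp g,
    fun i j => e ⟨w i j, hwE i j⟩, c, fun b => ?_, fun b => ?_, fun i j => ?_, fun i hi => ?_⟩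
  · exact hq _
  · simp only [RingEquiv.toRingHom_eq_coe, RingHom.comp_apply, RingHom.coe_coe,
      RingEquiv.symm_apply_apply]
    rw [← hφS]
    exact (hE (f.rangeRestrict b)).2
  · exact hw i j
  · obtain ⟨j, hj⟩ := hw1 i
    have h1 := congrFun hi j
    simp only [RingEquiv.toRingHom_eq_coe, RingHom.comp_apply, RingHom.coe_coe,
      RingEquiv.symm_apply_apply, Pi.zero_apply] at h1
    have h2 : (⟨w i j, hwE i j⟩ : E') = 1 := Subtype.ext hj
    rw [h2, map_one, map_one] at h1
    exact one_ne_zero h1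

/-! ### Divided differences of a form along a line. -/

section DividedDifference

variable {R S : Type*} [CommRing R] [CommRing S]

/-- The restriction of `G` to the parametrized line `A + s B`. -/
def lineRestrict (G : MvPolynomial (Fin 3) R) (A B : Fin 3 → R) : Polynomial R :=
  aeval (fun i => Polynomial.C (A i) + Polynomial.C (B i) * Polynomial.X) G

/-- The divided difference `(G(A + s B) - G(A)) / s`. -/
def divDiff (G : MvPolynomial (Fin 3) R) (A B : Fin 3 → R) (s : R) : R :=
  (lineRestrict G A B).divX.eval s

theorem eval_lineRestrict (G : MvPolynomial (Fin 3) R) (A B : Fin 3 → R) (s : R) :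
    (lineRestrict G A B).eval s = eval (A + s • B) G := by
  induction G using MvPolynomial.induction_on with
  | C a => simp [lineRestrict]
  | add p q hp hq => simp_all [lineRestrict]
  | mul_X p i hp =>
    have h : lineRestrict (p * X i) A B =
        lineRestrict p A B * (Polynomial.C (A i) + Polynomial.C (B i) * Polynomial.X) := by
      simp [lineRestrict]
    rw [h, Polynomial.eval_mul, hp]
    simp [mul_comm s]

theorem mul_divDiff (G : MvPolynomial (Fin 3) R) (A B : Fin 3 → R) (s : R) :
    s * divDiff G A B s = eval (A + s • B) G - eval A G := by
  have h := congrArg (Polynomial.eval s) (Polynomial.divX_mul_X_add (lineRestrict G A B))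
  have h0 := eval_lineRestrict G A B 0
  rw [eval_lineRestrict] at h
  rw [← Polynomial.coeff_zero_eq_eval_zero, zero_smul, add_zero] at h0
  rw [← h, ← h0, divDiff]
  simp
  ring

theorem map_lineRestrict (φ : R →+* S) (G : MvPolynomial (Fin 3) R) (A B : Fin 3 → R) :
    (lineRestrict G A B).map φ = lineRestrict (map φ G) (φ ∘ A) (φ ∘ B) := by
  induction G using MvPolynomial.induction_on with
  | C a => simp [lineRestrict]
  | add p q hp hq => simp_all [lineRestrict]
  | mul_X p i hp => simp_all [lineRestrict]

theorem map_divDiff (φ : R →+* S) (G : MvPolynomial (Fin 3) R) (A B : Fin 3 → R) (s : R) :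
    φ (divDiff G A B s) = divDiff (map φ G) (φ ∘ A) (φ ∘ B) (φ s) := by
  have h : (lineRestrict G A B).divX.map φ = (lineRestrict (map φ G) (φ ∘ A) (φ ∘ B)).divX := by
    ext n
    rw [← map_lineRestrict]
    simp
  rw [divDiff, divDiff, ← h, Polynomial.eval_map_apply]

theorem divDiff_of_lineRestrict_eq {G : MvPolynomial (Fin 3) R} {A B : Fin 3 → R}
    {p : Polynomial R} {r : R} (h : lineRestrict G A B = p * Polynomial.X + Polynomial.C r)
    (s : R) :
    divDiff G A B s = p.eval s := by
  have : (lineRestrict G A B).divX = p := by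
    rw [h]; ext n; simp
  rw [divDiff, this]

theorem eval_smul_of_isHomogeneous {σ : Type*} {d : ℕ} {G : MvPolynomial σ R}
    (hG : G.IsHomogeneous d) (c : R) (A : σ → R) : eval (c • A) G = c ^ d * eval A G := by
  rw [eval_eq, eval_eq, Finset.mul_sum]
  refine Finset.sum_congr rfl fun m hm => ?_
  have hd : ∑ i ∈ m.support, m i = d := by
    have := hG (mem_support_iff.1 hm)
    simpa [Finsupp.weight_apply, Finsupp.sum] using this
  simp only [Pi.smul_apply, smul_eq_mul, mul_pow, Finset.prod_mul_distrib,
    Finset.prod_pow_eq_pow_sum,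
    hd]
  ring

/-- Since G(sB) = G(B)sᵈ, the divided difference is G(B)s^(d-1), which vanishes at 0 because d ≥ 2.
This settles the degenerate base point in `secantEqs_eq_zero`. -/
theorem divDiff_zero_zero {d : ℕ} (hd : 2 ≤ d) {G : MvPolynomial (Fin 3) R}
    (hG : G.IsHomogeneous d) (B : Fin 3 → R) : divDiff G 0 B 0 = 0 := by
  have h : lineRestrict G 0 B = Polynomial.C (eval B G) * Polynomial.X ^ d := by
    have h1 : (fun i => Polynomial.C ((0 : Fin 3 → R) i) + Polynomial.C (B i) * Polynomial.X) =
        (Polynomial.X : Polynomial R) • (Polynomial.C ∘ B) := by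
      ext1 i; simp [Polynomial.X_mul_C]
    have h2 := eval_smul_of_isHomogeneous (hG.map (Polynomial.C : R →+* Polynomial R))
      Polynomial.X (Polynomial.C ∘ B)
    rw [eval_map, eval_map] at h2
    rw [lineRestrict, h1]
    refine Eq.trans ?_ (h2.trans ?_)
    · rfl
    · rw [mul_comm]
      congr 1
      exact (MvPolynomial.eval₂_comp_left Polynomial.C (RingHom.id R) B G).symm
  obtain ⟨e, rfl⟩ := Nat.exists_eq_add_of_le' hd
  rw [divDiff_of_lineRestrict_eq (p := Polynomial.C (eval B G) * Polynomial.X ^ (e + 1)) (r := 0)]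
  · simp
  · rw [h]; simp; ring

end DividedDifference

/-! ### The equations of a billiard step in isotropic coordinates. -/

section NullStep

variable {R S : Type*} [CommRing R] [CommRing S]

/-- The equations of the secant correspondence from `(X, Q)` to `(X', Q)`, in coordinates in which
the isotropic directions are the axes. -/
def secantEqs (G : MvPolynomial (Fin 3) R) (X Q X' : Fin 3 → R) : Fin 3 → R :=
  ![eval X' G,
    Q 0 * (X 2 * X' 1 - X' 2 * X 1) - Q 1 * (X 2 * X' 0 - X' 2 * X 0),
    -- By the preceding equation, moving from X'₂Q₀ X along (Q₀, Q₁, 0) by the parameter X₂X'₀ -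
    -- X'₂X₀ leads to X₂Q₀ X'. Dividing the difference of the values of G by this parameter removes
    -- the diagonal, without denominators.
    divDiff G ((X' 2 * Q 0) • X) ![Q 0, Q 1, 0] (X 2 * X' 0 - X' 2 * X 0)]

/-- The equations of the reflection from `(X, Q)` to `(X, Q')`, in coordinates in which the
isotropic directions are the axes. -/
def reflectEqs (G : MvPolynomial (Fin 3) R) (X Q Q' : Fin 3 → R) : Fin 3 → R :=
  ![Q' 0 * Q' 1 - Q' 2 ^ 2,
    -- For a tangent vector (α, β) the reflected direction is (α²Q₁, β²Q₀, αβQ₂) up to a factor.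
    -- Eliminating it with α ∂₀G + β ∂₁G = 0 and Q₀Q₁ = Q₂² leaves equations linear in Q, in Q' and
    -- in the gradient.
    eval X (pderiv 0 G) * (Q 0 * Q' 0) + eval X (pderiv 1 G) * (Q 2 * Q' 2),
    eval X (pderiv 1 G) * (Q 1 * Q' 1) + eval X (pderiv 0 G) * (Q 2 * Q' 2)]

theorem map_eval_comp {σ : Type*} (φ : R →+* S) (G : MvPolynomial σ R) (A : σ → R) :
    φ (eval A G) = eval (φ ∘ A) (map φ G) := by
  rw [eval_map]
  exact eval₂_comp_left φ (RingHom.id R) A G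

theorem map_secantEqs (φ : R →+* S) (G : MvPolynomial (Fin 3) R) (X Q X' : Fin 3 → R) (k : Fin 3) :
    φ (secantEqs G X Q X' k) = secantEqs (map φ G) (φ ∘ X) (φ ∘ Q) (φ ∘ X') k := by
  have h : φ ∘ ![Q 0, Q 1, 0] = ![φ (Q 0), φ (Q 1), 0] := by
    ext i; fin_cases i <;> simp
  have h' : φ ∘ ((X' 2 * Q 0) • X) = (φ (X' 2) * φ (Q 0)) • (φ ∘ X) := by
    ext i; simp
  fin_cases k <;> simp [secantEqs, map_eval_comp, map_divDiff, h, h']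

theorem map_reflectEqs (φ : R →+* S) (G : MvPolynomial (Fin 3) R) (X Q Q' : Fin 3 → R) (k : Fin 3) :
    φ (reflectEqs G X Q Q' k) = reflectEqs (map φ G) (φ ∘ X) (φ ∘ Q) (φ ∘ Q') k := by
  fin_cases k <;> simp [reflectEqs, map_eval_comp, pderiv_map]

/-- One step of the billiard, in coordinates in which the isotropic directions are the axes. -/
def NullStep (G : MvPolynomial (Fin 3) R) (X Q X' Q' : Fin 3 → R) : Prop :=
  secantEqs G X Q X' = 0 ∧ reflectEqs G X' Q Q' = 0

theorem NullStep.map {G : MvPolynomial (Fin 3) R} {X Q X' Q' : Fin 3 → R}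
    (h : NullStep G X Q X' Q') (φ : R →+* S) :
    NullStep (MvPolynomial.map φ G) (φ ∘ X) (φ ∘ Q) (φ ∘ X') (φ ∘ Q') :=
  ⟨funext fun k => by simp [← map_secantEqs, h.1], funext fun k => by simp [← map_reflectEqs, h.2]⟩

theorem NullStep.of_map {G : MvPolynomial (Fin 3) R} {X Q X' Q' : Fin 3 → R} (φ : R →+* S)
    (hφ : Function.Injective φ)
    (h : NullStep (MvPolynomial.map φ G) (φ ∘ X) (φ ∘ Q) (φ ∘ X') (φ ∘ Q')) :
    NullStep G X Q X' Q' :=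
  ⟨funext fun k => hφ (by simp [map_secantEqs, h.1]),
    funext fun k => hφ (by simp [map_reflectEqs, h.2])⟩

end NullStep

/-! ### The model curve: its billiard runs away from the origin. -/

section Model

/-- The curve `w = -uᵈ / d`, the model of a curve near a point of order `d` contact with an
isotropic line. -/
def modelCurve (R : Type*) [CommRing R] (d : ℕ) : MvPolynomial (Fin 3) R :=
  X 0 ^ d + (d : MvPolynomial (Fin 3) R) * (X 1 * X 2 ^ (d - 1))

theorem divDiff_modelCurve {R : Type*} [CommRing R] {d : ℕ} (A B : Fin 3 → R) (hB : B 2 = 0)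
    (s : R) :
    divDiff (modelCurve R d) A B s =
      B 0 * ∑ i ∈ Finset.range d, (A 0 + s * B 0) ^ i * A 0 ^ (d - 1 - i) +
        d * (B 1 * A 2 ^ (d - 1)) := by
  rw [divDiff_of_lineRestrict_eq (r := A 0 ^ d + d * (A 1 * A 2 ^ (d - 1)))
    (p := Polynomial.C (B 0) * ∑ i ∈ Finset.range d,
      (Polynomial.C (A 0) + Polynomial.C (B 0) * Polynomial.X) ^ i *
        Polynomial.C (A 0) ^ (d - 1 - i) +
      (d : Polynomial R) * (Polynomial.C (B 1) * Polynomial.C (A 2) ^ (d - 1)))]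
  · simp [Polynomial.eval_finsetSum, mul_comm s]
  · have h := (Commute.all (Polynomial.C (A 0) + Polynomial.C (B 0) * Polynomial.X)
      (Polynomial.C (A 0))).geom_sum₂_mul d
    simp only [lineRestrict, modelCurve, map_add, map_mul, map_pow, aeval_X, hB, map_zero, zero_mul,
      add_zero, map_natCast]
    linear_combination (-1 : Polynomial R) * h

/-- The states from which the ball runs away from the point of contact. -/
structure Escaping (d : ℕ) (X Q : Fin 3 → ℂ) : Prop where
  ne₂ : X 2 ≠ 0
  ne₀ : Q 0 ≠ 0
  conic : Q 0 * Q 1 = Q 2 ^ 2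
  -- With u = X₀/X₂ the tangent has slope -u^(d-1), and the direction has slope Q₁/Q₀ = (Q₂/Q₀)².
  lt : ‖X 0 / X 2‖ ^ (d - 1) < ‖Q 2 / Q 0‖ ^ 2

theorem norm_geom_sum₂_le {d : ℕ} {x y : ℂ} (h : ‖x‖ ≤ ‖y‖) :
    ‖∑ i ∈ Finset.range d, x ^ i * y ^ (d - 1 - i)‖ ≤ d * ‖y‖ ^ (d - 1) := by
  calc _ ≤ ∑ i ∈ Finset.range d, ‖y‖ ^ (d - 1) := by
        refine norm_sum_le_of_le _ fun i hi => ?_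
        rw [Finset.mem_range] at hi
        calc ‖x ^ i * y ^ (d - 1 - i)‖ ≤ ‖y‖ ^ i * ‖y‖ ^ (d - 1 - i) := by
              rw [norm_mul, norm_pow, norm_pow]; gcongr
          _ = ‖y‖ ^ (d - 1) := by rw [← pow_add]; congr 1; omega
    _ = _ := by simp

theorem norm_geom_sum₂_lt {d : ℕ} (hd : 2 ≤ d) {x y : ℂ} (h : ‖x‖ < ‖y‖) :
    ‖∑ i ∈ Finset.range d, x ^ i * y ^ (d - 1 - i)‖ < d * ‖y‖ ^ (d - 1) := by
  have hy : 0 < ‖y‖ := (norm_nonneg _).trans_lt h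
  calc _ ≤ ∑ i ∈ Finset.range d, ‖x‖ ^ i * ‖y‖ ^ (d - 1 - i) :=
        norm_sum_le_of_le _ fun i _ => by rw [norm_mul, norm_pow, norm_pow]
    _ < ∑ i ∈ Finset.range d, ‖y‖ ^ (d - 1) := by
        have key : ∀ i ∈ Finset.range d, ‖y‖ ^ i * ‖y‖ ^ (d - 1 - i) = ‖y‖ ^ (d - 1) :=
          fun i hi => by
            rw [Finset.mem_range] at hi
            rw [← pow_add]; congr 1; omega
        refine Finset.sum_lt_sum (fun i hi => ?_) ⟨1, Finset.mem_range.2 hd, ?_⟩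
        · rw [← key i hi]; gcongr
        · rw [← key 1 (Finset.mem_range.2 hd)]
          gcongr
    _ = _ := by simp

/-- The squared ratio m² is the slope of the chord, minus the mean of the d monomials u'^i
u^(d-1-i). If |u'| ≤ |u|, it would be at most |u|^(d-1), contrary to escape; so |u| < |u'|.
Reflection replaces m by m' with m m' = -u'^(d-1), which puts |m'|² above |u'|^(d-1) exactly because
|m|² is below it. -/
theorem Escaping.step {d : ℕ} (hd : 2 ≤ d) {X Q X' Q' : Fin 3 → ℂ} (h : Escaping d X Q)
    (hX' : X' ≠ 0) (hQ' : Q' ≠ 0) (hs : NullStep (modelCurve ℂ d) X Q X' Q') :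
    Escaping d X' Q' ∧ ‖X 0 / X 2‖ < ‖X' 0 / X' 2‖ := by
  obtain ⟨hX2, hQ0, hQ, hlt⟩ := h
  have hd0 : (d : ℂ) ≠ 0 := by exact_mod_cast (by omega : d ≠ 0)
  have hdR : (0 : ℝ) < d := by exact_mod_cast (by omega : 0 < d)
  have hcol := congrFun hs.1 1
  have hdd := congrFun hs.1 2
  have hcon := congrFun hs.2 0
  have hr0 := congrFun hs.2 1
  have hr1 := congrFun hs.2 2
  simp only [secantEqs, reflectEqs, Matrix.cons_val, Pi.zero_apply] at hcol hdd hcon hr0 hr1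
  rw [divDiff_modelCurve _ _ (by simp)] at hdd
  simp only [Pi.smul_apply, smul_eq_mul, Matrix.cons_val] at hdd
  -- At infinity the base point of the divided difference is 0, so only the term i = d - 1 survives.
  -- It forces X'₀ = 0, and collinearity then forces X'₁ = 0.
  have hX'2 : X' 2 ≠ 0 := by
    intro h0
    simp only [h0, zero_mul, sub_zero, zero_add] at hdd hcol
    rw [Finset.sum_eq_single (d - 1), Nat.sub_self, pow_zero,
      zero_pow (n := d - 1) (by omega)] at hdd
    · have h00 : X' 0 = 0 := by simpa [hQ0, hX2, show d - 1 ≠ 0 by omega] using hdd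
      have h01 : X' 1 = 0 := by simpa [h00, hQ0, hX2] using hcol
      exact hX' (funext fun i => by fin_cases i <;> simp [h0, h00, h01])
    · intro i hi hne
      rw [Finset.mem_range] at hi
      rw [zero_pow (n := d - 1 - i) (by omega), mul_zero]
    · simp; omega
  obtain ⟨u, hu⟩ : ∃ u, u = X 0 / X 2 := ⟨_, rfl⟩
  obtain ⟨u', hu'⟩ : ∃ u', u' = X' 0 / X' 2 := ⟨_, rfl⟩
  obtain ⟨m, hm⟩ : ∃ m, m = Q 2 / Q 0 := ⟨_, rfl⟩
  have eX0 : X 0 = u * X 2 := by rw [hu]; field_simp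
  have eX'0 : X' 0 = u' * X' 2 := by rw [hu']; field_simp
  have eQ2 : Q 2 = m * Q 0 := by rw [hm]; field_simp
  have eQ1 : Q 1 = m ^ 2 * Q 0 := by
    apply mul_left_cancel₀ hQ0; rw [hQ, eQ2]; ring
  rw [← hu, ← hm] at hlt
  have hm0 : m ≠ 0 := by
    rintro rfl
    rw [norm_zero, zero_pow two_ne_zero] at hlt
    exact absurd hlt (not_lt.2 (by positivity))
  have hP : ∑ i ∈ Finset.range d, u' ^ i * u ^ (d - 1 - i) = -d * m ^ 2 := by
    have e : ∀ i ∈ Finset.range d, (X' 2 * Q 0 * X 0 + (X 2 * X' 0 - X' 2 * X 0) * Q 0) ^ i *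
        (X' 2 * Q 0 * X 0) ^ (d - 1 - i) =
        (X' 2 * Q 0 * X 2) ^ (d - 1) * (u' ^ i * u ^ (d - 1 - i)) := fun i hi => by
      rw [Finset.mem_range] at hi
      have e1 : X' 2 * Q 0 * X 0 + (X 2 * X' 0 - X' 2 * X 0) * Q 0 = (X' 2 * Q 0 * X 2) * u' := by
        rw [eX'0]; ring
      have e2 : X' 2 * Q 0 * X 0 = (X' 2 * Q 0 * X 2) * u := by rw [eX0]; ring
      have e3 : (X' 2 * Q 0 * X 2) ^ (d - 1) =
          (X' 2 * Q 0 * X 2) ^ i * (X' 2 * Q 0 * X 2) ^ (d - 1 - i) := by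
        rw [← pow_add]; congr 1; omega
      rw [e1, e2, mul_pow, mul_pow, e3]; ring
    rw [Finset.sum_congr rfl e, ← Finset.mul_sum, eQ1] at hdd
    have hne : Q 0 * (X' 2 * Q 0 * X 2) ^ (d - 1) ≠ 0 :=
      mul_ne_zero hQ0 (pow_ne_zero _ (mul_ne_zero (mul_ne_zero hX'2 hQ0) hX2))
    apply mul_left_cancel₀ hne
    linear_combination hdd
  have hgrow : ‖u‖ < ‖u'‖ := by
    by_contra hle
    have h1 := norm_geom_sum₂_le (d := d) (not_lt.1 hle)
    rw [hP, norm_mul, norm_neg, Complex.norm_natCast, norm_pow] at h1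
    exact absurd (le_of_mul_le_mul_left h1 hdR) (not_le.2 hlt)
  have hu0 : u' ≠ 0 := by
    rintro rfl
    rw [norm_zero] at hgrow
    exact absurd hgrow (not_lt.2 (norm_nonneg _))
  have ha : eval X' (pderiv 1 (modelCurve ℂ d)) = d * X' 2 ^ (d - 1) := by
    simp [modelCurve, Derivation.leibniz, Derivation.leibniz_pow]
  have hb : eval X' (pderiv 0 (modelCurve ℂ d)) = d * X' 0 ^ (d - 1) := by
    simp [modelCurve, Derivation.leibniz, Derivation.leibniz_pow]
  rw [ha, hb, eX'0, eQ2] at hr0 hr1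
  rw [eQ1] at hr1
  have hr0' : u' ^ (d - 1) * Q' 0 + m * Q' 2 = 0 := by
    have : (d : ℂ) * X' 2 ^ (d - 1) * Q 0 ≠ 0 :=
      mul_ne_zero (mul_ne_zero hd0 (pow_ne_zero _ hX'2)) hQ0
    apply mul_left_cancel₀ this
    rw [mul_pow] at hr0
    linear_combination hr0
  have hr1' : m * Q' 1 + u' ^ (d - 1) * Q' 2 = 0 := by
    have : (d : ℂ) * X' 2 ^ (d - 1) * Q 0 * m ≠ 0 :=
      mul_ne_zero (mul_ne_zero (mul_ne_zero hd0 (pow_ne_zero _ hX'2)) hQ0) hm0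
    apply mul_left_cancel₀ this
    rw [mul_pow] at hr1
    linear_combination hr1
  have hQ'0 : Q' 0 ≠ 0 := by
    intro h0
    have h2 : Q' 2 = 0 := by simpa [h0, hm0] using hr0'
    have h1 : Q' 1 = 0 := by simpa [h2, hm0] using hr1'
    exact hQ' (funext fun i => by fin_cases i <;> simp [h0, h1, h2])
  have hm' : m * (Q' 2 / Q' 0) = -u' ^ (d - 1) := by
    field_simp
    linear_combination hr0'
  refine ⟨⟨hX'2, hQ'0, sub_eq_zero.1 hcon, ?_⟩, by rw [← hu, ← hu']; exact hgrow⟩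
  rw [← hu']
  -- The sum is symmetric in u and u', so the strict bound applies with the larger |u'| as majorant
  -- and gives |m|² < |u'|^(d-1). The product |m|²|m'|² = |u'|^(2(d-1)) then makes |m'|² larger.
  have h2 := norm_geom_sum₂_lt (d := d) hd hgrow
  have hsymm : ∑ i ∈ Finset.range d, u ^ i * u' ^ (d - 1 - i) = -d * m ^ 2 := by
    rw [← hP, ← Finset.sum_range_reflect]
    refine Finset.sum_congr rfl fun i hi => ?_
    rw [Finset.mem_range] at hi
    rw [show d - 1 - (d - 1 - i) = i by omega, mul_comm]
  rw [hsymm, norm_mul, norm_neg, Complex.norm_natCast, norm_pow] at h2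
  have h3 : ‖m‖ ^ 2 < ‖u'‖ ^ (d - 1) := lt_of_mul_lt_mul_left h2 hdR.le
  have h4 : ‖m‖ ^ 2 * ‖Q' 2 / Q' 0‖ ^ 2 = ‖u'‖ ^ (d - 1) * ‖u'‖ ^ (d - 1) := by
    rw [← mul_pow, ← norm_mul, hm', norm_neg, norm_pow]; ring
  have h5 : 0 < ‖m‖ ^ 2 := by positivity
  by_contra hcon'
  have hU : 0 < ‖u'‖ ^ (d - 1) := h5.trans h3
  have h6 := mul_le_mul_of_nonneg_left (not_lt.1 hcon') h5.le
  have h7 := mul_lt_mul_of_pos_right h3 hU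
  linarith

end Model

/-! ### Specialization of closed chains to the model curve. -/

/-- A chain of billiard steps that specializes to the model curve, starting at the origin in a
direction which is not isotropic, does not return to its starting position. -/
theorem not_closed_chain {B K : Type*} [CommRing B] [Field K] (f : B →+* K) (φ : B →+* ℂ)
    (hfφ : ∀ b, f b = 0 → φ b = 0) {d : ℕ} (hd : 2 ≤ d) {G : MvPolynomial (Fin 3) B}
    (hG : map φ G = modelCurve ℂ d) {X₀ Q₀ : Fin 3 → B} (hX₀ : φ ∘ X₀ = ![0, 0, 1])
    (hQ₀ : φ ∘ Q₀ = ![1, 1, 1]) {n : ℕ} (hn : 1 ≤ n) (X Q : ℕ → Fin 3 → K)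
    (hX : ∀ i, X i ≠ 0) (hQ : ∀ i, Q i ≠ 0)
    (hstep : ∀ i < n, ∀ c : Fin 4 → Kˣ, NullStep (map f G) ((c 0 : K) • X i) ((c 1 : K) • Q i)
      ((c 2 : K) • X (i + 1)) ((c 3 : K) • Q (i + 1)))
    (h0X : ∀ j k, X 0 j * f (X₀ k) = X 0 k * f (X₀ j))
    (h0Q : ∀ j k, Q 0 j * f (Q₀ k) = Q 0 k * f (Q₀ j))
    (hnX : ∀ j k, X n j * f (X₀ k) = X n k * f (X₀ j)) : False := by
  obtain ⟨E, ψ, g, w, c, hg, hψ, hw, hw0⟩ := exists_place f φ hfφ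
    (Sum.elim (fun i : Fin (n + 1) => X i) (fun i : Fin (n + 1) => Q i))
    (by rintro (i | i) <;> simp [hX, hQ])
  let ix : ℕ → Fin (n + 1) := Fin.ofNat (n + 1)
  have hix : ∀ i ≤ n, ((ix i : Fin (n + 1)) : ℕ) = i := fun i hi => by
    simp [ix, Nat.mod_eq_of_lt (Nat.lt_succ_of_le hi)]
  have hwX : ∀ i ≤ n, ∀ j, (w (.inl (ix i)) j : K) = c (.inl (ix i)) * X i j := fun i hi j => by
    rw [hw, Sum.elim_inl, hix i hi]
  have hwQ : ∀ i ≤ n, ∀ j, (w (.inr (ix i)) j : K) = c (.inr (ix i)) * Q i j := fun i hi j => by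
    rw [hw, Sum.elim_inr, hix i hi]
  -- Proportionality to a vector over `B` is expressed by 2 × 2 minors, so it survives both the
  -- rescaling and the specialization.
  have minor : ∀ (a : Fin (n + 1) ⊕ Fin (n + 1)) (Y : Fin 3 → K) (Y₀ : Fin 3 → B),
      (∀ j, (w a j : K) = c a * Y j) → (∀ j k, Y j * f (Y₀ k) = Y k * f (Y₀ j)) →
      ∀ j k, ψ (w a j) * φ (Y₀ k) = ψ (w a k) * φ (Y₀ j) := fun a Y Y₀ h1 h2 j k => by
    rw [← hψ, ← hψ, ← map_mul, ← map_mul]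
    congr 1
    apply Subtype.ext
    push_cast
    rw [h1, h1, hg, hg, mul_assoc, mul_assoc, h2]
  have hX₀' : ∀ j, φ (X₀ j) = (![0, 0, 1] : Fin 3 → ℂ) j := fun j => congrFun hX₀ j
  have hQ₀' : ∀ j, φ (Q₀ j) = (![1, 1, 1] : Fin 3 → ℂ) j := fun j => congrFun hQ₀ j
  have hmap : map E.subtype (map g G) = map f G := by
    rw [map_map]; exact congrArg (fun h => map h G) (RingHom.ext hg)
  have hmap' : map ψ (map g G) = modelCurve ℂ d := by
    rw [map_map, ← hG]; exact congrArg (fun h => map h G) (RingHom.ext hψ)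
  have step : ∀ i < n, NullStep (modelCurve ℂ d) (ψ ∘ w (.inl (ix i))) (ψ ∘ w (.inr (ix i)))
      (ψ ∘ w (.inl (ix (i + 1)))) (ψ ∘ w (.inr (ix (i + 1)))) := fun i hi => by
    rw [← hmap']
    refine NullStep.map (NullStep.of_map E.subtype Subtype.coe_injective ?_) ψ
    rw [hmap]
    -- The scalars are known only once the place is chosen; this is why `hstep` is assumed for all
    -- of them.
    convert hstep i hi ![c (.inl (ix i)), c (.inr (ix i)), c (.inl (ix (i + 1))),
      c (.inr (ix (i + 1)))] using 1
    · ext j; exact hwX i hi.le j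
    · ext j; exact hwQ i hi.le j
    · ext j; exact hwX (i + 1) hi j
    · ext j; exact hwQ (i + 1) hi j
  -- The initial state has u = 0 and m = 1, so escape reads 0 < 1 there. From the first step on |u|
  -- is positive by strict growth, whereas closure of the chain would make u vanish at step n.
  have main : ∀ i ≤ n, Escaping d (ψ ∘ w (.inl (ix i))) (ψ ∘ w (.inr (ix i))) ∧
      (1 ≤ i → 0 < ‖ψ (w (.inl (ix i)) 0) / ψ (w (.inl (ix i)) 2)‖) := by
    intro i
    induction i with
    | zero =>
      intro _
      refine ⟨?_, fun h => absurd h (by norm_num)⟩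
      have m1 := minor _ _ X₀ (hwX 0 n.zero_le) h0X
      have m2 := minor _ _ Q₀ (hwQ 0 n.zero_le) h0Q
      simp only [hX₀', hQ₀'] at m1 m2
      have a0 := m1 0 2
      have a1 := m1 1 2
      have b1 := m2 1 0
      have b2 := m2 2 0
      simp only [Matrix.cons_val, mul_one, mul_zero] at a0 a1 b1 b2
      have a2 : ψ (w (.inl (ix 0)) 2) ≠ 0 := fun h => hw0 (.inl (ix 0)) <| funext fun j => by
        fin_cases j <;> simp [a0, a1, h]
      have b0 : ψ (w (.inr (ix 0)) 0) ≠ 0 := fun h => hw0 (.inr (ix 0)) <| funext fun j => by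
        fin_cases j <;> simp [b1, b2, h]
      refine ⟨a2, b0, ?_, ?_⟩
      · simp only [Function.comp_apply, b1, b2]; ring
      · simp only [Function.comp_apply, b2, a0, div_self b0, zero_div, norm_zero, norm_one]
        rw [zero_pow (by omega)]
        norm_num
    | succ i ih =>
      intro hi
      obtain ⟨h1, h2⟩ := (ih (by omega)).1.step hd (hw0 (.inl (ix (i + 1))))
        (hw0 (.inr (ix (i + 1)))) (step i hi)
      exact ⟨h1, fun _ => (norm_nonneg _).trans_lt h2⟩
  have h := (main n le_rfl).2 hn
  have m1 := minor _ _ X₀ (hwX n le_rfl) hnX 0 2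
  simp only [hX₀', Matrix.cons_val, mul_one, mul_zero] at m1
  rw [m1] at h
  simp at h

/-! ### Zariski closures, and closedness of composite correspondences. -/

section Closure

variable {K : Type*} [Field K]

theorem graphClosure_mono {Γ Γ' : Set (Phase K × Phase K)} (h : Γ ⊆ Γ') :
    graphClosure Γ ⊆ graphClosure Γ' :=
  fun _ hz f hf => hz f fun q hq => hf q (Set.image_mono h hq)

theorem mem_graphClosure_iff {Γ : Set (Phase K × Phase K)} {z : Phase K × Phase K} :
    z ∈ graphClosure Γ ↔ ∀ f : MvPolynomial (Fin 4 × Fin 3) K,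
      (∀ q ∈ Γ, VanishesAt f (quadruple q)) → VanishesAt f (quadruple z) := by
  simp only [graphClosure, zariskiClosure, Set.mem_ofPred_eq, Set.forall_mem_image]

/-- Pointwise nonvanishing yields a relation ∑ cⱼ rⱼ = 1 in the product ring, which every ring
homomorphism preserves. -/
theorem image_ne_zero_of_pointwise {I L : Type*} [Field L] (π : (I → K) →+* L)
    (r : I → Fin 3 → K) (hr : ∀ s, r s ≠ 0) : (fun j => π fun s => r s j) ≠ 0 := by
  intro h
  have hc : ∀ s, ∃ c : Fin 3 → K, ∑ j, c j * r s j = 1 := fun s => by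
    obtain ⟨j, hj⟩ := Function.ne_iff.1 (hr s)
    refine ⟨Pi.single j (r s j)⁻¹, ?_⟩
    simp only [Pi.single_apply, ite_mul, zero_mul, Finset.sum_ite_eq', Finset.mem_univ, if_true]
    exact inv_mul_cancel₀ hj
  choose c hc using hc
  have h1 : (1 : I → K) = ∑ j, (fun s => c s j) * fun s => r s j := by
    ext s; simp [hc]
  have h2 := congrArg π h1
  rw [map_one, map_sum] at h2
  refine one_ne_zero (h2.trans (Finset.sum_eq_zero fun j _ => ?_))
  have h3 : π (fun s => r s j) = 0 := congrFun h j
  rw [map_mul, h3, mul_zero]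

/-- Replacing the zero entries of α by 1 changes it by an element whose product with α is 0. The
domain property of L therefore hides the change whenever π α ≠ 0. -/
theorem exists_units_lift {I L : Type*} [Field L] (π : (I → K) →+* L)
    (hπ : ∀ u : L, ∃ α β, π β ≠ 0 ∧ u = π α / π β) (u : Lˣ) :
    ∃ c : I → Kˣ, π (fun s => (c s : K)) = u := by
  classical
  have fix : ∀ α : I → K, π α ≠ 0 → ∃ c : I → Kˣ, π (fun s => (c s : K)) = π α := fun α hα => by
    refine ⟨fun s => if h : α s = 0 then 1 else Units.mk0 _ h, ?_⟩
    apply sub_eq_zero.1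
    rw [← map_sub]
    apply (mul_eq_zero.1 (?_ : _ * π α = 0)).resolve_right hα
    rw [← map_mul, ← map_zero π]
    congr 1
    ext s
    by_cases h : α s = 0 <;> simp [h]
  obtain ⟨α, β, hβ, hu⟩ := hπ u
  have hα : π α ≠ 0 := fun h => u.ne_zero (by rw [hu, h, zero_div])
  obtain ⟨a, ha⟩ := fix α hα
  obtain ⟨b, hb⟩ := fix β hβ
  refine ⟨fun s => a s / b s, ?_⟩
  rw [hu, eq_div_iff hβ, ← hb, ← map_mul, ← ha]
  congr 1
  ext s
  simp

/-- A point `t` in the Zariski closure of the points `e s` is a specialization of a point `π ∘ e`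
with coordinates in an extension field. -/
theorem exists_generic_family.{u, v, w} {K : Type u} [Field K] {σ : Type w} {I : Type v}
    (e : I → σ → K) (t : σ → K)
    (h : ∀ f, (∀ s, eval (e s) f = 0) → eval t f = 0) :
    ∃ (L : Type (max u v)) (_ : Field L) (π : (I → K) →+* L),
      (∀ u : L, ∃ α β, π β ≠ 0 ∧ u = π α / π β) ∧
      ∀ f, π (fun s => eval (e s) f) = 0 → eval t f = 0 := by
  let ev : MvPolynomial σ K →+* (I → K) := RingHom.pi fun s => eval (e s)
  -- M consists of the value families of polynomials not vanishing at `t`. By hypothesis 0 is not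
  -- among them, so some prime of the product ring avoids M; its residue domain carries the generic
  -- point.
  let M : Submonoid (I → K) := ((nonZeroDivisors K).comap (eval t)).map ev
  have hdisj : Disjoint ((⊥ : Ideal (I → K)) : Set (I → K)) (M : Set (I → K)) := by
    rw [Set.disjoint_left]
    rintro x hx ⟨f, hf, rfl⟩
    have hf' : eval t f ≠ 0 := nonZeroDivisors.ne_zero hf
    exact hf' (h f fun s => congrFun (show ev f = 0 from hx) s)
  obtain ⟨q, hq, -, hqM⟩ := Ideal.exists_le_prime_disjoint _ M hdisj
  have hπ0 : ∀ a, algebraMap ((I → K) ⧸ q) (FractionRing ((I → K) ⧸ q))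
      (Ideal.Quotient.mk q a) = 0 ↔
      a ∈ q := fun a => by
    rw [← Ideal.Quotient.eq_zero_iff_mem]
    exact map_eq_zero_iff _ (IsFractionRing.injective ((I → K) ⧸ q) (FractionRing ((I → K) ⧸ q)))
  refine ⟨FractionRing ((I → K) ⧸ q), inferInstance,
    (algebraMap ((I → K) ⧸ q) (FractionRing ((I → K) ⧸ q))).comp (Ideal.Quotient.mk q),
    fun u => ?_, fun f hf => ?_⟩
  · obtain ⟨a, b, hb, rfl⟩ := IsFractionRing.div_surjective (A := (I → K) ⧸ q) u
    obtain ⟨α, rfl⟩ := Ideal.Quotient.mk_surjective a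
    obtain ⟨β, rfl⟩ := Ideal.Quotient.mk_surjective b
    refine ⟨α, β, fun h => nonZeroDivisors.ne_zero hb ?_, rfl⟩
    exact Ideal.Quotient.eq_zero_iff_mem.2 ((hπ0 β).1 h)
  · by_contra hne
    exact Set.disjoint_left.1 hqM ((hπ0 _).1 hf)
      ⟨f, mem_nonZeroDivisors_iff_ne_zero.2 hne, rfl⟩

theorem eval₂_algebraMap_pi {σ I : Type*} (v : σ → I → K) (f : MvPolynomial σ K) :
    eval₂ (algebraMap K (I → K)) v f = fun s => eval (fun i => v i s) f := by
  induction f using MvPolynomial.induction_on with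
  | C a => ext s; simp
  | add p q hp hq => ext s; simp [eval₂_add, hp, hq]
  | mul_X p i hp => ext s; simp [eval₂_mul, hp]

/-- A specialization of a family of points of a closed set lies in the closed set. -/
theorem mem_of_specialization {I L : Type*} [Field L] (π : (I → K) →+* L) (E : Subring L)
    (ψ : E →+* K) (kE : K →+* E) (hψ : ∀ k, ψ (kE k) = k)
    (hkE : ∀ k, (kE k : L) = π fun _ => k) {W : Set (Phase K × Phase K)} (hW : graphClosure W ⊆ W)
    (p : I → Phase K × Phase K) (hp : ∀ s, p s ∈ W) (m : Fin 4 → I → Kˣ) (V : Fin 4 → Fin 3 → E)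
    (hV : ∀ i j, (V i j : L) = π fun s => m i s * (quadruple (p s) i).rep j)
    (t : Phase K × Phase K) (ht : ∀ i, ∃ b : Kˣ, ∀ j, (quadruple t i).rep j = b * ψ (V i j)) :
    t ∈ W := by
  refine hW (mem_graphClosure_iff.2 fun f hf a => ?_)
  choose b hb using ht
  have e1 : eval (fun ij : Fin 4 × Fin 3 => (a ij.1 : K) * (quadruple t ij.1).rep ij.2) f =
      ψ (eval₂ kE (fun ij => kE (a ij.1 * b ij.1) * V ij.1 ij.2) f) := by
    rw [eval₂_comp_left ψ]
    have : ψ.comp kE = RingHom.id K := RingHom.ext hψ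
    rw [this]
    refine congrArg (fun v => eval₂ (RingHom.id K) v f) (funext fun ij => ?_)
    simp only [Function.comp_apply, map_mul, hb, hψ]
    ring
  rw [e1]
  suffices h : eval₂ kE (fun ij => kE (a ij.1 * b ij.1) * V ij.1 ij.2) f = 0 by rw [h, map_zero]
  apply Subtype.coe_injective
  change E.subtype _ = E.subtype 0
  rw [map_zero, eval₂_comp_left E.subtype]
  have e3 : (fun s => eval (fun ij => ((a ij.1 * b ij.1 * m ij.1 s : Kˣ) : K) *
      (quadruple (p s) ij.1).rep ij.2) f) =
      eval₂ (algebraMap K (I → K)) (fun ij s => ((a ij.1 * b ij.1 * m ij.1 s : Kˣ) : K) *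
      (quadruple (p s) ij.1).rep ij.2) f := by
    rw [eval₂_algebraMap_pi]
  have e2 : eval₂ (E.subtype.comp kE)
      (E.subtype ∘ fun ij : Fin 4 × Fin 3 => kE (a ij.1 * b ij.1) * V ij.1 ij.2) f =
      π (fun s => eval (fun ij => ((a ij.1 * b ij.1 * m ij.1 s : Kˣ) : K) *
        (quadruple (p s) ij.1).rep ij.2) f) := by
    rw [e3, eval₂_comp_left π]
    have h1 : E.subtype.comp kE = π.comp (algebraMap K (I → K)) := RingHom.ext hkE
    rw [h1]
    refine congrArg (fun v => eval₂ _ v f) (funext fun ij => ?_)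
    change ((kE _ : E) : L) * (V ij.1 ij.2 : L) = π _
    rw [hkE, hV, ← map_mul]
    congr 1
    ext s
    simp [mul_assoc]
  rw [e2, ← map_zero π]
  congr 1
  ext s
  exact hf _ (hp s) fun i => a i * b i * m i s

/-- Projections of closed subsets of products of projective planes are closed; hence so are
composites of closed correspondences. -/
theorem graphClosure_comp_subset [IsAlgClosed K] {W₁ W₂ : Set (Phase K × Phase K)}
    (h₁ : graphClosure W₁ ⊆ W₁) (h₂ : graphClosure W₂ ⊆ W₂) :
    graphClosure {z | ∃ y, (z.1, y) ∈ W₁ ∧ (y, z.2) ∈ W₂} ⊆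
      {z | ∃ y, (z.1, y) ∈ W₁ ∧ (y, z.2) ∈ W₂} := by
  intro z hz
  -- The scalars are part of the index because vanishing at a point is tested on all its
  -- multihomogeneous coordinates.
  let I := {z : Phase K × Phase K | ∃ y, (z.1, y) ∈ W₁ ∧ (y, z.2) ∈ W₂} × (Fin 4 → Kˣ)
  let e : I → Fin 4 × Fin 3 → K := fun s ij => s.2 ij.1 * (quadruple s.1.1 ij.1).rep ij.2
  obtain ⟨L, _, π, hπ, hker⟩ := exists_generic_family e
    (fun ij => (quadruple z ij.1).rep ij.2) fun f hf => by
      have := mem_graphClosure_iff.1 hz f (fun q hq c => hf (⟨q, hq⟩, c)) 1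
      simpa using this
  let ev : MvPolynomial (Fin 4 × Fin 3) K →+* (I → K) := RingHom.pi fun s => eval (e s)
  -- The intermediate points form one generic point over L. The place extending the specialization
  -- to `z`, after rescaling, sends it to an intermediate point for `z`; this is the properness of
  -- the projective plane.
  choose y hy using fun s : I => s.1.2
  obtain ⟨E, ψ, g, w, c, hg, hψ, hw, hw0⟩ := exists_place (π.comp ev) _ hker
    ![fun j => π fun s => (y s).1.rep j, fun j => π fun s => (y s).2.rep j] (fun i => by
      fin_cases i
      · exact image_ne_zero_of_pointwise π _ fun s => (y s).1.rep_nonzero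
      · exact image_ne_zero_of_pointwise π _ fun s => (y s).2.rep_nonzero)
  choose lam hlam using fun i => exists_units_lift π hπ (c i)
  have hψC : ∀ a, ψ (g.comp C a) = a := fun a => (hψ _).trans (eval_C a)
  have hgC : ∀ a : K, ((g.comp C a : E) : L) = π fun _ => a := fun a => by
    refine (hg (C a)).trans (congrArg π (funext fun s => ?_))
    exact eval_C a
  have hrep : ∀ (v : Fin 3 → K) (hv : v ≠ 0), ∃ b : Kˣ, ∀ j,
      (Projectivization.mk K v hv).rep j = b * v j := fun v hv => by
    obtain ⟨b, hb⟩ := Projectivization.exists_smul_eq_mk_rep K v hv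
    exact ⟨b, fun j => by rw [← hb]; rfl⟩
  have hgX : ∀ i j, ((g (X (i, j)) : E) : L) = π fun s => s.2 i * (quadruple s.1.1 i).rep j :=
    fun i j => (hg _).trans (congrArg π (funext fun s => eval_X _))
  have hψX : ∀ i j, (quadruple z i).rep j = ((1 : Kˣ) : K) * ψ (g (X (i, j))) := fun i j => by
    rw [hψ, eval_X, Units.val_one, one_mul]
  have hwl : ∀ i (r : I → Plane K), (∀ j, (w i j : L) = c i * π fun s => (r s).rep j) →
      ∀ j, (w i j : L) = π fun s => lam i s * (r s).rep j := fun i r h j => by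
    rw [h, ← hlam, ← map_mul]; rfl
  refine ⟨(Projectivization.mk K _ (hw0 0), Projectivization.mk K _ (hw0 1)), ?_, ?_⟩
  · refine mem_of_specialization π E ψ (g.comp C) hψC hgC h₁ (fun s => (s.1.1.1, y s))
      (fun s => (hy s).1) ![fun s => s.2 0, fun s => s.2 1, lam 0, lam 1]
      ![fun j => g (X (0, j)), fun j => g (X (1, j)), w 0, w 1] (fun i j => ?_) _ fun i => ?_
    · fin_cases i
      · exact hgX 0 j
      · exact hgX 1 j
      · exact hwl 0 (fun s => (y s).1) (hw 0) j
      · exact hwl 1 (fun s => (y s).2) (hw 1) j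
    · fin_cases i
      · exact ⟨1, hψX 0⟩
      · exact ⟨1, hψX 1⟩
      · exact hrep _ (hw0 0)
      · exact hrep _ (hw0 1)
  · refine mem_of_specialization π E ψ (g.comp C) hψC hgC h₂ (fun s => (y s, s.1.1.2))
      (fun s => (hy s).2) ![lam 0, lam 1, fun s => s.2 2, fun s => s.2 3]
      ![w 0, w 1, fun j => g (X (2, j)), fun j => g (X (3, j))] (fun i j => ?_) _ fun i => ?_
    · fin_cases i
      · exact hwl 0 (fun s => (y s).1) (hw 0) j
      · exact hwl 1 (fun s => (y s).2) (hw 1) j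
      · exact hgX 2 j
      · exact hgX 3 j
    · fin_cases i
      · exact hrep _ (hw0 0)
      · exact hrep _ (hw0 1)
      · exact ⟨1, hψX 2⟩
      · exact ⟨1, hψX 3⟩

end Closure

/-! ### Change to coordinates in which the isotropic directions are the axes. -/

theorem pderiv_bind₁ {R σ τ : Type*} [CommRing R] [Fintype σ] (h : σ → MvPolynomial τ R)
    (p : MvPolynomial σ R) (i : τ) :
    pderiv i (bind₁ h p) = ∑ j, bind₁ h (pderiv j p) * pderiv i (h j) := by
  classical
  induction p using MvPolynomial.induction_on with
  | C a => simp
  | add p q hp hq => simp [hp, hq, add_mul, Finset.sum_add_distrib]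
  | mul_X p k hp =>
    simp only [map_mul, bind₁_X_right, Derivation.leibniz, smul_eq_mul, hp, map_add, add_mul,
      Finset.sum_add_distrib, pderiv_X]
    have h1 : ∑ x, bind₁ h p * bind₁ h ((Pi.single x 1 : σ → MvPolynomial σ R) k) * pderiv i (h x) =
        bind₁ h p * pderiv i (h k) := by
      rw [Finset.sum_eq_single k (fun b _ hb => by simp [hb.symm]) (by simp)]
      simp
    rw [h1, Finset.mul_sum]
    simp only [mul_assoc]

/-- Affine coordinates whose axes have directions given by the linear forms `l`. -/
def nullPoint {R : Type*} [CommRing R] (l : Matrix (Fin 2) (Fin 2) R) (c : Fin 2 → R)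
    (X : Fin 3 → R) : Fin 3 → R :=
  ![l 0 0 * X 0 + l 0 1 * X 1 + c 0 * X 2, l 1 0 * X 0 + l 1 1 * X 1 + c 1 * X 2, X 2]

/-- The corresponding coordinates of directions. -/
def nullDir {R : Type*} [CommRing R] (l : Matrix (Fin 2) (Fin 2) R) (γ : R) (Q : Fin 3 → R) :
    Fin 3 → R :=
  ![l 0 0 * Q 0 + l 0 1 * Q 1, l 1 0 * Q 0 + l 1 1 * Q 1, γ * Q 2]

/-- In the coordinates given by `l`, `c`, `γ` the curve `F` has the equation `G` and the quadratic
form `Θ` is the product of the two coordinates. -/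
structure IsNullForm {K : Type*} [Field K] (F : MvPolynomial (Fin 3) K)
    (Θ : Matrix (Fin 2) (Fin 2) K) (l : Matrix (Fin 2) (Fin 2) K) (c : Fin 2 → K) (γ μ : K)
    (G : MvPolynomial (Fin 3) K) (d : ℕ) : Prop where
  two_le : 2 ≤ d
  hom : G.IsHomogeneous d
  det_ne : l 0 0 * l 1 1 - l 0 1 * l 1 0 ≠ 0
  γ_ne : γ ≠ 0
  μ_ne : μ ≠ 0
  symm : Θ 1 0 = Θ 0 1
  -- These three fields say that γ²Θ is the product of the linear forms given by the rows of `l`.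
  -- The factor γ leaves room for the rescaling of the Fermat hyperbola.
  form₀ : γ ^ 2 * Θ 0 0 = l 0 0 * l 1 0
  form₁ : γ ^ 2 * (2 * Θ 0 1) = l 0 0 * l 1 1 + l 0 1 * l 1 0
  form₂ : γ ^ 2 * Θ 1 1 = l 0 1 * l 1 1
  comp : bind₁ (nullPoint (l.map C) (C ∘ c) X) G = C μ * F

section Coordinates

variable {K : Type*} [Field K]

theorem nullPoint_smul (l : Matrix (Fin 2) (Fin 2) K) (c : Fin 2 → K) (t : K) (X : Fin 3 → K) :
    nullPoint l c (t • X) = t • nullPoint l c X := by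
  ext i; fin_cases i <;> simp [nullPoint] <;> ring

theorem nullDir_smul (l : Matrix (Fin 2) (Fin 2) K) (γ : K) (t : K) (X : Fin 3 → K) :
    nullDir l γ (t • X) = t • nullDir l γ X := by
  ext i; fin_cases i <;> simp [nullDir] <;> ring

theorem map_nullPoint {R S : Type*} [CommRing R] [CommRing S] (φ : R →+* S)
    (l : Matrix (Fin 2) (Fin 2) R) (c : Fin 2 → R) (X : Fin 3 → R) :
    φ ∘ nullPoint l c X = nullPoint (l.map φ) (φ ∘ c) (φ ∘ X) := by
  ext i; fin_cases i <;> simp [nullPoint]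

namespace IsNullForm

variable {F : MvPolynomial (Fin 3) K} {Θ l : Matrix (Fin 2) (Fin 2) K} {c : Fin 2 → K} {γ μ : K}
  {G : MvPolynomial (Fin 3) K} {d : ℕ}

theorem nullPoint_injective (h : IsNullForm F Θ l c γ μ G d) :
    Function.Injective (nullPoint l c) := by
  intro X Y hXY
  have h0 := congrFun hXY 0
  have h1 := congrFun hXY 1
  have h2 := congrFun hXY 2
  simp only [nullPoint, Matrix.cons_val] at h0 h1 h2
  have e0 : X 0 = Y 0 := mul_left_cancel₀ h.det_ne (by
    linear_combination l 1 1 * h0 - l 0 1 * h1 - (l 1 1 * c 0 - l 0 1 * c 1) * h2)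
  have e1 : X 1 = Y 1 := mul_left_cancel₀ h.det_ne (by
    linear_combination l 0 0 * h1 - l 1 0 * h0 - (l 0 0 * c 1 - l 1 0 * c 0) * h2)
  ext i; fin_cases i
  exacts [e0, e1, h2]

theorem nullDir_injective (h : IsNullForm F Θ l c γ μ G d) : Function.Injective (nullDir l γ) := by
  intro X Y hXY
  have h0 := congrFun hXY 0
  have h1 := congrFun hXY 1
  have h2 := congrFun hXY 2
  simp only [nullDir, Matrix.cons_val] at h0 h1 h2
  have e0 : X 0 = Y 0 := mul_left_cancel₀ h.det_ne (by
    linear_combination l 1 1 * h0 - l 0 1 * h1)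
  have e1 : X 1 = Y 1 := mul_left_cancel₀ h.det_ne (by
    linear_combination l 0 0 * h1 - l 1 0 * h0)
  ext i; fin_cases i
  exacts [e0, e1, mul_left_cancel₀ h.γ_ne h2]

theorem nullPoint_ne_zero (h : IsNullForm F Θ l c γ μ G d) {X : Fin 3 → K} (hX : X ≠ 0) :
    nullPoint l c X ≠ 0 := by
  intro h0
  apply hX
  apply h.nullPoint_injective
  rw [h0]
  ext i; fin_cases i <;> simp [nullPoint]

theorem nullDir_ne_zero (h : IsNullForm F Θ l c γ μ G d) {X : Fin 3 → K} (hX : X ≠ 0) :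
    nullDir l γ X ≠ 0 := by
  intro h0
  apply hX
  apply h.nullDir_injective
  rw [h0]
  ext i; fin_cases i <;> simp [nullDir]

theorem eval_bind₁_nullPoint (p : MvPolynomial (Fin 3) K) (X : Fin 3 → K) :
    eval X (bind₁ (nullPoint (l.map C) (C ∘ c) MvPolynomial.X) p) = eval (nullPoint l c X) p := by
  rw [eval, eval₂Hom_bind₁]
  refine congrArg (fun v => eval₂ (RingHom.id K) v p) (funext fun i => ?_)
  fin_cases i <;> simp [nullPoint]

theorem eval_nullPoint (h : IsNullForm F Θ l c γ μ G d) (X : Fin 3 → K) :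
    eval (nullPoint l c X) G = μ * eval X F := by
  rw [← eval_bind₁_nullPoint, h.comp]; simp

theorem eval_pderiv (h : IsNullForm F Θ l c γ μ G d) (X : Fin 3 → K) (i : Fin 2) :
    μ * eval X (pderiv i.castSucc F) = l 0 i * eval (nullPoint l c X) (pderiv 0 G) +
      l 1 i * eval (nullPoint l c X) (pderiv 1 G) := by
  have h1 := congrArg (fun p => eval X (pderiv i.castSucc p)) h.comp
  simp only [pderiv_bind₁, Fin.sum_univ_three, map_add, map_mul,
    Derivation.leibniz, pderiv_C, add_zero, smul_eq_mul, eval_C, mul_zero] at h1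
  rw [eval_bind₁_nullPoint, eval_bind₁_nullPoint, eval_bind₁_nullPoint] at h1
  rw [← h1]
  fin_cases i <;>
    simp [nullPoint, Derivation.leibniz, pderiv_X] <;> ring

theorem bilin_mul (h : IsNullForm F Θ l c γ μ G d) (u w : Fin 2 → K) :
    γ ^ 2 * (2 * bilin Θ u w) = (l 0 0 * u 0 + l 0 1 * u 1) * (l 1 0 * w 0 + l 1 1 * w 1) +
      (l 0 0 * w 0 + l 0 1 * w 1) * (l 1 0 * u 0 + l 1 1 * u 1) := by
  simp only [bilin, dotProduct, Matrix.mulVec, Fin.sum_univ_two, h.symm]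
  linear_combination 2 * u 0 * w 0 * h.form₀ + (u 0 * w 1 + u 1 * w 0) * h.form₁ +
    2 * u 1 * w 1 * h.form₂

theorem bilin_self (h : IsNullForm F Θ l c γ μ G d) (u : Fin 2 → K) :
    γ ^ 2 * bilin Θ u u = (l 0 0 * u 0 + l 0 1 * u 1) * (l 1 0 * u 0 + l 1 1 * u 1) := by
  simp only [bilin, dotProduct, Matrix.mulVec, Fin.sum_univ_two, h.symm]
  linear_combination u 0 * u 0 * h.form₀ + (u 0 * u 1) * h.form₁ + u 1 * u 1 * h.form₂

/-- Two points of the curve on a line of the direction `Q` satisfy the equations of the secant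
correspondence. -/
theorem secantEqs_eq_zero (h : IsNullForm F Θ l c γ μ G d) {X X' Q : Fin 3 → K}
    (hX0 : X ≠ 0) (hne : ∀ t : K, X' ≠ t • X)
    (hX : eval X F = 0) (hX' : eval X' F = 0)
    (hdet : Matrix.det ![X, X', ![Q 0, Q 1, 0]] = 0) :
    secantEqs G (nullPoint l c X) (nullDir l γ Q) (nullPoint l c X') = 0 := by
  have hY : eval (nullPoint l c X) G = 0 := by rw [h.eval_nullPoint, hX, mul_zero]
  have hY' : eval (nullPoint l c X') G = 0 := by rw [h.eval_nullPoint, hX', mul_zero]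
  have hY0 := h.nullPoint_ne_zero hX0
  have hYne : ∀ t : K, nullPoint l c X' ≠ t • nullPoint l c X := fun t ht => hne t <|
    h.nullPoint_injective (by rw [ht, nullPoint_smul])
  have hcol : nullDir l γ Q 0 * (nullPoint l c X 2 * nullPoint l c X' 1 -
      nullPoint l c X' 2 * nullPoint l c X 1) - nullDir l γ Q 1 * (nullPoint l c X 2 *
      nullPoint l c X' 0 - nullPoint l c X' 2 * nullPoint l c X 0) = 0 := by
    have hdet' := (Matrix.det_fin_three (Matrix.of ![X, X', ![Q 0, Q 1, 0]])).symm.trans hdet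
    simp only [Matrix.of_apply, Matrix.cons_val] at hdet'
    simp only [nullPoint, nullDir, Matrix.cons_val]
    linear_combination (-(l 0 0 * l 1 1 - l 0 1 * l 1 0)) * hdet'
  generalize nullPoint l c X = Y at *
  generalize nullPoint l c X' = Y' at *
  generalize nullDir l γ Q = P at *
  have hd : divDiff G ((Y' 2 * P 0) • Y) ![P 0, P 1, 0] (Y 2 * Y' 0 - Y' 2 * Y 0) = 0 := by
    -- Both ends of the segment are multiples of points of the curve, so the parameter times the
    -- divided difference is 0.
    have key : (Y' 2 * P 0) • Y + (Y 2 * Y' 0 - Y' 2 * Y 0) • ![P 0, P 1, 0] =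
        (Y 2 * P 0) • Y' := by
      ext i; fin_cases i
      · simp; ring
      · simp; linear_combination -hcol
      · simp; ring
    have h1 := mul_divDiff G ((Y' 2 * P 0) • Y) ![P 0, P 1, 0] (Y 2 * Y' 0 - Y' 2 * Y 0)
    rw [key, eval_smul_of_isHomogeneous h.hom, eval_smul_of_isHomogeneous h.hom, hY, hY', mul_zero,
      mul_zero, sub_zero] at h1
    rcases mul_eq_zero.1 h1 with h2 | h2
    · rw [h2]
      -- The parameter vanishes. Unless the base point is 0, collinearity makes Y and Y'
      -- proportional, which distinctness excludes.
      suffices h3 : Y' 2 * P 0 = 0 by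
        rw [h3, zero_smul]; exact divDiff_zero_zero h.two_le h.hom _
      by_contra h3
      have hP0 := right_ne_zero_of_mul h3
      have h4 : Y 2 * Y' 1 - Y' 2 * Y 1 = 0 := by
        apply mul_left_cancel₀ hP0
        linear_combination hcol + P 1 * h2
      by_cases hY2 : Y 2 = 0
      · have hY'2 := left_ne_zero_of_mul h3
        apply hY0
        ext i; fin_cases i
        · apply mul_left_cancel₀ hY'2
          change Y' 2 * Y 0 = Y' 2 * 0
          linear_combination -h2 + Y' 0 * hY2
        · apply mul_left_cancel₀ hY'2
          change Y' 2 * Y 1 = Y' 2 * 0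
          linear_combination -h4 + Y' 1 * hY2
        · exact hY2
      · apply hYne (Y' 2 / Y 2)
        ext i; fin_cases i
        · simp; field_simp; linear_combination h2
        · simp; field_simp; linear_combination h4
        · simp; field_simp
    · exact h2
  ext k; fin_cases k
  · exact hY'
  · exact hcol
  · exact hd

/-- The reflected direction satisfies the equations of the reflection. -/
theorem reflectEqs_eq_zero (h : IsNullForm F Θ l c γ μ G d) {X Q : Fin 3 → K}
    (hQ : bilin Θ (vec Q) (vec Q) = Q 2 ^ 2) (a b s : K) :
    reflectEqs G (nullPoint l c (a • X)) (nullDir l γ (b • Q))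
      (nullDir l γ (s • reflectVec Θ (tangent F X) Q)) = 0 := by
  rw [nullPoint_smul, nullDir_smul, nullDir_smul]
  set τ := tangent F X
  set α := l 0 0 * τ 0 + l 0 1 * τ 1
  set β := l 1 0 * τ 0 + l 1 1 * τ 1
  set P := nullDir l γ Q
  set P' := nullDir l γ (reflectVec Θ τ Q)
  set g := eval (nullPoint l c X) (pderiv 0 G)
  set g' := eval (nullPoint l c X) (pderiv 1 G)
  set Δ := l 0 0 * l 1 1 - l 0 1 * l 1 0
  -- In the new coordinates the tangent vector (α, β) is proportional to (-g', g).
  have hα : μ * α = -(Δ * g') := by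
    have h0 := h.eval_pderiv X 0
    have h1 := h.eval_pderiv X 1
    simp only [α, τ, tangent, Matrix.cons_val, Δ]
    simp only [Fin.castSucc_zero, Fin.castSucc_one] at h0 h1
    linear_combination (-l 0 0) * h1 + l 0 1 * h0
  have hβ : μ * β = Δ * g := by
    have h0 := h.eval_pderiv X 0
    have h1 := h.eval_pderiv X 1
    simp only [β, τ, tangent, Matrix.cons_val, Δ]
    simp only [Fin.castSucc_zero, Fin.castSucc_one] at h0 h1
    linear_combination (-l 1 0) * h1 + l 1 1 * h0
  have hP : P 0 * P 1 = P 2 ^ 2 := by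
    have := h.bilin_self (vec Q)
    rw [hQ] at this
    simp only [P, nullDir, Matrix.cons_val]
    simp only [vec, Matrix.cons_val] at this
    linear_combination -this
  have hB := h.bilin_mul τ (vec Q)
  have hT := h.bilin_self τ
  -- A reflection exchanges the two isotropic axes: P' is (α²P₁, β²P₀, αβP₂) divided by γ².
  have hP'0 : γ ^ 2 * P' 0 = α ^ 2 * P 1 := by
    simp only [P', P, nullDir, reflectVec, Matrix.cons_val, Pi.sub_apply, Pi.smul_apply,
      smul_eq_mul, α, vec] at hB hT ⊢
    linear_combination (l 0 0 * τ 0 + l 0 1 * τ 1) * hB - (l 0 0 * Q 0 + l 0 1 * Q 1) * hT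
  have hP'1 : γ ^ 2 * P' 1 = β ^ 2 * P 0 := by
    simp only [P', P, nullDir, reflectVec, Matrix.cons_val, Pi.sub_apply, Pi.smul_apply,
      smul_eq_mul, β, vec] at hB hT ⊢
    linear_combination (l 1 0 * τ 0 + l 1 1 * τ 1) * hB - (l 1 0 * Q 0 + l 1 1 * Q 1) * hT
  have hP'2 : γ ^ 2 * P' 2 = α * β * P 2 := by
    simp only [P', P, nullDir, reflectVec, Matrix.cons_val, α, β] at hT ⊢
    linear_combination γ * Q 2 * hT
  have hγ2 : γ ^ 2 ≠ 0 := pow_ne_zero _ h.γ_ne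
  have e0 : P' 0 * P' 1 = P' 2 ^ 2 := by
    apply mul_left_cancel₀ (mul_ne_zero hγ2 hγ2)
    linear_combination γ ^ 2 * P' 1 * hP'0 + α ^ 2 * P 1 * hP'1 -
      (γ ^ 2 * P' 2 + α * β * P 2) * hP'2 + α ^ 2 * β ^ 2 * hP
  have e1 : g * (P 0 * P' 0) + g' * (P 2 * P' 2) = 0 := by
    apply mul_left_cancel₀ (mul_ne_zero h.det_ne hγ2)
    linear_combination Δ * g * P 0 * hP'0 + Δ * g' * P 2 * hP'2 - α ^ 2 * P 1 * P 0 * hβ +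
      α * β * P 2 ^ 2 * hα + μ * β * α ^ 2 * hP
  have e2 : g' * (P 1 * P' 1) + g * (P 2 * P' 2) = 0 := by
    apply mul_left_cancel₀ (mul_ne_zero h.det_ne hγ2)
    linear_combination Δ * g' * P 1 * hP'1 + Δ * g * P 2 * hP'2 - α * β * P 2 ^ 2 * hβ +
      β ^ 2 * P 0 * P 1 * hα - μ * α * β ^ 2 * hP
  have hg : ∀ i, eval (a • nullPoint l c X) (pderiv i G) =
      a ^ (d - 1) * eval (nullPoint l c X) (pderiv i G) := fun i =>
    eval_smul_of_isHomogeneous h.hom.pderiv _ _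
  ext k; fin_cases k
  · simp [reflectEqs]; linear_combination s ^ 2 * e0
  · simp [reflectEqs, hg]; linear_combination a ^ (d - 1) * b * s * e1
  · simp [reflectEqs, hg]; linear_combination a ^ (d - 1) * b * s * e2

end IsNullForm

end Coordinates

/-! ### The billiard correspondence lies in a closed relation; iterates as chains. -/

section Correspondence

variable {K : Type*} [Field K]

/-- `E` is a polynomial condition written on four coordinate vectors and `f` is its polynomial.
Checking all scalings on Γ is what the definition of the closure requires, so no homogeneity need be
proved. -/
theorem eq_zero_of_mem_graphClosure {Γ : Set (Phase K × Phase K)} {E : (Fin 4 → Fin 3 → K) → K}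
    (f : MvPolynomial (Fin 4 × Fin 3) K) (hf : ∀ v, eval (fun ij => v ij.1 ij.2) f = E v)
    (h : ∀ q ∈ Γ, ∀ a : Fin 4 → Kˣ, E (fun i => (a i : K) • (quadruple q i).rep) = 0)
    {z : Phase K × Phase K} (hz : z ∈ graphClosure Γ) (a : Fin 4 → Kˣ) :
    E (fun i => (a i : K) • (quadruple z i).rep) = 0 := by
  have e : ∀ (q : Phase K × Phase K) (b : Fin 4 → Kˣ),
      eval (fun ij => (b ij.1 : K) * (quadruple q ij.1).rep ij.2) f =
        E (fun i => (b i : K) • (quadruple q i).rep) :=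
    fun q b => hf fun i => (b i : K) • (quadruple q i).rep
  rw [← e]
  refine mem_graphClosure_iff.1 hz f (fun q hq b => ?_) a
  rw [e]
  exact h q hq b

theorem eq_of_minors {p q : Plane K} (h : ∀ j k, p.rep j * q.rep k - p.rep k * q.rep j = 0) :
    p = q := by
  obtain ⟨k, hk⟩ := Function.ne_iff.1 q.rep_nonzero
  rw [← p.mk_rep, ← q.mk_rep, Projectivization.mk_eq_mk_iff' K _ _ p.rep_nonzero q.rep_nonzero]
  refine ⟨p.rep k / q.rep k, funext fun j => ?_⟩
  have hk' : q.rep k ≠ 0 := hk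
  simp only [Pi.smul_apply, smul_eq_mul]
  field_simp
  linear_combination -h j k

theorem eq_of_minors_closure {Γ : Set (Phase K × Phase K)} (i i' : Fin 4)
    (h : ∀ q ∈ Γ, quadruple q i = quadruple q i') {z : Phase K × Phase K}
    (hz : z ∈ graphClosure Γ) : quadruple z i = quadruple z i' := by
  refine eq_of_minors fun j k => ?_
  have := eq_zero_of_mem_graphClosure (E := fun v => v i j * v i' k - v i k * v i' j)
    (X (i, j) * X (i', k) - X (i, k) * X (i', j)) (fun v => by simp)
    (fun q hq a => by
      simp only [h q hq, Pi.smul_apply, smul_eq_mul]; ring) hz 1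
  simpa using this

theorem graphClosure_diagonal_subset :
    graphClosure {z : Phase K × Phase K | z.2 = z.1} ⊆ {z | z.2 = z.1} := fun z hz =>
  Prod.ext
    (eq_of_minors_closure 2 0 (fun q hq => by
      change q.2.1 = q.1.1; rw [show q.2 = q.1 from hq]) hz)
    (eq_of_minors_closure 3 1 (fun q hq => by
      change q.2.2 = q.1.2; rw [show q.2 = q.1 from hq]) hz)

section

variable (l : Matrix (Fin 2) (Fin 2) K) (c : Fin 2 → K) (γ : K) (G : MvPolynomial (Fin 3) K)

theorem eval_comp_nullPoint (v : Fin 4 → Fin 3 → K) (i : Fin 4) :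
    eval (fun ij : Fin 4 × Fin 3 => v ij.1 ij.2) ∘
      nullPoint (l.map C) (C ∘ c) (fun j => X (i, j)) = nullPoint l c (v i) := by
  ext j; fin_cases j <;> simp [nullPoint]

theorem eval_comp_nullDir (v : Fin 4 → Fin 3 → K) (i : Fin 4) :
    eval (fun ij : Fin 4 × Fin 3 => v ij.1 ij.2) ∘
      nullDir (l.map C) (C γ) (fun j => X (i, j)) = nullDir l γ (v i) := by
  ext j; fin_cases j <;> simp [nullDir]

theorem map_eval_map_C {σ τ : Type*} (v : σ → K) (G : MvPolynomial τ K) :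
    map (eval v) (map C G) = G := by
  rw [map_map]
  have : (eval v).comp C = RingHom.id K := RingHom.ext fun k => eval_C k
  rw [this, map_id]

theorem secantEqs_of_mem_graphClosure {Γ : Set (Phase K × Phase K)} (i₀ i₁ i₂ : Fin 4)
    (h : ∀ q ∈ Γ, ∀ a : Fin 4 → Kˣ, secantEqs G (nullPoint l c ((a i₀ : K) • (quadruple q i₀).rep))
      (nullDir l γ ((a i₁ : K) • (quadruple q i₁).rep))
      (nullPoint l c ((a i₂ : K) • (quadruple q i₂).rep)) = 0)
    {z : Phase K × Phase K} (hz : z ∈ graphClosure Γ) (a : Fin 4 → Kˣ) :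
    secantEqs G (nullPoint l c ((a i₀ : K) • (quadruple z i₀).rep))
      (nullDir l γ ((a i₁ : K) • (quadruple z i₁).rep))
      (nullPoint l c ((a i₂ : K) • (quadruple z i₂).rep)) = 0 := by
  ext k
  refine eq_zero_of_mem_graphClosure
    (E := fun v => secantEqs G (nullPoint l c (v i₀)) (nullDir l γ (v i₁)) (nullPoint l c (v i₂)) k)
    (secantEqs (map C G) (nullPoint (l.map C) (C ∘ c) (fun j => X (i₀, j)))
      (nullDir (l.map C) (C γ) (fun j => X (i₁, j)))
      (nullPoint (l.map C) (C ∘ c) (fun j => X (i₂, j))) k) (fun v => ?_)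
    (fun q hq b => congrFun (h q hq b) k) hz a
  rw [map_secantEqs, eval_comp_nullPoint, eval_comp_nullDir, eval_comp_nullPoint, map_eval_map_C]

theorem reflectEqs_of_mem_graphClosure {Γ : Set (Phase K × Phase K)} (i₀ i₁ i₂ : Fin 4)
    (h : ∀ q ∈ Γ, ∀ a : Fin 4 → Kˣ, reflectEqs G (nullPoint l c ((a i₀ : K) • (quadruple q i₀).rep))
      (nullDir l γ ((a i₁ : K) • (quadruple q i₁).rep))
      (nullDir l γ ((a i₂ : K) • (quadruple q i₂).rep)) = 0)
    {z : Phase K × Phase K} (hz : z ∈ graphClosure Γ) (a : Fin 4 → Kˣ) :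
    reflectEqs G (nullPoint l c ((a i₀ : K) • (quadruple z i₀).rep))
      (nullDir l γ ((a i₁ : K) • (quadruple z i₁).rep))
      (nullDir l γ ((a i₂ : K) • (quadruple z i₂).rep)) = 0 := by
  ext k
  refine eq_zero_of_mem_graphClosure
    (E := fun v => reflectEqs G (nullPoint l c (v i₀)) (nullDir l γ (v i₁)) (nullDir l γ (v i₂)) k)
    (reflectEqs (map C G) (nullPoint (l.map C) (C ∘ c) (fun j => X (i₀, j)))
      (nullDir (l.map C) (C γ) (fun j => X (i₁, j)))
      (nullDir (l.map C) (C γ) (fun j => X (i₂, j))) k) (fun v => ?_)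
    (fun q hq b => congrFun (h q hq b) k) hz a
  rw [map_reflectEqs, eval_comp_nullPoint, eval_comp_nullDir, eval_comp_nullDir, map_eval_map_C]

/-- The closed correspondence on pairs of planes given by the equations of a billiard step. -/
def nullRel : Set (Phase K × Phase K) :=
  {z | ∀ a : Fin 4 → Kˣ, NullStep G (nullPoint l c ((a 0 : K) • z.1.1.rep))
    (nullDir l γ ((a 1 : K) • z.1.2.rep)) (nullPoint l c ((a 2 : K) • z.2.1.rep))
    (nullDir l γ ((a 3 : K) • z.2.2.rep))}

theorem graphClosure_nullRel_subset : graphClosure (nullRel l c γ G) ⊆ nullRel l c γ G :=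
  fun _ hz a => ⟨secantEqs_of_mem_graphClosure l c γ G 0 1 2 (fun _ hq b => (hq b).1) hz a,
    -- The reflection takes place at the new point (index 2) and turns the old direction (index 1)
    -- into the new one (index 3).
    reflectEqs_of_mem_graphClosure l c γ G 2 1 3 (fun _ hq b => (hq b).2) hz a⟩

end

namespace IsNullForm

variable {F : MvPolynomial (Fin 3) K} {Θ l : Matrix (Fin 2) (Fin 2) K} {c : Fin 2 → K} {γ μ : K}
  {G : MvPolynomial (Fin 3) K} {d : ℕ}

theorem eval_smul (h : IsNullForm F Θ l c γ μ G d) (t : K) (X : Fin 3 → K) :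
    eval (t • X) F = t ^ d * eval X F := by
  apply mul_left_cancel₀ h.μ_ne
  rw [← h.eval_nullPoint, nullPoint_smul, eval_smul_of_isHomogeneous h.hom, h.eval_nullPoint]
  ring

theorem secant_eqs (h : IsNullForm F Θ l c γ μ G d) {z : Phase K × Phase K} (hz : z ∈ secant F Θ)
    (a : Fin 4 → Kˣ) :
    secantEqs G (nullPoint l c ((a 0 : K) • z.1.1.rep)) (nullDir l γ ((a 1 : K) • z.1.2.rep))
      (nullPoint l c ((a 2 : K) • z.2.1.rep)) = 0 := by
  refine secantEqs_of_mem_graphClosure l c γ G 0 1 2 (fun q hq b => ?_) hz a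
  obtain ⟨⟨⟨h1, h2⟩, ⟨h3, h4⟩, hv, hdet⟩, hne⟩ := hq
  refine h.secantEqs_eq_zero (smul_ne_zero (b 0).ne_zero q.1.1.rep_nonzero) (fun t ht => hne ?_)
    ?_ ?_ ?_
  · refine Prod.ext ?_ hv
    rw [← q.1.1.mk_rep, ← q.2.1.mk_rep, eq_comm, Projectivization.mk_eq_mk_iff' K _ _
      q.2.1.rep_nonzero q.1.1.rep_nonzero]
    refine ⟨(b 2 : K)⁻¹ * t * b 0, ?_⟩
    rw [mul_smul, mul_smul]
    change (b 2 : K) • q.2.1.rep = t • (b 0 : K) • q.1.1.rep at ht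
    rw [← ht, smul_smul, inv_mul_cancel₀ (b 2).ne_zero, one_smul]
  · rw [h.eval_smul]
    exact mul_eq_zero_of_right _ h1
  · rw [h.eval_smul]
    exact mul_eq_zero_of_right _ h3
  · have h5 := (Matrix.det_fin_three
      (Matrix.of ![q.1.1.rep, q.2.1.rep, ![q.1.2.rep 0, q.1.2.rep 1, 0]])).symm.trans hdet
    refine (Matrix.det_fin_three (Matrix.of ![(b 0 : K) • q.1.1.rep, (b 2 : K) • q.2.1.rep,
      ![((b 1 : K) • q.1.2.rep) 0, ((b 1 : K) • q.1.2.rep) 1, 0]])).trans ?_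
    simp only [Matrix.of_apply, Matrix.cons_val, Pi.smul_apply, smul_eq_mul] at h5 ⊢
    linear_combination (b 0 : K) * b 1 * b 2 * h5

theorem secant_dir {z : Phase K × Phase K} (hz : z ∈ secant F Θ) : z.1.2 = z.2.2 :=
  eq_of_minors_closure 1 3 (fun _ hq => hq.1.2.2.1) hz

theorem reflection_eqs (h : IsNullForm F Θ l c γ μ G d) {z : Phase K × Phase K}
    (hz : z ∈ reflection F Θ) (a : Fin 4 → Kˣ) :
    reflectEqs G (nullPoint l c ((a 0 : K) • z.1.1.rep)) (nullDir l γ ((a 1 : K) • z.1.2.rep))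
      (nullDir l γ ((a 3 : K) • z.2.2.rep)) = 0 := by
  refine reflectEqs_of_mem_graphClosure l c γ G 0 1 3 (fun q hq b => ?_) hz a
  obtain ⟨⟨-, h2⟩, -, -, -, -, h0, h3⟩ := hq
  obtain ⟨t, ht⟩ := Projectivization.exists_smul_eq_mk_rep K _ h0
  have e : (b 3 : K) • (quadruple q 3).rep =
      ((b 3 * t : Kˣ) : K) • reflectVec Θ (tangent F q.1.1.rep) q.1.2.rep := by
    change (b 3 : K) • q.2.2.rep = _
    rw [h3, ← ht, Units.val_mul, mul_smul, Units.smul_def]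
  rw [e]
  exact h.reflectEqs_eq_zero h2 _ _ _

theorem reflection_point {z : Phase K × Phase K} (hz : z ∈ reflection F Θ) : z.2.1 = z.1.1 :=
  eq_of_minors_closure 2 0 (fun _ hq => hq.2.2.2.2.1) hz

/-- The secant step preserves the direction and the reflection preserves the position, so the
intermediate state is determined by the two ends. The indeterminacy conditions only make the
composite smaller and may be dropped. -/
theorem billiard_subset (h : IsNullForm F Θ l c γ μ G d) : billiard F Θ ⊆ nullRel l c γ G := by
  refine (graphClosure_mono ?_).trans (graphClosure_nullRel_subset l c γ G)
  rintro ⟨⟨x, v⟩, ⟨x', v'⟩⟩ ⟨⟨x'', v''⟩, -, -, hs, hr⟩ a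
  obtain rfl : v = v'' := secant_dir hs
  obtain rfl : x' = x'' := reflection_point hr
  exact ⟨h.secant_eqs hs ![a 0, a 1, a 2, 1], h.reflection_eqs hr ![a 2, a 1, 1, a 3]⟩

end IsNullForm

/-- The closure taken in each composition might add pairs not joined by any chain. It does not,
since the pairs joined by chains in a closed relation already form a closed set. -/
theorem iterate_subset_chain [IsAlgClosed K] (S : Set (Phase K)) {Γ W : Set (Phase K × Phase K)}
    (hΓ : Γ ⊆ W) (hW : graphClosure W ⊆ W) (n : ℕ) {z : Phase K × Phase K}
    (hz : z ∈ iterate S Γ n) :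
    ∃ y : ℕ → Phase K, y 0 = z.1 ∧ y n = z.2 ∧ ∀ i < n, (y i, y (i + 1)) ∈ W := by
  let R : ℕ → Set (Phase K × Phase K) := fun n => Nat.rec {z | z.2 = z.1}
    (fun _ A => {z | ∃ y, (z.1, y) ∈ A ∧ (y, z.2) ∈ W}) n
  have hR : ∀ n, graphClosure (R n) ⊆ R n := fun n => by
    induction n with
    | zero => exact graphClosure_diagonal_subset
    | succ n ih => exact graphClosure_comp_subset ih hW
  have hS : ∀ n, iterate S Γ n ⊆ R n := fun n => by
    induction n with
    | zero => exact fun z hz => hz.2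
    | succ n ih =>
      refine (graphClosure_mono ?_).trans (hR (n + 1))
      rintro z ⟨y, -, -, h1, h2⟩
      exact ⟨y, ih h1, hΓ h2⟩
  have main : ∀ n z, z ∈ R n →
      ∃ y : ℕ → Phase K, y 0 = z.1 ∧ y n = z.2 ∧ ∀ i < n, (y i, y (i + 1)) ∈ W := fun n => by
    induction n with
    | zero =>
      intro z hz
      exact ⟨fun _ => z.1, rfl, (show z.2 = z.1 from hz).symm, fun i hi => absurd hi i.not_lt_zero⟩
    | succ n ih =>
      rintro z ⟨y, h1, h2⟩
      obtain ⟨u, hu0, hun, hu⟩ := ih _ h1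
      refine ⟨fun i => if i ≤ n then u i else z.2, by simpa using hu0, by simp, fun i hi => ?_⟩
      rcases Nat.lt_succ_iff_lt_or_eq.1 hi with h | rfl
      · simpa [h.le, Nat.succ_le_of_lt h] using hu i h
      · simpa [hun] using h2
  exact main n z (hS n hz)

/-- A curve that specializes to the model curve has a billiard which is not reflective, provided
that the origin, with a direction which is not isotropic, lifts to the phase space. -/
theorem IsNullForm.not_isReflective [IsAlgClosed K] {F : MvPolynomial (Fin 3) K}
    {Θ l : Matrix (Fin 2) (Fin 2) K} {c : Fin 2 → K} {γ μ : K}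
    {B : Type*} [CommRing B] {G : MvPolynomial (Fin 3) B} {d : ℕ} (f : B →+* K) (φ : B →+* ℂ)
    (h : IsNullForm F Θ l c γ μ (map f G) d)
    (hfφ : ∀ b, f b = 0 → φ b = 0) (hG : map φ G = modelCurve ℂ d) {X₀ Q₀ : Fin 3 → B}
    (hX₀ : φ ∘ X₀ = ![0, 0, 1]) (hQ₀ : φ ∘ Q₀ = ![1, 1, 1]) {x v : Fin 3 → K} (hx : x ≠ 0)
    (hv : v ≠ 0) (hxF : eval x F = 0) (hvΘ : bilin Θ (vec v) (vec v) = v 2 ^ 2)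
    (hxX : nullPoint l c x = f ∘ X₀) (hvQ : nullDir l γ v = f ∘ Q₀) {n : ℕ} (hn : 1 ≤ n) :
    ¬ IsReflective F Θ n := by
  intro hr
  obtain ⟨t, ht⟩ := Projectivization.exists_smul_eq_mk_rep K x hx
  obtain ⟨s, hs⟩ := Projectivization.exists_smul_eq_mk_rep K v hv
  have hmem : (Projectivization.mk K x hx, Projectivization.mk K v hv) ∈ table F Θ := by
    constructor
    · change eval (Projectivization.mk K x hx).rep F = 0
      rw [← ht, Units.smul_def, h.eval_smul, hxF, mul_zero]
    · change bilin Θ (vec (Projectivization.mk K v hv).rep) (vec (Projectivization.mk K v hv).rep) =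
        (Projectivization.mk K v hv).rep 2 ^ 2
      have e : vec (s • v) = (s : K) • vec v := by
        ext i; fin_cases i <;> simp [vec, Units.smul_def]
      rw [← hs, e, bilin, Matrix.mulVec_smul, smul_dotProduct, dotProduct_smul]
      rw [bilin] at hvΘ
      rw [hvΘ, Units.smul_def]
      simp only [Pi.smul_apply, smul_eq_mul]
      ring
  obtain ⟨y, hy0, hyn, hy⟩ := iterate_subset_chain _ h.billiard_subset
    (graphClosure_nullRel_subset _ _ _ _) n (hr _ hmem)
  have hP : ∀ j, nullPoint l c (Projectivization.mk K x hx).rep j = t * f (X₀ j) := fun j => by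
    rw [← ht, Units.smul_def, nullPoint_smul, hxX]; rfl
  have hD : ∀ j, nullDir l γ (Projectivization.mk K v hv).rep j = s * f (Q₀ j) := fun j => by
    rw [← hs, Units.smul_def, nullDir_smul, hvQ]; rfl
  refine not_closed_chain f φ hfφ h.two_le hG hX₀ hQ₀ hn (fun i => nullPoint l c (y i).1.rep)
    (fun i => nullDir l γ (y i).2.rep) (fun i => h.nullPoint_ne_zero (y i).1.rep_nonzero)
    (fun i => h.nullDir_ne_zero (y i).2.rep_nonzero) (fun i hi a => ?_) (fun j k => ?_)
    (fun j k => ?_) (fun j k => ?_)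
  · have := hy i hi a
    rwa [nullPoint_smul, nullDir_smul, nullPoint_smul, nullDir_smul] at this
  · simp only [hy0, hP]; ring
  · simp only [hy0, hD]; ring
  · simp only [hyn, hP]; ring

end Correspondence

/-! ### The Fermat hyperbola. -/

/-- The Fermat hyperbola near its isotropic tangent, in rescaled coordinates; `t` is the small
parameter. -/
def rescaledFermat (d : ℕ) : MvPolynomial (Fin 3) (Polynomial ℤ) :=
  X 0 ^ d + X 1 * ∑ i ∈ Finset.range d,
    (X 2 + C (Polynomial.X ^ (2 * d)) * X 1) ^ i * X 2 ^ (d - 1 - i)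

theorem rescaledFermat_isHomogeneous {d : ℕ} (hd : 2 ≤ d) : (rescaledFermat d).IsHomogeneous d := by
  have h0 : (X 0 ^ d : MvPolynomial (Fin 3) (Polynomial ℤ)).IsHomogeneous d :=
    isHomogeneous_X_pow _ _
  refine h0.add ?_
  have h1 : (∑ i ∈ Finset.range d,
      (X 2 + C (Polynomial.X ^ (2 * d)) * X 1) ^ i * X 2 ^ (d - 1 - i) :
      MvPolynomial (Fin 3) (Polynomial ℤ)).IsHomogeneous (d - 1) := by
    refine IsHomogeneous.sum _ _ _ fun i hi => ?_
    rw [Finset.mem_range] at hi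
    have h2 : (X 2 + C (Polynomial.X ^ (2 * d)) * X 1 :
        MvPolynomial (Fin 3) (Polynomial ℤ)).IsHomogeneous 1 :=
      (isHomogeneous_X _ _).add (isHomogeneous_C_mul_X _ _)
    have h3 := (h2.pow i).mul (isHomogeneous_X_pow (R := Polynomial ℤ) (2 : Fin 3) (d - 1 - i))
    rwa [one_mul, show i + (d - 1 - i) = d - 1 by omega] at h3
  have h2 := (isHomogeneous_X (Polynomial ℤ) (1 : Fin 3)).mul h1
  rwa [show 1 + (d - 1) = d by omega] at h2

/-- With A = X₀ + iX₁ and A' = X₀ - iX₁, the isotropic line A = X₂ has contact of order d with the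
curve at A' = 0. Put A' = e²u and A = 1 + e^(2d)w; division by e^(2d) leaves uᵈ + w ∑ (1 +
e^(2d)w)^i, which is the model at e = 0. The exponents are even so that γ⁻² = e² e^(2d) has the
square root e^(d+1). -/
theorem isNullForm_fermat {d : ℕ} (hd : 2 ≤ d) {e : ℂ} (he : e ≠ 0) :
    IsNullForm (fermatHyperbola d) 1
      !![(e ^ 2)⁻¹, -Complex.I * (e ^ 2)⁻¹; (e ^ (2 * d))⁻¹, Complex.I * (e ^ (2 * d))⁻¹]
      ![0, -(e ^ (2 * d))⁻¹] (e ^ (d + 1))⁻¹ (e ^ (2 * d))⁻¹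
      (map (Polynomial.aeval e : Polynomial ℤ →ₐ[ℤ] ℂ).toRingHom (rescaledFermat d)) d where
  two_le := hd
  hom := (rescaledFermat_isHomogeneous hd).map _
  det_ne := by
    have h1 : ((e ^ 2)⁻¹ * (Complex.I * (e ^ (2 * d))⁻¹) -
        -Complex.I * (e ^ 2)⁻¹ * (e ^ (2 * d))⁻¹) =
        2 * Complex.I * (e ^ 2)⁻¹ * (e ^ (2 * d))⁻¹ := by
      ring
    simp only [Matrix.of_apply, Matrix.cons_val, h1]
    simp [he]
  γ_ne := inv_ne_zero (pow_ne_zero _ he)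
  μ_ne := inv_ne_zero (pow_ne_zero _ he)
  symm := by simp
  form₀ := by
    simp only [Matrix.of_apply, Matrix.cons_val, Matrix.one_apply_eq, mul_one]
    field_simp
    ring
  form₁ := by
    simp only [Matrix.of_apply, Matrix.cons_val, Matrix.one_apply, zero_ne_one, if_false]
    ring
  form₂ := by
    simp only [Matrix.of_apply, Matrix.cons_val, Matrix.one_apply_eq, mul_one]
    have : -Complex.I * (e ^ 2)⁻¹ * (Complex.I * (e ^ (2 * d))⁻¹) =
        -(Complex.I * Complex.I) * ((e ^ 2)⁻¹ * (e ^ (2 * d))⁻¹) := by ring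
    rw [this, Complex.I_mul_I]
    field_simp
    ring
  comp := by
    have he' : (C (e ^ (2 * d)) : MvPolynomial (Fin 3) ℂ) * C (e ^ (2 * d))⁻¹ = 1 := by
      rw [← C_mul, mul_inv_cancel₀ (pow_ne_zero _ he), C_1]
    obtain ⟨A, hA⟩ : ∃ A : MvPolynomial (Fin 3) ℂ, A = X 0 + C Complex.I * X 1 := ⟨_, rfl⟩
    have hU : nullPoint ((!![(e ^ 2)⁻¹, -Complex.I * (e ^ 2)⁻¹;
        (e ^ (2 * d))⁻¹, Complex.I * (e ^ (2 * d))⁻¹] : Matrix (Fin 2) (Fin 2) ℂ).map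
        (C : ℂ →+* MvPolynomial (Fin 3) ℂ)) (C ∘ ![0, -(e ^ (2 * d))⁻¹]) X =
        ![C (e ^ 2)⁻¹ * (X 0 - C Complex.I * X 1), C (e ^ (2 * d))⁻¹ * (A - X 2), X 2] := by
      rw [hA]
      ext1 i
      fin_cases i
      · simp only [nullPoint, Matrix.map_apply, Matrix.of_apply, Function.comp_apply, C_mul, C_neg,
          C_0, Fin.zero_eta, Matrix.cons_val]
        ring
      · simp only [nullPoint, Matrix.map_apply, Matrix.of_apply, Function.comp_apply, C_mul, C_neg,
          C_0, Fin.mk_one, Matrix.cons_val]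
        ring
      · rfl
    rw [hU]
    have hpow : (C (e ^ 2)⁻¹ : MvPolynomial (Fin 3) ℂ) ^ d = C (e ^ (2 * d))⁻¹ := by
      rw [← C_pow, inv_pow, ← pow_mul]
    simp only [rescaledFermat, map_add, map_mul, map_pow, map_sum, map_X, map_C, bind₁_X_right,
      bind₁_C_right, Matrix.cons_val, AlgHom.toRingHom_eq_coe, RingHom.coe_coe, Polynomial.aeval_X]
    have hZ : X 2 + C e ^ (2 * d) * (C (e ^ (2 * d))⁻¹ * (A - X 2)) = A := by
      rw [← mul_assoc, ← C_pow, he']; ring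
    have hg := (Commute.all A (X 2)).geom_sum₂_mul d
    rw [hZ, mul_pow, hpow, fermatHyperbola, ← hA]
    linear_combination C (e ^ (2 * d))⁻¹ * hg

theorem not_isReflective_fermat {d : ℕ} (hd : 2 ≤ d) {n : ℕ} (hn : 1 ≤ n) :
    ¬ IsReflective (fermatHyperbola d) (1 : Matrix (Fin 2) (Fin 2) ℂ) n := by
  -- A transcendental number serves as the small parameter: a polynomial over ℤ vanishing at e is
  -- zero, so sending the parameter to 0 is compatible with evaluation at e.
  obtain ⟨e, he⟩ : ∃ e : ℂ, Transcendental ℤ e :=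
    ⟨(liouvilleNumber 2 : ℝ), (transcendental_algebraMap_iff (A := ℂ)
      (algebraMap ℝ ℂ).injective).2 (transcendental_liouvilleNumber le_rfl)⟩
  have he0 : e ≠ 0 := by rintro rfl; exact he isAlgebraic_zero
  have h2 : (e ^ 2) ≠ 0 := pow_ne_zero _ he0
  have h2d : (e ^ (2 * d)) ≠ 0 := pow_ne_zero _ he0
  have hI := Complex.I_mul_I
  refine (isNullForm_fermat hd he0).not_isReflective
    (Polynomial.aeval e : Polynomial ℤ →ₐ[ℤ] ℂ).toRingHom
    ((Int.castRingHom ℂ).comp (Polynomial.evalRingHom 0)) (fun b hb => ?_) ?_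
    -- The starting position is the contact point A' = 0, A = 1, and `v` is the direction with
    -- isotropic coordinates (1, 1, 1).
    (X₀ := ![0, 0, 1]) (Q₀ := ![1, 1, 1]) ?_ ?_ (x := ![1 / 2, -Complex.I / 2, 1])
    (v := ![(e ^ 2 + e ^ (2 * d)) / 2, -Complex.I * (e ^ (2 * d) - e ^ 2) / 2, e ^ (d + 1)])
    (fun h => ?_) (fun h => ?_) ?_ ?_ ?_ ?_ hn
  · have : b = 0 := transcendental_iff.1 he b hb
    rw [this, map_zero]
  · have h0 : ((0 : ℂ)) ^ (2 * d) = 0 := zero_pow (by omega)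
    simp only [rescaledFermat, modelCurve, map_add, map_mul, map_pow, map_sum, map_X, map_C,
      RingHom.comp_apply, Polynomial.coe_evalRingHom, Polynomial.eval_X, map_zero]
    rw [zero_pow (by omega : 2 * d ≠ 0), zero_mul, add_zero]
    have : ∀ i ∈ Finset.range d, (X 2 ^ i * X 2 ^ (d - 1 - i) : MvPolynomial (Fin 3) ℂ) =
        X 2 ^ (d - 1) := fun i hi => by
      rw [Finset.mem_range] at hi
      rw [← pow_add]; congr 1; omega
    rw [Finset.sum_congr rfl this]
    simp
    ring
  · ext i; fin_cases i <;> simp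
  · ext i; fin_cases i <;> simp
  · have := congrFun h 2
    simp at this
  · have := congrFun h 2
    simp [he0] at this
  · simp only [fermatHyperbola, map_sub, map_add, map_mul, map_pow, eval_X, eval_C, Matrix.cons_val]
    have e1 : (1 / 2 - Complex.I * (-Complex.I / 2) : ℂ) = 0 := by linear_combination (1 / 2) * hI
    have e2 : (1 / 2 + Complex.I * (-Complex.I / 2) : ℂ) = 1 := by linear_combination -(1 / 2) * hI
    rw [e1, e2, zero_pow (by omega)]
    simp
  · simp only [bilin, vec, Matrix.one_mulVec, dotProduct, Fin.sum_univ_two, Matrix.cons_val]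
    have e1 : (e ^ (d + 1)) ^ 2 = e ^ 2 * e ^ (2 * d) := by ring
    rw [e1]
    linear_combination (e ^ (2 * d) - e ^ 2) ^ 2 / 4 * hI
  · ext i; fin_cases i
    · simp [nullPoint]; linear_combination (1 / 2) * (e ^ 2)⁻¹ * hI
    · simp [nullPoint]; linear_combination -(1 / 2) * (e ^ (2 * d))⁻¹ * hI
    · simp [nullPoint]
  · ext i; fin_cases i
    · simp [nullDir]; field_simp; linear_combination (e ^ (2 * d) - e ^ 2) * hI
    · simp [nullDir]; field_simp; linear_combination -(e ^ (2 * d) - e ^ 2) * hI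
    · simp [nullDir, he0]

/-! ### Generic forms and the generic curve. -/

/-- The ternary form of degree `d` with given coefficients. -/
def formOf {R : Type*} [CommRing R] {d : ℕ} (a : Exponents d → R) : MvPolynomial (Fin 3) R :=
  ∑ m : Exponents d, monomial m.1 (a m)

/-- The exponent of `X₂ᵈ`. -/
def constExponent (d : ℕ) : Exponents d :=
  ⟨Finsupp.single 2 d, by simp [Finset.mem_finsuppAntidiag]⟩

section FormOf

variable {R S : Type*} [CommRing R] [CommRing S] {d : ℕ}

theorem map_formOf (φ : R →+* S) (a : Exponents d → R) : map φ (formOf a) = formOf (φ ∘ a) := by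
  simp [formOf, map_monomial]

theorem mem_exponents_iff {m : Fin 3 →₀ ℕ} :
    m ∈ (Finset.univ : Finset (Fin 3)).finsuppAntidiag d ↔ m.degree = d := by
  simp [Finset.mem_finsuppAntidiag, Finsupp.degree_eq_sum]

theorem formOf_isHomogeneous (a : Exponents d → R) : (formOf a).IsHomogeneous d :=
  IsHomogeneous.sum _ _ _ fun m _ => isHomogeneous_monomial _ (mem_exponents_iff.1 m.2)

theorem formOf_coeff {p : MvPolynomial (Fin 3) R} (hp : p.IsHomogeneous d) :
    formOf (fun m : Exponents d => coeff m.1 p) = p := by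
  classical
  ext m
  rw [formOf, coeff_sum]
  simp only [coeff_monomial]
  by_cases hm : m.degree = d
  · rw [Finset.sum_eq_single ⟨m, mem_exponents_iff.2 hm⟩ (fun b _ hb => if_neg fun h => hb
      (Subtype.ext h)) (by simp)]
    simp
  · rw [hp.coeff_eq_zero hm]
    refine Finset.sum_eq_zero fun b _ => if_neg fun h => hm ?_
    rw [← h]
    exact mem_exponents_iff.1 b.2

theorem eval_formOf (a : Exponents d → R) (y : Fin 3 → R) :
    eval y (formOf a) = ∑ m : Exponents d, a m * ∏ i, y i ^ m.1 i := by
  simp [formOf, eval_monomial, Finsupp.prod_fintype]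

theorem eval_formOf_eq_add (a : Exponents d → R) {y : Fin 3 → R} (hy : y 2 = 1) :
    eval y (formOf a) = a (constExponent d) +
      ∑ m : {m : Exponents d // m ≠ constExponent d}, a m * ∏ i, y i ^ m.1.1 i := by
  rw [eval_formOf, Fintype.sum_eq_add_sum_subtype_ne _ (constExponent d)]
  congr 1
  simp [constExponent, Fin.prod_univ_three, hy]

end FormOf

section LinearChange

variable {R S : Type*} [CommRing R] [CommRing S]

/-- The linear change of coordinates of the plane with linear part `l`, fixing the line at infinity
and the origin. -/
def linearChange (l : Matrix (Fin 2) (Fin 2) R) : Fin 3 → MvPolynomial (Fin 3) R :=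
  nullPoint (l.map C) (C ∘ 0) X

theorem map_linearChange (φ : R →+* S) (l : Matrix (Fin 2) (Fin 2) R) (i : Fin 3) :
    map φ (linearChange l i) = linearChange (l.map φ) i := by
  fin_cases i <;> simp [linearChange, nullPoint]

theorem bind₁_linearChange (l l' : Matrix (Fin 2) (Fin 2) R) (h : l' * l = 1)
    (p : MvPolynomial (Fin 3) R) : bind₁ (linearChange l) (bind₁ (linearChange l') p) = p := by
  rw [bind₁_bind₁]
  have e : (fun i => bind₁ (linearChange l) (linearChange l' i)) = X := by
    have h00 := congrFun (congrFun h 0) 0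
    have h01 := congrFun (congrFun h 0) 1
    have h10 := congrFun (congrFun h 1) 0
    have h11 := congrFun (congrFun h 1) 1
    simp only [Matrix.mul_apply, Fin.sum_univ_two, Matrix.one_apply, if_true, zero_ne_one,
      one_ne_zero, if_false] at h00 h01 h10 h11
    have k00 := congrArg (C : R → MvPolynomial (Fin 3) R) h00
    have k01 := congrArg (C : R → MvPolynomial (Fin 3) R) h01
    have k10 := congrArg (C : R → MvPolynomial (Fin 3) R) h10
    have k11 := congrArg (C : R → MvPolynomial (Fin 3) R) h11
    simp only [C_add, C_mul, C_0, C_1] at k00 k01 k10 k11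
    ext1 i
    fin_cases i
    · simp [linearChange, nullPoint]
      linear_combination X 0 * k00 + X 1 * k01
    · simp [linearChange, nullPoint]
      linear_combination X 0 * k10 + X 1 * k11
    · simp [linearChange, nullPoint]
  rw [e, bind₁_X_left]
  rfl

theorem isHomogeneous_bind₁_linearChange (l : Matrix (Fin 2) (Fin 2) R) {d : ℕ}
    {p : MvPolynomial (Fin 3) R} (hp : p.IsHomogeneous d) :
    (bind₁ (linearChange l) p).IsHomogeneous d := by
  have := hp.eval₂ C (linearChange l) (fun r => isHomogeneous_C _ r) (n := 1) fun i => by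
    fin_cases i
    · simpa [linearChange, nullPoint] using
        (isHomogeneous_C_mul_X (l 0 0) (0 : Fin 3)).add (isHomogeneous_C_mul_X (l 0 1) (1 : Fin 3))
    · simpa [linearChange, nullPoint] using
        (isHomogeneous_C_mul_X (l 1 0) (0 : Fin 3)).add (isHomogeneous_C_mul_X (l 1 1) (1 : Fin 3))
    · exact isHomogeneous_X _ _
  rw [one_mul] at this
  exact this

theorem modelCurve_isHomogeneous {d : ℕ} (hd : 2 ≤ d) : (modelCurve R d).IsHomogeneous d := by
  refine (isHomogeneous_X_pow _ _).add ?_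
  have h := ((isHomogeneous_X R (1 : Fin 3)).mul (isHomogeneous_X_pow (2 : Fin 3) (d - 1)))
  rw [show 1 + (d - 1) = d by omega] at h
  have := h.C_mul (d : R)
  simpa using this

end LinearChange

/-- The coefficients of a form with a zero at a given point of the affine plane are determined by
those other than that of `X₂ᵈ`. -/
theorem comp_coeff_eq {R S : Type*} [CommRing R] [CommRing S] {d : ℕ} (g : R →+* S)
    {a : Exponents d → R} {b : Exponents d → S} {x : Fin 3 → R} (hx : x 2 = 1)
    (ha : a (constExponent d) =
      -∑ m : {m : Exponents d // m ≠ constExponent d}, a m * ∏ i, x i ^ m.1.1 i)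
    (h : ∀ m : {m : Exponents d // m ≠ constExponent d}, g (a m) = b m)
    (hb : eval (g ∘ x) (formOf b) = 0) : g ∘ a = b := by
  rw [eval_formOf_eq_add _ (by simp [hx])] at hb
  ext m
  by_cases hm : m = constExponent d
  · have e : ∀ m : {m : Exponents d // m ≠ constExponent d},
        g (a m * ∏ i, x i ^ m.1.1 i) = b m * ∏ i, (g ∘ x) i ^ m.1.1 i := fun m => by
      rw [map_mul, map_prod, h]
      simp only [map_pow, Function.comp_apply]
    simp only [← e, ← map_sum] at hb
    subst hm
    exact (congrArg g ha).trans ((map_neg g _).trans (eq_neg_of_add_eq_zero_left hb).symm)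
  · exact h ⟨m, hm⟩

/-- A form whose coefficients, other than that of `X₂ᵈ`, are independent, and which vanishes at a
given point, specializes to the model curve, and the point to the origin. -/
theorem exists_generic_model {k K J : Type*} [Field k] [Field K] [Algebra k K] [Algebra k ℂ] {d : ℕ}
    (hd : 2 ≤ d) (j : {m : Exponents d // m ≠ constExponent d} → J) (e : J → K) (val : J → ℂ)
    {a : Exponents d → K} (hea : ∀ m, e (j m) = a m) {l l' : Matrix (Fin 2) (Fin 2) k}
    (hl : l' * l = 1)
    (hval : ∀ m, val (j m) = coeff m.1.1 (bind₁ (linearChange (l.map (algebraMap k ℂ)))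
      (modelCurve ℂ d))) {x : Fin 3 → MvPolynomial J k} (hx : x 2 = 1)
    (hxφ : eval₂Hom (algebraMap k ℂ) val ∘ x = ![0, 0, 1])
    (hxF : eval (aeval e ∘ x) (formOf a) = 0) :
    ∃ G : MvPolynomial (Fin 3) (MvPolynomial J k), G.IsHomogeneous d ∧
      map (eval₂Hom (algebraMap k ℂ) val) G = modelCurve ℂ d ∧
      bind₁ (linearChange (l.map (algebraMap k K)))
        (map (aeval e : MvPolynomial J k →ₐ[k] K).toRingHom G) = formOf a := by
  classical
  set φ : MvPolynomial J k →+* ℂ := eval₂Hom (algebraMap k ℂ) val with hφ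
  set f : MvPolynomial J k →+* K := (aeval e : MvPolynomial J k →ₐ[k] K).toRingHom with hf
  have hl' : l * l' = 1 := mul_eq_one_comm.1 hl
  -- The coefficients are indeterminates, except the constant one, which is solved for so that the
  -- form vanishes at `x`. `comp_coeff_eq` then identifies it under both `f` and `φ`.
  obtain ⟨aB, haB, haB0⟩ : ∃ aB : Exponents d → MvPolynomial J k,
      (∀ m : {m : Exponents d // m ≠ constExponent d}, aB m = X (j m)) ∧
      aB (constExponent d) =
        -∑ m : {m : Exponents d // m ≠ constExponent d}, aB m * ∏ i, x i ^ m.1.1 i := by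
    refine ⟨fun m => if h : m ≠ constExponent d then X (j ⟨m, h⟩) else
      -∑ m : {m : Exponents d // m ≠ constExponent d}, X (j m) * ∏ i, x i ^ m.1.1 i,
      fun m => dif_pos m.2, ?_⟩
    exact (dif_neg (by simp)).trans (congrArg Neg.neg
      (Finset.sum_congr rfl fun m _ => by beta_reduce; rw [dif_pos m.2]))
  have hfa : f ∘ aB = a := comp_coeff_eq f hx haB0 (fun m => by rw [haB]; simp [hf, hea]) hxF
  set Fb := bind₁ (linearChange (l.map (algebraMap k ℂ))) (modelCurve ℂ d) with hFb
  have hFb' : formOf (fun m : Exponents d => coeff m.1 Fb) = Fb :=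
    formOf_coeff (isHomogeneous_bind₁_linearChange _ (modelCurve_isHomogeneous hd))
  have hφa : φ ∘ aB = fun m => coeff m.1 Fb := comp_coeff_eq φ hx haB0 (fun m => by
    rw [haB]; simp [hφ, hval]) (by
      rw [hFb', hxφ, hFb, linearChange]
      have := IsNullForm.eval_bind₁_nullPoint (l := l.map (algebraMap k ℂ)) (c := 0)
        (modelCurve ℂ d) ![0, 0, 1]
      rw [this]
      simp [nullPoint, modelCurve, show d ≠ 0 by omega])
  refine ⟨bind₁ (linearChange (l'.map C)) (formOf aB),
    isHomogeneous_bind₁_linearChange _ (formOf_isHomogeneous _), ?_, ?_⟩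
  · rw [map_bind₁, map_formOf, hφa, hFb']
    have e1 : (fun i => map φ (linearChange (l'.map (C : k →+* MvPolynomial J k)) i)) =
        linearChange (l'.map (algebraMap k ℂ)) := by
      ext1 i
      rw [map_linearChange]
      congr 1
      ext i j
      simp [hφ]
    rw [e1, hFb]
    apply bind₁_linearChange
    rw [← Matrix.map_mul, hl', Matrix.map_one _ (map_zero _) (map_one _)]
  · rw [map_bind₁, map_formOf, hfa]
    have e1 : (fun i => map f (linearChange (l'.map (C : k →+* MvPolynomial J k)) i)) =
        linearChange (l'.map (algebraMap k K)) := by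
      ext1 i
      rw [map_linearChange]
      congr 1
      ext i j
      simp [hf]
    rw [e1]
    apply bind₁_linearChange
    rw [← Matrix.map_mul, hl, Matrix.map_one _ (map_zero _) (map_one _)]

/-- Exchange: if `a₀` is a polynomial in `a` and `y`, and independent of `a`, then `y` is
transcendental over `a`. -/
theorem transcendental_of_mem_adjoin_insert {k K ι : Type*} [Field k] [Field K] [Algebra k K]
    {a : ι → K} {a₀ y : K} (h : AlgebraicIndependent k (fun o : Option ι => o.elim a₀ a))
    (hmem : a₀ ∈ Algebra.adjoin k (insert y (Set.range a))) :
    AlgebraicIndependent k (fun o : Option ι => o.elim y a) := by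
  obtain ⟨h1, h2⟩ := AlgebraicIndependent.option_iff.1 h
  refine (h1.option_iff_transcendental y).2 fun hy => h2 ?_
  -- If `y` were algebraic over `a`, so would be every polynomial in `y` and `a`, including `a₀`.
  have hle : Algebra.adjoin k (insert y (Set.range a)) ≤
      (Subalgebra.algebraicClosure (Algebra.adjoin k (Set.range a)) K).restrictScalars k := by
    refine Algebra.adjoin_le ?_
    rintro z (rfl | hz)
    · exact hy
    · exact isAlgebraic_algebraMap
        (⟨z, Algebra.subset_adjoin hz⟩ : Algebra.adjoin k (Set.range a))
  exact hle hmem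

/-- The constant coefficient of a form is a polynomial in the other ones and the coordinates of a
point of the curve. -/
theorem coeff_mem_of_eval_formOf_eq_zero {k K : Type*} [Field k] [Field K] [Algebra k K] {d : ℕ}
    {a : Exponents d → K} {y : Fin 3 → K} (hy : y 2 = 1) (h : eval y (formOf a) = 0)
    (A : Subalgebra k K) (hyA : ∀ i, y i ∈ A)
    (ha : ∀ m : {m : Exponents d // m ≠ constExponent d}, a m ∈ A) : a (constExponent d) ∈ A := by
  rw [eval_formOf_eq_add _ hy] at h
  rw [eq_neg_of_add_eq_zero_left h]
  exact A.neg_mem (A.sum_mem fun m _ => A.mul_mem (ha m) (A.prod_mem fun i _ =>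
    A.pow_mem (hyA i) _))

/-- A nondegenerate quadratic form in two variables is a product of two linear forms. -/
theorem exists_factorization {Θ : Matrix (Fin 2) (Fin 2) ℂ} (hΘ : Θ.IsSymm) (hdet : Θ.det ≠ 0) :
    ∃ l : Matrix (Fin 2) (Fin 2) ℂ, l.det ≠ 0 ∧ Θ 0 0 = l 0 0 * l 1 0 ∧
      2 * Θ 0 1 = l 0 0 * l 1 1 + l 0 1 * l 1 0 ∧ Θ 1 1 = l 0 1 * l 1 1 := by
  have h10 : Θ 1 0 = Θ 0 1 := hΘ.apply 0 1
  rw [Matrix.det_fin_two, h10] at hdet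
  by_cases ha : Θ 0 0 = 0
  · refine ⟨!![0, 1; 2 * Θ 0 1, Θ 1 1], ?_, ?_, ?_, ?_⟩
    · have : Θ 0 1 ≠ 0 := fun h => hdet (by rw [ha, h]; ring)
      simpa [Matrix.det_fin_two]
    all_goals simp [ha]
  · obtain ⟨s, hs⟩ := IsAlgClosed.exists_pow_nat_eq (Θ 0 1 ^ 2 - Θ 0 0 * Θ 1 1) two_pos
    have hs0 : s ≠ 0 := by
      rintro rfl
      exact hdet (by linear_combination hs)
    -- With a, b, c the entries of Θ and s² = b² - ac, the form is (a q₀ + (b + s) q₁)(q₀ + ((b -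
    -- s)/a) q₁).
    refine ⟨!![Θ 0 0, Θ 0 1 + s; 1, (Θ 0 1 - s) / Θ 0 0], ?_, ?_, ?_, ?_⟩
    · rw [Matrix.det_fin_two]
      have : Θ 0 0 * ((Θ 0 1 - s) / Θ 0 0) - (Θ 0 1 + s) * 1 = -2 * s := by
        field_simp; ring
      rw [Matrix.of_apply, Matrix.of_apply, Matrix.of_apply, Matrix.of_apply]
      exact this.trans_ne (mul_ne_zero (by norm_num) hs0)
    · simp
    · simp; field_simp; ring
    · simp; field_simp; linear_combination hs

/-- The coefficient of `X₂ᵈ` may be replaced by a coordinate of a point of the affine curve as a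
member of a family of independent elements. -/
theorem algebraicIndependent_coordinate {k K : Type*} [Field k] [Field K] [Algebra k K] {d : ℕ}
    {a : Exponents d → K} (ha : AlgebraicIndependent k a) {l : Matrix (Fin 2) (Fin 2) k} {w : K}
    (hw : eval (nullPoint (l.map (algebraMap k K)) 0 ![0, w, 1]) (formOf a) = 0) :
    AlgebraicIndependent k (fun o : Option {m : Exponents d // m ≠ constExponent d} =>
      o.elim w (fun m => a m)) := by
  classical
  have h := ha.comp _ (Equiv.optionSubtypeNe (constExponent d)).injective
  have e : a ∘ (Equiv.optionSubtypeNe (constExponent d)) =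
      fun o : Option {m : Exponents d // m ≠ constExponent d} =>
        o.elim (a (constExponent d)) (fun m => a m) := by
    ext1 o
    cases o <;> rfl
  rw [e] at h
  refine transcendental_of_mem_adjoin_insert h ?_
  refine coeff_mem_of_eval_formOf_eq_zero (by simp [nullPoint]) hw _ (fun i => ?_) fun m =>
    Algebra.subset_adjoin (Set.mem_insert_of_mem _ ⟨m, rfl⟩)
  have hwA : w ∈ Algebra.adjoin k (insert w
      (Set.range fun m : {m : Exponents d // m ≠ constExponent d} => a m)) :=
    Algebra.subset_adjoin (Set.mem_insert _ _)
  fin_cases i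
  · simpa [nullPoint] using Subalgebra.mul_mem _ (Subalgebra.algebraMap_mem _ (l 0 1)) hwA
  · simpa [nullPoint] using Subalgebra.mul_mem _ (Subalgebra.algebraMap_mem _ (l 1 1)) hwA
  · exact Subalgebra.one_mem _

/-- A line through the origin meets the generic curve at a finite distance. -/
theorem exists_eval_formOf_eq_zero {k K : Type*} [Field k] [Field K] [IsAlgClosed K] [Algebra k K]
    {d : ℕ} (hd : d ≠ 0) {a : Exponents d → K} (ha : AlgebraicIndependent k a)
    {l : Matrix (Fin 2) (Fin 2) k} (hl : l 0 1 ≠ 0 ∨ l 1 1 ≠ 0) :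
    ∃ w : K, eval (nullPoint (l.map (algebraMap k K)) 0 ![0, w, 1]) (formOf a) = 0 := by
  classical
  set p : Polynomial K := eval₂ Polynomial.C
    (nullPoint (l.map (Polynomial.C.comp (algebraMap k K))) 0 ![0, Polynomial.X, 1]) (formOf a)
    with hp
  have hev : ∀ w, p.eval w = eval (nullPoint (l.map (algebraMap k K)) 0 ![0, w, 1]) (formOf a) := by
    intro w
    rw [hp, ← Polynomial.coe_evalRingHom, hom_eval₂, ← eval₂_id]
    congr 1
    · ext; simp
    · ext i; fin_cases i <;> simp [nullPoint]
  -- The zero polynomial is harmless. A nonzero constant p would give p(1) = p(0), a linear relation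
  -- over `k` between the independent coefficients; the monomials X₀ᵈ and X₁ᵈ then force the
  -- direction of the line to vanish.
  suffices h : p.degree ≠ 0 by
    obtain ⟨w, hw⟩ := IsAlgClosed.exists_root p h
    exact ⟨w, (hev w).symm.trans hw⟩
  intro h0
  have h01 : p.eval 1 = p.eval 0 := by
    rw [Polynomial.eq_C_of_degree_eq_zero h0]
    simp
  have hval : ∀ (m : Exponents d) (t : k),
      algebraMap k K (∏ i, nullPoint l 0 ![0, t, 1] i ^ m.1 i) =
        ∏ i, nullPoint (l.map (algebraMap k K)) 0 ![0, algebraMap k K t, 1] i ^ m.1 i := by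
    intro m t
    simp [Fin.prod_univ_three, nullPoint]
  rw [hev, hev, eval_formOf, eval_formOf] at h01
  have h02 := sub_eq_zero.2 h01
  rw [← Finset.sum_sub_distrib] at h02
  have hlin := Fintype.linearIndependent_iff.1 ha.linearIndependent
    (fun m => (∏ i, nullPoint l 0 ![0, 1, 1] i ^ m.1 i) - ∏ i, nullPoint l 0 ![0, 0, 1] i ^ m.1 i)
    ((Finset.sum_congr rfl fun m _ => by
      rw [Algebra.smul_def, map_sub, hval, hval, map_one, map_zero]; ring).trans h02)
  have hkey : ∀ i : Fin 3, i ≠ 2 → nullPoint l 0 ![0, 1, 1] i = 0 := by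
    intro i hi
    have := hlin ⟨Finsupp.single i d, by simp [Finset.mem_finsuppAntidiag]⟩
    rw [Finset.prod_eq_single i, Finset.prod_eq_single i] at this
    · have hz : nullPoint l 0 ![0, 0, 1] i = 0 := by
        fin_cases i
        · simp [nullPoint]
        · simp [nullPoint]
        · exact absurd rfl hi
      simp only [Finsupp.single_eq_same, hz, zero_pow hd, sub_zero] at this
      exact pow_eq_zero_iff hd |>.1 this
    all_goals simp +contextual [eq_comm]
  rcases hl with hl | hl
  · exact hl (by simpa [nullPoint] using hkey 0 (by decide))
  · exact hl (by simpa [nullPoint] using hkey 1 (by decide))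

/-- The starting point is taken on the isotropic axis u = 0, leaving one coordinate w to exchange
for the constant coefficient. Independence permits sending w to 0 and the other coefficients to
those of the model. The direction (1, 1, 1) is defined over ℂ and needs no specialization. -/
theorem not_isReflective_generic {d : ℕ} (hd : 2 ≤ d) {Θ : Matrix (Fin 2) (Fin 2) ℂ}
    (hΘ : Θ.IsSymm) (hdet : Θ.det ≠ 0) {n : ℕ} (hn : 1 ≤ n) :
    ¬ IsReflective (genericCurve d) (Θ.map (algebraMap ℂ (GenericField d))) n := by
  classical
  obtain ⟨l, hldet, hl0, hl1, hl2⟩ := exists_factorization hΘ hdet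
  have hu : IsUnit l.det := isUnit_iff_ne_zero.2 hldet
  have hll' : l * l⁻¹ = 1 := Matrix.mul_nonsing_inv l hu
  have hl'l : l⁻¹ * l = 1 := Matrix.nonsing_inv_mul l hu
  set l' := l⁻¹
  set κ := algebraMap ℂ (GenericField d) with hκ
  set a : Exponents d → GenericField d := fun m =>
    algebraMap (MvPolynomial (Exponents d) ℂ) (GenericField d) (X m) with haX
  have hinj : Function.Injective (algebraMap (MvPolynomial (Exponents d) ℂ) (GenericField d)) := by
    rw [IsScalarTower.algebraMap_eq _ (FractionRing (MvPolynomial (Exponents d) ℂ))]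
    exact (RingHom.injective (algebraMap (FractionRing (MvPolynomial (Exponents d) ℂ))
      (GenericField d))).comp (IsFractionRing.injective _ _)
  have ha : AlgebraicIndependent ℂ a :=
    (MvPolynomial.algebraicIndependent_X (Exponents d) ℂ).map'
      (f := IsScalarTower.toAlgHom ℂ (MvPolynomial (Exponents d) ℂ) (GenericField d)) hinj
  have hF : genericCurve d = formOf a := rfl
  obtain ⟨w, hw⟩ := exists_eval_formOf_eq_zero (by omega) ha (l := l') (by
    by_contra! h
    have := congrFun (congrFun hll' 1) 1
    simp [Matrix.mul_apply, h.1, h.2] at this)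
  have he := algebraicIndependent_coordinate ha hw
  set e : Option {m : Exponents d // m ≠ constExponent d} → GenericField d :=
    fun o => o.elim w (fun m => a m) with hedef
  let val : Option {m : Exponents d // m ≠ constExponent d} → ℂ := fun o => o.elim 0 fun m =>
    coeff m.1.1 (bind₁ (linearChange (l.map (algebraMap ℂ ℂ))) (modelCurve ℂ d))
  let x : Fin 3 → MvPolynomial (Option {m : Exponents d // m ≠ constExponent d}) ℂ :=
    nullPoint (l'.map C) 0 ![0, X none, 1]
  have hfx : aeval e ∘ x = nullPoint (l'.map κ) 0 ![0, w, 1] := by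
    ext i
    fin_cases i <;> simp [x, nullPoint, hedef, κ]
  obtain ⟨G, hG, hGφ, hGf⟩ := exists_generic_model hd some e val (a := a) (fun _ => rfl) hl'l
    (fun _ => rfl) (x := x) (by simp [x, nullPoint]) (by
      ext i
      fin_cases i <;> simp [x, nullPoint, val]) (by rw [hfx]; exact hw)
  have k (i j : Fin 2) : ∑ t, κ (l i t) * κ (l' t j) = if i = j then 1 else 0 := by
    have := congrArg κ (congrFun (congrFun hll' i) j)
    rw [Matrix.mul_apply, Matrix.one_apply, map_sum] at this
    simpa [apply_ite κ] using this
  have k00 := k 0 0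
  have k01 := k 0 1
  have k10 := k 1 0
  have k11 := k 1 1
  simp only [Fin.sum_univ_two, if_true, zero_ne_one, one_ne_zero, if_false] at k00 k01 k10 k11
  have hform : IsNullForm (genericCurve d) (Θ.map κ) (l.map κ) 0 1 1
      (map (aeval e : _ →ₐ[ℂ] GenericField d).toRingHom G) d :=
    { two_le := hd
      hom := hG.map _
      det_ne := by
        simpa [Matrix.det_fin_two, ← map_mul, ← map_sub, sub_eq_zero] using hldet
      γ_ne := one_ne_zero
      μ_ne := one_ne_zero
      symm := by simp [hΘ.apply 0 1]
      form₀ := by simp [hl0]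
      form₁ := by
        simp only [Matrix.map_apply, ← map_mul, ← map_add, ← hl1]
        simp [(map_ofNat κ 2).symm]
      form₂ := by simp [hl2]
      comp := by
        rw [C_1, one_mul, hF]
        exact hGf }
  have t0 := congrArg κ hl0
  have t1 := congrArg κ hl1
  have t2 := congrArg κ hl2
  simp only [map_mul, map_add, map_ofNat] at t0 t1 t2
  refine hform.not_isReflective (aeval e : _ →ₐ[ℂ] GenericField d).toRingHom _
    (fun b hb => ?_) hGφ (X₀ := ![0, X none, 1]) (Q₀ := ![1, 1, 1]) ?_ ?_
    (x := nullPoint (l'.map κ) 0 ![0, w, 1])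
    (v := nullPoint (l'.map κ) 0 ![1, 1, 1]) ?_ ?_ hw ?_ ?_ ?_ hn
  · have : b = 0 := he (hb.trans (map_zero _).symm)
    rw [this, map_zero]
  · ext i; fin_cases i <;> simp [val]
  · ext i; fin_cases i <;> simp
  · intro h; simpa [nullPoint] using congrFun h 2
  · intro h; simpa [nullPoint] using congrFun h 2
  · simp [bilin, vec, nullPoint, dotProduct, Matrix.mulVec, Fin.sum_univ_two]
    have h10 : κ (Θ 1 0) = κ (Θ 0 1) := by rw [hΘ.apply 0 1]
    rw [h10]
    set u0 := κ (l' 0 0) + κ (l' 0 1)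
    set u1 := κ (l' 1 0) + κ (l' 1 1)
    linear_combination (u0 ^ 2) * t0 + u0 * u1 * t1 + u1 ^ 2 * t2 +
      (κ (l 1 0) * u0 + κ (l 1 1) * u1) * (k00 + k01) + (k10 + k11)
  · ext i
    fin_cases i
    · simp [nullPoint, hedef]
      linear_combination w * k01
    · simp [nullPoint, hedef]
      linear_combination w * k11
    · simp [nullPoint]
  · ext i
    fin_cases i
    · simp [nullPoint, nullDir]
      linear_combination k00 + k01
    · simp [nullPoint, nullDir]
      linear_combination k10 + k11
    · simp [nullPoint, nullDir]

/-! ### Complexification of the classical billiard. -/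

/-- The exponents of the affine monomial corresponding to a monomial of degree `d`. -/
def affineExponent {d : ℕ} (m : Exponents d) : {m : Fin 2 →₀ ℕ // m.degree ≤ d} :=
  ⟨Finsupp.equivFunOnFinite.symm fun i => m.1 i.castSucc, by
    have := mem_exponents_iff.1 m.2
    rw [Finsupp.degree_eq_sum, Fin.sum_univ_castSucc] at this
    rw [Finsupp.degree_eq_sum]
    simp only [Finsupp.coe_equivFunOnFinite_symm]
    omega⟩

theorem affineExponent_apply {d : ℕ} (m : Exponents d) (i : Fin 2) :
    (affineExponent m).1 i = m.1 i.castSucc := rfl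

theorem affineExponent_bijective (d : ℕ) :
    Function.Bijective (affineExponent : Exponents d → _) := by
  constructor
  · intro m m' h
    have h' : ∀ i : Fin 2, m.1 i.castSucc = m'.1 i.castSucc := fun i => by
      rw [← affineExponent_apply, h, affineExponent_apply]
    have e := mem_exponents_iff.1 m.2
    have e' := mem_exponents_iff.1 m'.2
    rw [Finsupp.degree_eq_sum, Fin.sum_univ_castSucc] at e e'
    simp only [h'] at e
    ext i
    refine Fin.lastCases ?_ (fun i => h' i) i
    omega
  · rintro ⟨m, hm⟩
    rw [Finsupp.degree_eq_sum] at hm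
    refine ⟨⟨Finsupp.equivFunOnFinite.symm (Fin.snoc m (d - ∑ i, m i) : Fin 3 → ℕ), ?_⟩, ?_⟩
    · rw [mem_exponents_iff, Finsupp.degree_eq_sum, Fin.sum_univ_castSucc]
      simp only [Finsupp.coe_equivFunOnFinite_symm]
      simp only [Fin.snoc_castSucc, Fin.snoc_last]
      omega
    · ext i
      rw [affineExponent_apply]
      simp only [Finsupp.coe_equivFunOnFinite_symm]
      exact Fin.snoc_castSucc (α := fun _ => ℕ) _ _ _

/-- The coefficients of an affine polynomial, as those of a form of degree `d`. -/
def homogCoeff {R : Type*} [CommRing R] (d : ℕ) (F : MvPolynomial (Fin 2) R)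
    (m : Exponents d) : R :=
  coeff (affineExponent m).1 F

section Homogenization

variable {R : Type*} [CommRing R] {d : ℕ} {F : MvPolynomial (Fin 2) R}

theorem bind₁_formOf_homogCoeff (hF : F.totalDegree ≤ d) :
    bind₁ ![X 0, X 1, 1] (formOf (homogCoeff d F)) = F := by
  classical
  have h1 : ∀ m : Exponents d, bind₁ ![X 0, X 1, 1] (monomial m.1 (homogCoeff d F m)) =
      monomial (affineExponent m).1 (coeff (affineExponent m).1 F) := by
    intro m
    rw [bind₁, aeval_monomial, Finsupp.prod_fintype _ _ (by simp), monomial_eq,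
      Finsupp.prod_fintype _ _ (by simp)]
    simp [Fin.prod_univ_three, Fin.prod_univ_two, homogCoeff, affineExponent_apply]
  rw [formOf, map_sum]
  simp only [h1]
  ext v
  simp only [coeff_sum, coeff_monomial]
  by_cases hv : v.degree ≤ d
  · obtain ⟨m, hm⟩ := (affineExponent_bijective d).2 ⟨v, hv⟩
    rw [Finset.sum_eq_single m (fun b _ hb => if_neg fun h => hb
      ((affineExponent_bijective d).1 (Subtype.ext (by rw [h, hm])))) (by simp), hm, if_pos rfl]
  · rw [Finset.sum_eq_zero fun b _ => if_neg fun h : _ = v =>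
      hv (h ▸ (affineExponent b).2)]
    refine (coeff_eq_zero_of_totalDegree_lt (hF.trans_lt ?_)).symm
    rw [← Finsupp.degree_apply]
    exact not_le.1 hv

theorem eval_bind₁_affine (p : MvPolynomial (Fin 3) R) (x : Fin 2 → R) :
    eval x (bind₁ ![X 0, X 1, 1] p) = eval ![x 0, x 1, 1] p := by
  rw [eval, eval₂Hom_bind₁]
  refine congrArg (fun v => eval₂ (RingHom.id R) v p) (funext fun i => ?_)
  fin_cases i <;> simp

theorem eval_formOf_homogCoeff (hF : F.totalDegree ≤ d) (x : Fin 2 → R) :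
    eval ![x 0, x 1, 1] (formOf (homogCoeff d F)) = eval x F := by
  rw [← eval_bind₁_affine, bind₁_formOf_homogCoeff hF]

theorem eval_pderiv_formOf_homogCoeff (hF : F.totalDegree ≤ d) (x : Fin 2 → R) (i : Fin 2) :
    eval ![x 0, x 1, 1] (pderiv i.castSucc (formOf (homogCoeff d F))) = eval x (pderiv i F) := by
  conv_rhs => rw [← bind₁_formOf_homogCoeff hF]
  rw [pderiv_bind₁, map_sum]
  simp only [map_mul, eval_bind₁_affine, Fin.sum_univ_three]
  fin_cases i <;> simp [pderiv_X]

end Homogenization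

/-- The complex homogeneous coordinates of a point of the Euclidean plane. -/
def affinePoint (p : E2) : Fin 3 → ℂ := ![p 0, p 1, 1]

theorem affinePoint_eq (p : E2) : affinePoint p = Complex.ofRealHom ∘ ![p 0, p 1, 1] := by
  ext i; fin_cases i <;> simp [affinePoint]

theorem affinePoint_ne_zero (p : E2) : affinePoint p ≠ 0 := fun h => by
  simpa [affinePoint] using congrFun h 2

/-- The complex homogenization of a real polynomial. -/
def complexForm (d : ℕ) (F : MvPolynomial (Fin 2) ℝ) : MvPolynomial (Fin 3) ℂ :=
  map Complex.ofRealHom (formOf (homogCoeff d F))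

theorem complexForm_isHomogeneous (d : ℕ) (F : MvPolynomial (Fin 2) ℝ) :
    (complexForm d F).IsHomogeneous d := (formOf_isHomogeneous _).map _

section ComplexForm

variable {d : ℕ} {F : MvPolynomial (Fin 2) ℝ}

theorem eval_complexForm (hF : F.totalDegree ≤ d) (p : E2) :
    eval (affinePoint p) (complexForm d F) = eval (fun i => p i) F := by
  rw [affinePoint_eq, complexForm, ← map_eval_comp,
    ← eval_formOf_homogCoeff hF (fun i => p i)]
  rfl

theorem tangent_complexForm (hF : F.totalDegree ≤ d) (p : E2) :
    tangent (complexForm d F) (affinePoint p) = ![-(grad F p 1 : ℂ), (grad F p 0 : ℂ)] := by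
  have h : ∀ i : Fin 2, eval (affinePoint p) (pderiv i.castSucc (complexForm d F)) =
      (grad F p i : ℂ) := fun i => by
    rw [affinePoint_eq, complexForm, pderiv_map, ← map_eval_comp,
      eval_pderiv_formOf_homogCoeff hF (fun i => p i)]
    fin_cases i <;> rfl
  have h0 := h 0
  have h1 := h 1
  simp only [Fin.castSucc_zero, Fin.castSucc_one] at h0 h1
  rw [tangent, h0, h1]

theorem norm_sq_eq (v : E2) : ‖v‖ ^ 2 = v 0 ^ 2 + v 1 ^ 2 := by
  simp [EuclideanSpace.norm_sq_eq, Fin.sum_univ_two]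

theorem bilin_affinePoint {v : E2} (hv : ‖v‖ = 1) :
    bilin 1 (vec (affinePoint v)) (vec (affinePoint v)) = affinePoint v 2 ^ 2 := by
  have := norm_sq_eq v
  rw [hv] at this
  simp [bilin, vec, affinePoint, dotProduct, Fin.sum_univ_two]
  norm_cast
  linarith

theorem reflectVec_complexForm (hF : F.totalDegree ≤ d) (p v : E2) :
    reflectVec 1 (tangent (complexForm d F) (affinePoint p)) (affinePoint v) =
      ((‖grad F p‖ ^ 2 : ℝ) : ℂ) •
        affinePoint ((Submodule.span ℝ {grad F p})ᗮ.reflection v) := by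
  rw [tangent_complexForm hF]
  have key : ∀ i, ‖grad F p‖ ^ 2 * (Submodule.span ℝ {grad F p})ᗮ.reflection v i =
      ‖grad F p‖ ^ 2 * v i - 2 * (grad F p 0 * v 0 + grad F p 1 * v 1) * grad F p i := by
    intro i
    rw [Submodule.reflection_orthogonal_apply, Submodule.reflection_singleton_apply]
    by_cases hg : grad F p = 0
    · simp [hg]
    · have : ‖grad F p‖ ≠ 0 := norm_ne_zero_iff.2 hg
      simp [Fin.sum_univ_two, PiLp.inner_apply]
      field_simp
  have k0 := congrArg (fun r : ℝ => (r : ℂ)) (key 0)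
  have k1 := congrArg (fun r : ℝ => (r : ℂ)) (key 1)
  rw [norm_sq_eq] at k0 k1 ⊢
  push_cast at k0 k1 ⊢
  ext i
  fin_cases i
  · simp [reflectVec, bilin, vec, affinePoint, dotProduct, Fin.sum_univ_two, k0]
    ring
  · simp [reflectVec, bilin, vec, affinePoint, dotProduct, Fin.sum_univ_two, k1]
    ring
  · simp [reflectVec, bilin, affinePoint, dotProduct, Fin.sum_univ_two]
    ring

/-- At a singular point of the curve every direction satisfies the equations of the reflection. -/
theorem IsNullForm.reflectEqs_eq_zero_of_tangent {K : Type*} [Field K]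
    {F G : MvPolynomial (Fin 3) K}
    {Θ l : Matrix (Fin 2) (Fin 2) K} {c : Fin 2 → K} {γ μ : K} {d : ℕ}
    (h : IsNullForm F Θ l c γ μ G d) {X : Fin 3 → K} (hX : tangent F X = 0) (a : K) (Q : Fin 3 → K)
    {Q' : Fin 3 → K} (hQ' : bilin Θ (vec Q') (vec Q') = Q' 2 ^ 2) :
    reflectEqs G (nullPoint l c (a • X)) Q (nullDir l γ Q') = 0 := by
  have h0 := h.eval_pderiv X 0
  have h1 := h.eval_pderiv X 1
  have t0 := congrFun hX 0
  have t1 := congrFun hX 1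
  simp only [tangent, Matrix.cons_val, Pi.zero_apply, neg_eq_zero] at t0 t1
  simp only [Fin.castSucc_zero, Fin.castSucc_one, t0, t1, mul_zero] at h0 h1
  have g0 : eval (nullPoint l c X) (pderiv 0 G) = 0 := by
    refine (mul_eq_zero.1 ?_).resolve_left h.det_ne
    linear_combination l 1 0 * h1 - l 1 1 * h0
  have g1 : eval (nullPoint l c X) (pderiv 1 G) = 0 := by
    refine (mul_eq_zero.1 ?_).resolve_left h.det_ne
    linear_combination l 0 1 * h0 - l 0 0 * h1
  have hQ := h.bilin_self (vec Q')
  rw [hQ'] at hQ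
  simp only [vec, Matrix.cons_val] at hQ
  rw [nullPoint_smul]
  ext k; fin_cases k
  · simp [reflectEqs, nullDir]
    linear_combination -hQ
  · simp [reflectEqs, eval_smul_of_isHomogeneous h.hom.pderiv, g0, g1]
  · simp [reflectEqs, eval_smul_of_isHomogeneous h.hom.pderiv, g0, g1]

/-- The complexification of a step of the classical billiard. -/
theorem IsNullForm.nullStep_of_billiardMap (hF : F.totalDegree ≤ d) {l : Matrix (Fin 2) (Fin 2) ℂ}
    {c : Fin 2 → ℂ} {γ μ : ℂ} {G : MvPolynomial (Fin 3) ℂ}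
    (h : IsNullForm (complexForm d F) 1 l c γ μ G d) {Ω : Set E2}
    (hΩ : frontier Ω ⊆ realCurve F) {z z' : E2 × E2} (hz : BilliardMap F Ω z z') (u : Fin 4 → ℂˣ) :
    NullStep G ((u 0 : ℂ) • nullPoint l c (affinePoint z.1))
      ((u 1 : ℂ) • nullDir l γ (affinePoint z.2)) ((u 2 : ℂ) • nullPoint l c (affinePoint z'.1))
      ((u 3 : ℂ) • nullDir l γ (affinePoint z'.2)) := by
  obtain ⟨hzi, hzi', t, ht, -, hx, hv⟩ := hz
  have hon : ∀ {w : E2 × E2}, w ∈ inward Ω → ∀ a : ℂ,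
      eval (a • affinePoint w.1) (complexForm d F) = 0 := fun {w} hw a => by
    have e : eval (fun i => w.1 i) F = 0 := hΩ hw.1
    rw [eval_smul_of_isHomogeneous (complexForm_isHomogeneous d F), eval_complexForm hF, e]
    simp
  have hvz := hzi.2.1
  simp only [← nullPoint_smul, ← nullDir_smul]
  constructor
  · refine h.secantEqs_eq_zero (smul_ne_zero (u 0).ne_zero (affinePoint_ne_zero _)) (fun s hs => ?_)
      (hon hzi _) (hon hzi' _) ?_
    · have h2 := congrFun hs 2
      have h0 := congrFun hs 0
      have h1 := congrFun hs 1
      simp only [affinePoint, Pi.smul_apply, smul_eq_mul, Matrix.cons_val, mul_one] at h0 h1 h2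
      have hne : (u 2 : ℂ) ≠ 0 := (u 2).ne_zero
      have e : ∀ i, (z'.1 i : ℂ) = z.1 i := by
        intro i
        apply mul_left_cancel₀ hne
        fin_cases i
        · simp only [Fin.zero_eta]; linear_combination h0 - z.1 0 * h2
        · simp only [Fin.mk_one]; linear_combination h1 - z.1 1 * h2
      -- Comparison of the last coordinates makes the scalars agree, so the two positions coincide
      -- and a positive time of flight forces zero velocity.
      have hv0 : z.2 = 0 := by
        ext i
        have := e i
        rw [hx] at this
        norm_cast at this
        simpa [ht.ne'] using this
      rw [hv0] at hvz
      simp at hvz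
    · rw [hx]
      refine (Matrix.det_fin_three _).trans ?_
      simp [affinePoint]
      ring
  -- At a singular point the gradient terms drop out and only the conic equation of the outgoing
  -- direction remains.
  · by_cases hg : grad F z'.1 = 0
    · refine h.reflectEqs_eq_zero_of_tangent ?_ _ _ ?_
      · rw [tangent_complexForm hF, hg]
        ext i; fin_cases i <;> simp
      · have := bilin_affinePoint hzi'.2.1
        have e : vec ((u 3 : ℂ) • affinePoint z'.2) = (u 3 : ℂ) • vec (affinePoint z'.2) := by
          ext i; fin_cases i <;> simp [vec]
        rw [e, bilin, Matrix.mulVec_smul, smul_dotProduct, dotProduct_smul, ← bilin, this]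
        simp; ring
    · have hn : ((‖grad F z'.1‖ ^ 2 : ℝ) : ℂ) ≠ 0 := by
        exact_mod_cast pow_ne_zero 2 (norm_ne_zero_iff.2 hg)
      have := h.reflectEqs_eq_zero (bilin_affinePoint hvz) (X := affinePoint z'.1) (u 2) (u 1)
        ((u 3 : ℂ) * ((‖grad F z'.1‖ ^ 2 : ℝ) : ℂ)⁻¹)
      rwa [reflectVec_complexForm hF, ← hv, smul_smul, mul_assoc, inv_mul_cancel₀ hn,
        mul_one] at this

end ComplexForm

theorem exists_chain_of_transGen {α : Type*} {r : α → α → Prop} {a b : α}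
    (h : Relation.TransGen r a b) :
    ∃ (n : ℕ) (z : ℕ → α), 1 ≤ n ∧ z 0 = a ∧ z n = b ∧ ∀ i < n, r (z i) (z (i + 1)) := by
  induction h with
  | single h => exact ⟨1, fun i => if i = 0 then a else _, le_rfl, rfl, rfl, by simpa using h⟩
  | @tail b c _ hbc ih =>
    obtain ⟨n, z, hn, h0, hzn, hz⟩ := ih
    refine ⟨n + 1, fun i => if i ≤ n then z i else c, by omega, by simpa using h0, by simp,
      fun i hi => ?_⟩
    rcases Nat.lt_succ_iff_lt_or_eq.1 hi with hi | rfl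
    · simpa [hi.le, Nat.succ_le_of_lt hi] using hz i hi
    · simpa [hzn] using hbc

theorem isClosed_realCurve (F : MvPolynomial (Fin 2) ℝ) : IsClosed (realCurve F) := by
  have : Continuous fun x : E2 => eval (fun i => x i) F :=
    (MvPolynomial.continuous_eval F).comp (by fun_prop)
  exact isClosed_eq this continuous_const

/-- The boundary of a component of the complement of a closed set lies in that set. -/
theorem frontier_connectedComponentIn_subset {X : Type*} [TopologicalSpace X]
    [LocallyConnectedSpace X] {T : Set X} (hT : IsClosed T) (x : X) :
    frontier (connectedComponentIn Tᶜ x) ⊆ T := by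
  intro z hz
  by_contra hzT
  have ho : ∀ y, IsOpen (connectedComponentIn Tᶜ y) := fun y => hT.isOpen_compl.connectedComponentIn
  -- Off T, the open component of `z` meets that of `x`, so they coincide and `z` is interior.
  obtain ⟨y, hyz, hyx⟩ := mem_closure_iff.1 hz.1 _ (ho z) (mem_connectedComponentIn hzT)
  apply hz.2
  rw [(ho x).interior_eq, connectedComponentIn_eq hyx, ← connectedComponentIn_eq hyz]
  exact mem_connectedComponentIn hzT

/-! ### Independent phases are not periodic. -/

section Independence

variable {k K : Type*} [Field k] [Field K] [Algebra k K]

/-- The constant coefficient of the equation of a curve may be replaced by the second coordinate of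
a point as a member of an independent family. -/
theorem algebraicIndependent_point {d : ℕ} {a : Exponents d → K} {s t y : K}
    (h : AlgebraicIndependent k
      (fun o : Option (Option (Exponents d)) => o.elim t fun o => o.elim s a))
    (hy : eval ![s, y, 1] (formOf a) = 0) :
    AlgebraicIndependent k
      (fun o : Option (Option (Option {m : Exponents d // m ≠ constExponent d})) =>
      o.elim t fun o => o.elim y fun o => o.elim s fun m => a m) := by
  let σ : Option (Option (Option {m : Exponents d // m ≠ constExponent d})) →
      Option (Option (Exponents d)) := fun o => o.elim (some (some (constExponent d))) fun o =>
    o.elim none fun o => o.elim (some none) fun m => some (some m.1)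
  have hσ : Function.Injective σ := by
    rintro (_ | _ | _ | m) (_ | _ | _ | m') h <;> simp [σ] at h ⊢
    · exact m'.2 h.symm
    · exact m.2 h
    · exact Subtype.ext h
  have h1 := h.comp σ hσ
  have e1 : (fun o : Option (Option (Exponents d)) => o.elim t fun o => o.elim s a) ∘ σ =
      fun o => o.elim (a (constExponent d)) fun o : Option (Option
        {m : Exponents d // m ≠ constExponent d}) => o.elim t fun o => o.elim s fun m => a m := by
    ext1 o
    rcases o with _ | _ | _ | m <;> rfl
  rw [e1] at h1
  have h2 := transcendental_of_mem_adjoin_insert (y := y) h1 (by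
    refine coeff_mem_of_eval_formOf_eq_zero (by simp) hy _ (fun i => ?_) fun m =>
      Algebra.subset_adjoin (Set.mem_insert_of_mem _ ⟨some (some m), rfl⟩)
    fin_cases i
    · exact Algebra.subset_adjoin (Set.mem_insert_of_mem _ ⟨some none, rfl⟩)
    · exact Algebra.subset_adjoin (Set.mem_insert _ _)
    · exact Subalgebra.one_mem _)
  let ρ : Option (Option (Option {m : Exponents d // m ≠ constExponent d})) →
      Option (Option (Option {m : Exponents d // m ≠ constExponent d})) := fun o =>
    o.elim (some none) fun o => o.elim none fun o => some (some o)
  have hρ : Function.Injective ρ := by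
    rintro (_ | _ | _ | m) (_ | _ | _ | m') h <;> simp [ρ] at h ⊢
    exact h
  have h3 := h2.comp ρ hρ
  convert h3 using 1
  ext1 o
  rcases o with _ | _ | _ | m <;> rfl

/-- An independent cosine may be replaced by the corresponding exponential. -/
theorem algebraicIndependent_of_add_inv {ι : Type*} {b : ι → K} {τ : K}
    (h : AlgebraicIndependent k (fun o : Option ι => o.elim (τ + τ⁻¹) b)) :
    AlgebraicIndependent k (fun o : Option ι => o.elim τ b) := by
  obtain ⟨h1, h2⟩ := AlgebraicIndependent.option_iff.1 h
  exact (h1.option_iff_transcendental τ).2 fun hτ => h2 (hτ.add hτ.inv)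

end Independence

/-- A phase with independent coordinates is not periodic. -/
theorem not_periodic {d : ℕ} (hd : 2 ≤ d) {F : MvPolynomial (Fin 2) ℝ} (hF : F.totalDegree ≤ d)
    {Ω : Set E2} (hΩ : frontier Ω ⊆ realCurve F) {w : E2 × E2} (hw : w.1 ∈ realCurve F)
    (hw1 : ‖w.2‖ = 1) (h : AlgebraicIndependent ℚ (fun o : Option (Option (Exponents d)) =>
      o.elim (2 * w.2 0) fun o => o.elim (w.1 0) (homogCoeff d F))) :
    w ∉ periodicPoints F Ω := by
  classical
  intro hper
  obtain ⟨n, z, hn, hz0, hzn, hz⟩ := exists_chain_of_transGen hper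
  set a : Exponents d → ℂ := Complex.ofRealHom ∘ homogCoeff d F with ha
  have hFa : complexForm d F = formOf a := map_formOf _ _
  -- For v = (cos θ, sin θ) this is e^(-iθ), with τ + τ⁻¹ = 2 cos θ.
  set τ : ℂ := w.2 0 - Complex.I * w.2 1 with hτ
  have hττ : τ * (w.2 0 + Complex.I * w.2 1) = 1 := by
    have := norm_sq_eq w.2
    rw [hw1] at this
    have e : ((w.2 0 : ℂ)) ^ 2 + (w.2 1 : ℂ) ^ 2 = 1 := by
      exact_mod_cast this.symm.trans (by norm_num)
    rw [hτ]
    linear_combination e - (w.2 1 : ℂ) ^ 2 * Complex.I_sq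
  have hinv : τ⁻¹ = w.2 0 + Complex.I * w.2 1 := (eq_inv_of_mul_eq_one_right hττ).symm
  have h1 : AlgebraicIndependent ℚ (fun o : Option (Option (Exponents d)) =>
      o.elim (τ + τ⁻¹) fun o => o.elim (w.1 0 : ℂ) a) := by
    have := h.map' (f := Complex.ofRealAm.restrictScalars ℚ) Complex.ofReal_injective
    convert this using 1
    ext1 o
    rcases o with _ | _ | m
    · change τ + τ⁻¹ = ((2 * w.2 0 : ℝ) : ℂ)
      rw [hinv, hτ]
      push_cast
      ring
    · rfl
    · rfl
  have heval : eval ![(w.1 0 : ℂ), w.1 1, 1] (formOf a) = 0 := by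
    rw [← hFa]
    refine (eval_complexForm hF w.1).trans ?_
    have : eval (fun i => w.1 i) F = 0 := hw
    rw [this, Complex.ofReal_zero]
  have h2 :=
    (algebraicIndependent_of_add_inv (algebraicIndependent_point h1 heval)).algebraicClosure
  -- The base field must contain i, since the isotropic coordinates are X₀ ± iX₁; independence
  -- persists over algebraic numbers.
  set k := algebraicClosure ℚ ℂ
  set e : Option (Option (Option {m : Exponents d // m ≠ constExponent d})) → ℂ := fun o =>
    o.elim τ fun o => o.elim (w.1 1 : ℂ) fun o => o.elim (w.1 0 : ℂ) fun m => a m with he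
  let I' : k := ⟨Complex.I, mem_algebraicClosure_iff.2 (IsAlgebraic.of_pow two_pos (by
    rw [Complex.I_sq]
    exact isAlgebraic_one.neg))⟩
  have hI' : algebraMap k ℂ I' = Complex.I := rfl
  let l : Matrix (Fin 2) (Fin 2) k := !![1, -I'; 1, I']
  have hl : l⁻¹ * l = 1 := Matrix.nonsing_inv_mul l (isUnit_iff_ne_zero.2 (by
    rw [Matrix.det_fin_two_of]
    intro h0
    have := congrArg (algebraMap k ℂ) h0
    rw [map_sub, map_mul, map_mul, map_neg, hI', map_one, map_zero] at this
    have h0 : (2 : ℂ) * Complex.I = 0 := by linear_combination this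
    simp at h0))
  -- The direction parameter goes to 1, the point to the origin, and the coefficients to those of
  -- the model.
  let val : Option (Option (Option {m : Exponents d // m ≠ constExponent d})) → ℂ := fun o =>
    o.elim 1 fun o => o.elim 0 fun o => o.elim 0 fun m =>
      coeff m.1.1 (bind₁ (linearChange (l.map (algebraMap k ℂ))) (modelCurve ℂ d))
  let x : Fin 3 →
      MvPolynomial (Option (Option (Option {m : Exponents d // m ≠ constExponent d}))) k :=
    ![X (some (some none)), X (some none), 1]
  have hfx : aeval e ∘ x = affinePoint w.1 := by
    ext i
    fin_cases i <;> simp [x, affinePoint, he]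
  obtain ⟨G, hG, hGφ, hGf⟩ := exists_generic_model hd (fun m => some (some (some m))) e val (a := a)
    (fun _ => rfl) hl (fun _ => rfl) (x := x) rfl (by
      ext i
      fin_cases i <;> simp [x, val]) (by rw [hfx]; exact heval)
  set f :
      MvPolynomial (Option (Option (Option {m : Exponents d // m ≠ constExponent d}))) k →+* ℂ :=
    (aeval e : _ →ₐ[k] ℂ).toRingHom with hf
  set lC : Matrix (Fin 2) (Fin 2) ℂ := l.map (algebraMap k ℂ) with hlC
  have hlC' : lC = !![1, -Complex.I; 1, Complex.I] := by
    ext i j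
    fin_cases i <;> fin_cases j <;> simp [hlC, l] <;> rfl
  have hform : IsNullForm (complexForm d F) 1 lC 0 1 1 (map f G) d :=
    { two_le := hd
      hom := hG.map _
      det_ne := by
        rw [hlC']
        simp
      γ_ne := one_ne_zero
      μ_ne := one_ne_zero
      symm := by simp
      form₀ := by simp [hlC']
      form₁ := by simp [hlC']
      form₂ := by simp [hlC']
      comp := by
        rw [C_1, one_mul, hFa]
        exact hGf }
  have hX0 : nullPoint lC 0 (affinePoint (z 0).1) = f ∘ nullPoint (l.map C) 0 x := by
    rw [map_nullPoint, hz0]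
    have e1 : f ∘ x = affinePoint w.1 := hfx
    have e2 : (l.map C).map f = lC := by
      ext i j
      simp [hf, hlC]
    rw [e1, e2]
    congr 1
  -- The direction has isotropic coordinates (τ, τ⁻¹, 1). Multiplication by τ makes them polynomial,
  -- with value (1, 1, 1) at τ = 1.
  have hQ0 : τ • nullDir lC 1 (affinePoint (z 0).2) = f ∘ ![X none ^ 2, 1, X none] := by
    rw [hz0, hlC']
    have e1 : f (X none) = τ := aeval_X _ _
    ext i
    fin_cases i
    · simp [nullDir, affinePoint, e1]
      rw [hτ]
      ring
    · simp [nullDir, affinePoint]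
      linear_combination hττ
    · simp [nullDir, affinePoint, e1]
  refine not_closed_chain f (eval₂Hom (algebraMap k ℂ) val) (fun b hb => ?_) hd hGφ
    (X₀ := nullPoint (l.map C) 0 x) (Q₀ := ![X none ^ 2, 1, X none]) ?_ ?_ hn
    (fun i => nullPoint lC 0 (affinePoint (z i).1)) (fun i => nullDir lC 1 (affinePoint (z i).2))
    (fun i => hform.nullPoint_ne_zero (affinePoint_ne_zero _))
    (fun i => hform.nullDir_ne_zero (affinePoint_ne_zero _))
    (fun i hi c => hform.nullStep_of_billiardMap hF hΩ (hz i hi) c) ?_ ?_ ?_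
  · have : b = 0 := h2 (hb.trans (map_zero _).symm)
    rw [this, map_zero]
  · ext i; fin_cases i <;> simp [nullPoint, x, val]
  · ext i; fin_cases i <;> simp [val]
  · intro i j
    have := congrFun hX0
    simp only [Function.comp_apply] at this
    rw [this, this, mul_comm]
  · intro i j
    have := congrFun hQ0
    simp only [Function.comp_apply, Pi.smul_apply, smul_eq_mul] at this
    rw [← this, ← this]
    ring
  · intro i j
    have := congrFun hX0
    simp only [Function.comp_apply, hz0] at this
    simp only [hzn]
    rw [this, this, mul_comm]

/-! ### Null sets on the phase surface. -/

/-- Hadamard's lemma for polynomials. -/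
theorem exists_hadamard {σ : Type*} [Fintype σ] (F : MvPolynomial σ ℝ) (p : σ → ℝ) :
    ∃ H : σ → (σ → ℝ) → ℝ, (∀ i, Continuous (H i)) ∧ (∀ i, H i p = eval p (pderiv i F)) ∧
      ∀ q, eval q F - eval p F = ∑ i, (q i - p i) * H i q := by
  classical
  induction F using MvPolynomial.induction_on with
  | C a => exact ⟨fun _ _ => 0, fun _ => continuous_const, by simp, by simp⟩
  | add F G hF hG =>
    obtain ⟨H, h1, h2, h3⟩ := hF
    obtain ⟨H', h1', h2', h3'⟩ := hG
    refine ⟨fun i q => H i q + H' i q, fun i => (h1 i).add (h1' i), by simp [h2, h2'], fun q => ?_⟩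
    simp only [map_add, mul_add, Finset.sum_add_distrib, ← h3, ← h3']
    ring
  | mul_X F j hF =>
    obtain ⟨H, h1, h2, h3⟩ := hF
    refine ⟨fun i q => H i q * q j + if i = j then eval p F else 0,
      fun i => ((h1 i).mul (continuous_apply j)).add continuous_const, fun i => ?_, fun q => ?_⟩
    · simp only [h2, Derivation.leibniz, pderiv_X, map_add, smul_eq_mul, map_mul, eval_X]
      by_cases h : i = j
      · subst h; simp; ring
      · simp [h, Ne.symm h]; ring
    · simp only [mul_add, Finset.sum_add_distrib, mul_ite, mul_zero, Finset.sum_ite_eq',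
        Finset.mem_univ, if_true, ← mul_assoc, ← Finset.sum_mul, ← h3, map_mul, eval_X]
      ring

/-- The points of the curve near which it is confined to a double cone around the horizontal
direction, with slope and radius bounded in terms of `k`. -/
def flatPart (F : MvPolynomial (Fin 2) ℝ) (k : ℕ) : Set E2 :=
  {p | p ∈ realCurve F ∧ ∀ q ∈ realCurve F, dist q p < 1 / ((k : ℝ) + 1) →
    |q 1 - p 1| ≤ k * |q 0 - p 0|}

/-- Between two points of the curve Hadamard's formula reads (Δx)H₀ + (Δy)H₁ = 0. Near p, |H₁|
exceeds half of its nonzero value there and |H₀| is bounded by M, whence |Δy| ≤ (2M/c)|Δx|; `k`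
dominates both this slope and the inverse radius. -/
theorem exists_mem_flatPart {F : MvPolynomial (Fin 2) ℝ} {p : E2} (hp : p ∈ realCurve F)
    (h : eval (fun i => p i) (pderiv 1 F) ≠ 0) : ∃ k, p ∈ flatPart F k := by
  obtain ⟨H, h1, h2, h3⟩ := exists_hadamard F (fun i => p i)
  have hc : ∀ i, Continuous fun q : E2 => |H i (fun i => q i)| := fun i =>
    ((h1 i).comp (by fun_prop)).abs
  set c := |eval (fun i => p i) (pderiv 1 F)| with hcdef
  have hc0 : 0 < c := abs_pos.2 h
  have ev1 : ∀ᶠ q : E2 in nhds p, c / 2 < |H 1 (fun i => q i)| :=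
    (hc 1).continuousAt.eventually (lt_mem_nhds (by beta_reduce; rw [h2]; linarith))
  set M := |H 0 (fun i => p i)| + 1 with hM
  have hM0 : 0 < M := by positivity
  have ev0 : ∀ᶠ q : E2 in nhds p, |H 0 (fun i => q i)| < M :=
    (hc 0).continuousAt.eventually (gt_mem_nhds (by beta_reduce; rw [hM]; linarith))
  obtain ⟨δ, hδ, hb⟩ := Metric.eventually_nhds_iff.1 (ev1.and ev0)
  obtain ⟨k, hk⟩ := exists_nat_gt (max (2 * M / c) (1 / δ))
  refine ⟨k, hp, fun q hq hqp => ?_⟩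
  have hk1 : 2 * M / c < k := (le_max_left _ _).trans_lt hk
  have hk2 : 1 / δ < k := (le_max_right _ _).trans_lt hk
  have hkδ : 1 / ((k : ℝ) + 1) ≤ δ := by
    rw [div_le_iff₀ (by positivity)]
    rw [div_lt_iff₀ hδ] at hk2
    nlinarith
  obtain ⟨hq1, hq0⟩ := hb (hqp.trans_le hkδ)
  have e := h3 (fun i => q i)
  have ep : eval (fun i => p i) F = 0 := hp
  have eq : eval (fun i => q i) F = 0 := hq
  rw [ep, eq, Fin.sum_univ_two, sub_zero] at e
  have e' : |q 1 - p 1| * |H 1 (fun i => q i)| = |q 0 - p 0| * |H 0 (fun i => q i)| := by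
    rw [← abs_mul, ← abs_mul, ← abs_neg]
    congr 1
    linear_combination e
  have i1 : |q 1 - p 1| * (c / 2) ≤ |q 0 - p 0| * M := by
    calc _ ≤ |q 1 - p 1| * |H 1 (fun i => q i)| := by gcongr
      _ = _ := e'
      _ ≤ _ := by gcongr
  rw [div_lt_iff₀ hc0] at hk1
  have i2 : |q 0 - p 0| * (2 * M) ≤ |q 0 - p 0| * (k * c) := by gcongr
  refine le_of_mul_le_mul_right ?_ hc0
  linarith

/-- A point of a curve without vertical asymptotes is a zero of some iterated derivative in the
vertical direction, but not of the next one. -/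
theorem exists_iterate_pderiv_ne_zero {d : ℕ} {F : MvPolynomial (Fin 2) ℝ} {p : Fin 2 → ℝ}
    (hF : ∀ m : Fin 2 →₀ ℕ, d < m.degree → coeff m F = 0)
    (hd : coeff (Finsupp.single 1 d) F ≠ 0) (hp : eval p F = 0) :
    ∃ j, eval p ((pderiv 1)^[j] F) = 0 ∧ eval p (pderiv 1 ((pderiv 1)^[j] F)) ≠ 0 := by
  induction d generalizing F with
  | zero =>
    have : F = C (coeff 0 F) := by
      ext m
      rw [coeff_C]
      split_ifs with h
      · rw [h]
      · exact hF m (Nat.pos_of_ne_zero fun h0 => h ((Finsupp.degree_eq_zero_iff _).1 h0).symm)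
    rw [this, eval_C] at hp
    simp [hp] at hd
  | succ d ih =>
    by_cases h : eval p (pderiv 1 F) = 0
    -- Differentiation lowers the degree bound by one and multiplies the coefficient of yᵈ⁺¹ by d +
    -- 1, so the pure power of y survives to the end.
    · obtain ⟨j, h1, h2⟩ := ih (F := pderiv 1 F) (fun m hm => by
        rw [coeff_pderiv, hF _ (by rw [map_add, Finsupp.degree_single]; omega), zero_mul]) (by
        rw [coeff_pderiv, ← Finsupp.single_add]
        exact mul_ne_zero hd (by positivity)) h
      exact ⟨j + 1, h1, h2⟩
    · exact ⟨0, hp, h⟩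

theorem dist_le_add (p q : E2) : dist p q ≤ |p 0 - q 0| + |p 1 - q 1| := by
  rw [EuclideanSpace.dist_eq, Fin.sum_univ_two, Real.dist_eq, Real.dist_eq]
  refine Real.sqrt_le_iff.2 ⟨by positivity, ?_⟩
  nlinarith [abs_nonneg (p 0 - q 0), abs_nonneg (p 1 - q 1)]

/-- The unit vectors at the points of a flat piece of the curve form a null set if their coordinates
do. -/
theorem hausdorffMeasure_flatPart (F : MvPolynomial (Fin 2) ℝ) (k : ℕ) (y : E2) {R : Set (ℝ × ℝ)}
    (hR : volume R = 0) :
    Measure.hausdorffMeasure 2 {w : E2 × E2 | w.1 ∈ flatPart F k ∩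
      Metric.ball y (1 / (2 * ((k : ℝ) + 1))) ∧
      ∃ θ : ℝ, w.2 = !₂[Real.cos θ, Real.sin θ] ∧ (w.1 0, θ) ∈ R} = 0 := by
  set M := {w : E2 × E2 | w.1 ∈ flatPart F k ∩ Metric.ball y (1 / (2 * ((k : ℝ) + 1))) ∧
      ∃ θ : ℝ, w.2 = !₂[Real.cos θ, Real.sin θ] ∧ (w.1 0, θ) ∈ R}
  choose θ hθ using fun w : M => w.2.2
  set ρ : M → ℝ × ℝ := fun w => (w.1.1 0, θ w)
  -- The balls are small enough for the cone condition to apply to any two positions. It bounds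
  -- their distance by (k + 1)r and that of the unit vectors by 2r, where r is the distance of the
  -- parameters; k + 2 covers both.
  have hρ : AntilipschitzWith (k + 2) ρ := by
    refine AntilipschitzWith.of_le_mul_dist fun w w' => ?_
    have hr : 0 ≤ dist (ρ w) (ρ w') := dist_nonneg
    have h0 : |w.1.1 0 - w'.1.1 0| ≤ dist (ρ w) (ρ w') := le_max_left _ _
    have h1 : |θ w - θ w'| ≤ dist (ρ w) (ρ w') := le_max_right _ _
    have hball : dist w.1.1 w'.1.1 < 1 / ((k : ℝ) + 1) := by
      calc _ ≤ dist w.1.1 y + dist w'.1.1 y := dist_triangle_right _ _ _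
        _ < 1 / (2 * ((k : ℝ) + 1)) + 1 / (2 * ((k : ℝ) + 1)) := add_lt_add w.2.1.2 w'.2.1.2
        _ = _ := by field_simp; norm_num
    have h2 := w'.2.1.1.2 _ w.2.1.1.1 hball
    have h3 : (k : ℝ) * |w.1.1 0 - w'.1.1 0| ≤ k * dist (ρ w) (ρ w') := by gcongr
    push_cast
    refine max_le ?_ ?_
    · refine (dist_le_add _ _).trans ?_
      linarith
    · have h4 := Real.abs_cos_sub_cos_le (θ w) (θ w')
      have h5 := Real.abs_sin_sub_sin_le (θ w) (θ w')
      have h6 : 0 ≤ (k : ℝ) * dist (ρ w) (ρ w') := by positivity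
      refine (dist_le_add _ _).trans ?_
      rw [(hθ w).1, (hθ w').1]
      simp only [Matrix.cons_val_zero, Matrix.cons_val_one]
      linarith
  have h1 := hρ.le_hausdorffMeasure_image (d := 2) (by norm_num) Set.univ
  have h2 : (Measure.hausdorffMeasure 2 : Measure (ℝ × ℝ)) (ρ '' Set.univ) = 0 := by
    rw [hausdorffMeasure_prod_real]
    refine measure_mono_null ?_ hR
    rintro _ ⟨w, -, rfl⟩
    exact (hθ w).2
  rw [h2, mul_zero] at h1
  have h3 := (isometry_subtype_coe (s := M)).hausdorffMeasure_image (d := 2) (Or.inl (by norm_num))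
    Set.univ
  rw [Set.image_univ, Subtype.range_coe, nonpos_iff_eq_zero.1 h1] at h3
  exact h3

theorem countable_mvPolynomial {σ R : Type} [Countable σ] [Countable R] [CommSemiring R] :
    Countable (MvPolynomial σ R) := by
  rw [← Cardinal.mk_le_aleph0_iff]
  exact MvPolynomial.cardinalMk_le_max.trans (by simp)

theorem countable_two_mul_cos_preimage {s : Set ℝ} (hs : s.Countable) :
    {θ : ℝ | 2 * Real.cos θ ∈ s}.Countable := by
  have : {θ : ℝ | 2 * Real.cos θ ∈ s} = ⋃ t ∈ s, {θ : ℝ | 2 * Real.cos θ = t} := by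
    ext θ; simp
  rw [this]
  refine hs.biUnion fun t _ => ?_
  by_cases h : ∃ θ₀, 2 * Real.cos θ₀ = t
  · obtain ⟨θ₀, rfl⟩ := h
    refine ((Set.countable_range fun n : ℤ => 2 * (n : ℝ) * Real.pi + θ₀).union
      (Set.countable_range fun n : ℤ => 2 * (n : ℝ) * Real.pi - θ₀)).mono fun θ hθ => ?_
    obtain ⟨n, hn | hn⟩ := Real.cos_eq_cos_iff.1 (mul_left_cancel₀ two_ne_zero hθ).symm
    · exact Or.inl ⟨n, hn.symm⟩
    · exact Or.inr ⟨n, hn.symm⟩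
  · convert Set.countable_empty
    ext θ
    simpa using fun h' => h ⟨θ, h'⟩

theorem countable_isAlgebraic_adjoin {ι : Type} [Countable ι] (a : ι → ℝ) :
    {x : ℝ | IsAlgebraic (Algebra.adjoin ℚ (Set.range a)) x}.Countable := by
  have : Countable (Algebra.adjoin ℚ (Set.range a)) := by
    rw [Algebra.adjoin_range_eq_range_aeval]
    have := countable_mvPolynomial (σ := ι) (R := ℚ)
    exact (Set.countable_range (aeval a : MvPolynomial ι ℚ → ℝ)).to_subtype
  exact Algebraic.countable _ _

/-- Almost every pair `(s, θ)` makes `s` and `2 cos θ` independent over a given countable family. -/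
theorem volume_not_algebraicIndependent {ι : Type} [Countable ι] {a : ι → ℝ}
    (ha : AlgebraicIndependent ℚ a) :
    volume {z : ℝ × ℝ | ¬ AlgebraicIndependent ℚ
      (fun o : Option (Option ι) => o.elim (2 * Real.cos z.2) fun o => o.elim z.1 a)} = 0 := by
  have := countable_mvPolynomial (σ := Option (Option ι)) (R := ℚ)
  have hm : MeasurableSet {z : ℝ × ℝ | ¬ AlgebraicIndependent ℚ
      (fun o : Option (Option ι) => o.elim (2 * Real.cos z.2) fun o => o.elim z.1 a)} := by
    have e : {z : ℝ × ℝ | ¬ AlgebraicIndependent ℚ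
        (fun o : Option (Option ι) => o.elim (2 * Real.cos z.2) fun o => o.elim z.1 a)} =
        ⋃ g : {g : MvPolynomial (Option (Option ι)) ℚ // g ≠ 0},
          {z | aeval (fun o : Option (Option ι) => o.elim (2 * Real.cos z.2)
            fun o => o.elim z.1 a) g.1 = 0} := by
      ext z
      simp [algebraicIndependent_iff, and_comm]
    rw [e]
    refine MeasurableSet.iUnion fun g => IsClosed.measurableSet (isClosed_eq ?_ continuous_const)
    simp only [aeval_def, ← eval_map]
    refine (MvPolynomial.continuous_eval _).comp (continuous_pi fun o => ?_)
    rcases o with _ | _ | i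
    · exact (Real.continuous_cos.comp continuous_snd).const_mul 2
    · exact continuous_fst
    · exact continuous_const
  -- Fubini: for s outside the countable set of numbers algebraic over the coefficients, only
  -- countably many θ make 2 cos θ algebraic over the coefficients and s.
  rw [Measure.volume_eq_prod, Measure.measure_prod_null hm]
  have hae : ∀ᵐ s : ℝ, s ∉ {x : ℝ | IsAlgebraic (Algebra.adjoin ℚ (Set.range a)) x} :=
    measure_eq_zero_iff_ae_notMem.1 ((countable_isAlgebraic_adjoin a).measure_zero _)
  filter_upwards [hae] with s hs
  have h1 : AlgebraicIndependent ℚ (fun o : Option ι => o.elim s a) :=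
    (ha.option_iff_transcendental s).2 hs
  refine measure_mono_null ?_ ((countable_two_mul_cos_preimage
    (countable_isAlgebraic_adjoin (fun o : Option ι => o.elim s a))).measure_zero _)
  intro θ hθ
  by_contra h
  exact hθ ((h1.option_iff_transcendental _).2 h)

theorem exists_eq_cos_sin {v : E2} (hv : ‖v‖ = 1) :
    ∃ θ : ℝ, v = !₂[Real.cos θ, Real.sin θ] := by
  have h := norm_sq_eq v
  rw [hv] at h
  set z : ℂ := ⟨v 0, v 1⟩
  have hz : ‖z‖ = 1 := by
    rw [Complex.norm_def, Complex.normSq_apply, Real.sqrt_eq_one]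
    linarith
  refine ⟨z.arg, ?_⟩
  rw [Complex.cos_arg (norm_ne_zero_iff.1 (by rw [hz]; exact one_ne_zero)), Complex.sin_arg, hz]
  ext i
  fin_cases i <;> simp [z]

/-- The periodic points of the classical billiard in a domain bounded by a curve with independent
coefficients form a null set. -/
theorem hausdorffMeasure_periodicPoints {d : ℕ} (hd : 2 ≤ d) {F : MvPolynomial (Fin 2) ℝ}
    (hF : F.totalDegree ≤ d) (ha : AlgebraicIndependent ℚ
      (fun m : {m : Fin 2 →₀ ℕ // m.degree ≤ d} => coeff m.1 F)) {Ω : Set E2}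
    (hΩ : frontier Ω ⊆ realCurve F) :
    Measure.hausdorffMeasure 2 (periodicPoints F Ω) = 0 := by
  have ha' : AlgebraicIndependent ℚ (homogCoeff d F) := ha.comp _ (affineExponent_bijective d).1
  have hR := volume_not_algebraicIndependent ha'
  set R := {z : ℝ × ℝ | ¬ AlgebraicIndependent ℚ (fun o : Option (Option (Exponents d)) =>
    o.elim (2 * Real.cos z.2) fun o => o.elim z.1 (homogCoeff d F))}
  refine measure_mono_null (t := ⋃ (j : ℕ) (k : ℕ) (i : ℕ),
    {w : E2 × E2 | w.1 ∈ flatPart ((pderiv 1)^[j] F) k ∩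
      Metric.ball (TopologicalSpace.denseSeq E2 i) (1 / (2 * ((k : ℝ) + 1))) ∧
      ∃ θ : ℝ, w.2 = !₂[Real.cos θ, Real.sin θ] ∧ (w.1 0, θ) ∈ R}) ?_
    (measure_iUnion_null fun j => measure_iUnion_null fun k => measure_iUnion_null fun i =>
      hausdorffMeasure_flatPart _ _ _ hR)
  intro w hw
  obtain ⟨w', hw', -⟩ := Relation.TransGen.head'_iff.1 hw
  have hwT : w.1 ∈ realCurve F := hΩ hw'.1.1
  have hw1 : ‖w.2‖ = 1 := hw'.1.2.1
  obtain ⟨θ, hθ⟩ := exists_eq_cos_sin hw1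
  -- Where the tangent is vertical or the curve is singular, x₀ need not be a Lipschitz parameter on
  -- F = 0. Such a point lies on a flat part of the zero set of an iterated y-derivative, so
  -- countably many flat parts cover the whole curve.
  obtain ⟨j, hj, hj'⟩ := exists_iterate_pderiv_ne_zero (d := d) (p := fun i => w.1 i)
    (fun m hm => coeff_eq_zero_of_totalDegree_lt (hF.trans_lt hm))
    (ha.ne_zero ⟨Finsupp.single 1 d, by simp⟩) hwT
  obtain ⟨k, hk⟩ := exists_mem_flatPart (p := w.1) hj hj'
  obtain ⟨i, hi⟩ := (TopologicalSpace.denseRange_denseSeq E2).exists_dist_lt w.1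
    (ε := 1 / (2 * ((k : ℝ) + 1))) (by positivity)
  simp only [Set.mem_iUnion]
  refine ⟨j, k, i, ⟨hk, hi⟩, θ, hθ, fun hgen => ?_⟩
  refine not_periodic hd hF hΩ hwT hw1 ?_ hw
  have e : w.2 0 = Real.cos θ := by rw [hθ]; rfl
  rw [e]
  exact hgen

end AlgBilliard

end

theorem theorem1p5 (d : ℕ) (hd : 2 ≤ d) :
    (∀ n : ℕ, 1 ≤ n →
      ¬ AlgBilliard.IsReflective (AlgBilliard.fermatHyperbola d)
        (1 : Matrix (Fin 2) (Fin 2) ℂ) n) ∧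
    (∀ Θ : Matrix (Fin 2) (Fin 2) ℂ, Θ.IsSymm → Θ.det ≠ 0 → ∀ n : ℕ, 1 ≤ n →
      ¬ AlgBilliard.IsReflective (AlgBilliard.genericCurve d)
        (Θ.map (algebraMap ℂ (AlgBilliard.GenericField d))) n) ∧
    (∀ F : MvPolynomial (Fin 2) ℝ, F.totalDegree = d →
      AlgebraicIndependent ℚ
        (fun m : {m : Fin 2 →₀ ℕ // m.degree ≤ d} => MvPolynomial.coeff m.1 F) →
      ∀ (Ω : Set AlgBilliard.E2) (x₀ : AlgBilliard.E2),
        x₀ ∈ (AlgBilliard.realCurve F)ᶜ →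
        Ω = connectedComponentIn (AlgBilliard.realCurve F)ᶜ x₀ →
        Bornology.IsBounded Ω →
        MeasureTheory.Measure.hausdorffMeasure 2 (AlgBilliard.periodicPoints F Ω) = 0) := by
  refine ⟨fun n hn => AlgBilliard.not_isReflective_fermat hd hn,
    fun Θ hΘ hdet n hn => AlgBilliard.not_isReflective_generic hd hΘ hdet hn,
    fun F hF ha Ω x₀ _ hΩ _ => AlgBilliard.hausdorffMeasure_periodicPoints hd hF.le ha ?_⟩
  rw [hΩ]
  exact AlgBilliard.frontier_connectedComponentIn_subset (AlgBilliard.isClosed_realCurve F) x₀
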